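/- Let $\mathbb K$ be either $\mathbb R$ or the torus $\mathbb T=\mathbb R/2\pi\mathbb Z$, let $\mathcal P(\mathbb K)$ be its Borel probability measures, and let $d_W(\nu_1,\nu_2)=\sup\{\int\psi\,d(\nu_2-\nu_1):\psi\in C_b(\mathbb K),\ \|\psi\|_{\mathrm{Lip}}\le 1\}\in[0,\infty]$. Let $V$ assign to each $\nu\in\mathcal P(\mathbb K)$ a function $V[\nu]:\mathbb K\to\mathbb R$, and suppose that there are constants $C_1,C_2,C_3,C_4>0$ such that for all $\nu,\nu_1,\nu_2\in\mathcal P(\mathbb K)$ and $x,y\in\mathbb K$: (A1) $|V[\nu](x)|\le C_1$; (A2) $|V[\nu](x)-V[\nu](y)|\le C_2|x-y|$; (A3) $\|V[\nu_1]-V[\nu_2]\|_{L^\infty(\mathbb K)}\le C_3\,d_W(\nu_1,\nu_2)$; (A4) $V[\nu]$ is differentiable and $\|\partial_xV[\nu]\|_{\mathrm{Lip}(\mathbb K)}\le C_4$. Let $\mu_0\in\mathcal P(\mathbb K)$ be compactly supported and absolutely continuous with respect to Lebesgue measure, with a density $\rho_0\in BV(\mathbb K)$. A measure-valued solution of $\partial_t\mu+\partial_x(V[\mu]\mu)=0$,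 $\mu|_{t=0}=\mu_0$, is a curve $[0,\infty)\ni t\mapsto\mu_t\in\mathcal P(\mathbb K)$ such that $t\mapsto\int\phi\,d\mu_t$ is continuous for every $\phi\in C_0(\mathbb K)$, and such that for every $\phi\in C_c^\infty(\mathbb K\times[0,\infty))$ the time integral below exists and $$\int_0^\infty\!\!\int_{\mathbb K}\big(\partial_t\phi+V[\mu_t]\,\partial_x\phi\big)\,d\mu_t\,dt+\int_{\mathbb K}\phi(x,0)\,d\mu_0(x)=0 .$$ Consider a uniform mesh of $\mathbb K$ with cells $[x_{i-1/2},x_{i+1/2})$ of length $\Delta x$ and midpoints $x_i$; here $i\in\mathbb Z$ if $\mathbb K=\mathbb R$, and $i\in\mathbb Z/N\mathbb Z$ with $\Delta x=2\pi/N$ if $\mathbb K=\mathbb T$. Let $\Delta t>0$, $t^n=n\Delta t$. The (unstaggered, one-dimensional) Lax–Friedrichs method, written for cell densities, is $$\mu_i^0=\frac1{\Delta x}\int_{x_{i-1/2}}^{x_{i+1/2}}\rho_0\,dx,\qquad \mu_i^{n+1}=\frac{\mu_{i-1}^n+\mu_{i+1}^n}{2}-\Delta t\,\frac{V[\mu^n](x_{i+1})\,\mu_{i+1}^n-V[\mu^n](x_{i-1})\,\mu_{i-1}^n}{2\Delta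 x},$$ where the argument $\mu^n$ of $V$ is either, at every step, the atomic measure $\sum_i\Delta x\,\mu_i^n\delta_{x_i}$, or, at every step, the measure with the piecewise constant density $\hat\mu^n=\sum_i\mu_i^n\mathbf 1_{[x_{i-1/2},x_{i+1/2})}$. Set $$\hat\mu_t^{\Delta x}=\frac{t^{n+1}-t}{\Delta t}\hat\mu^n+\frac{t-t^n}{\Delta t}\hat\mu^{n+1}\qquad\text{for }t\in[t^n,t^{n+1}).$$ Then there is a measure-valued solution $\mu$ with initial value $\mu_0$, it is unique, and $\mu_t$ is absolutely continuous with respect to Lebesgue measure for every $t\ge0$. Moreover, for either choice of the argument of $V$, for every $\lambda_0>0$ and every $T>0$, $$\sup_{t\in[0,T]}\big\|\hat\mu_t^{\Delta x}-\mu_t\big\|_{L^1(\mathbb K)}\to0\qquad\text{as }\Delta x\to0,$$ uniformly over the position of the mesh and over all $\Delta t$ that satisfy the CFL condition $\lambda_0\le\Delta t/\Delta x\le C_1^{-1}$. -/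

import Mathlib

open MeasureTheory Set
open scoped ENNReal ContDiff BoundedContinuousFunction ZeroAtInfty

namespace NonlocalLaw

/-- The torus `ℝ / 2πℤ`, with the arc-length metric and Lebesgue measure of total mass `2π`. -/
abbrev Torus : Type := AddCircle (2 * Real.pi)

instance : Fact (0 < 2 * Real.pi) := ⟨Real.two_pi_pos⟩

/-! The spatial domain `K` is the line (with `p : ℝ → K` the identity) or the torus (with `p` the
quotient map `torusProj`). The map `p` is what derivatives on `K` are defined with. -/

/-- The projection of the line onto the torus. -/
noncomputable def torusProj (x : ℝ) : Torus := (x : Torus)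

section Continuous

variable {K : Type} [NormedAddCommGroup K]

/-- The derivative at `x` of a function on the line (`p = id`) or on the torus
(`p = torusProj`). -/
noncomputable def dx (p : ℝ → K) (f : K → ℝ) (x : K) : ℝ :=
  deriv (fun h : ℝ => f (x + p h)) 0

/-- The 1-Wasserstein distance, as a supremum over bounded functions that are Lipschitz with
constant 1; it may be infinite. -/
noncomputable def dW [MeasurableSpace K] (ν₁ ν₂ : Measure K) : ℝ≥0∞ :=
  ⨆ (ψ : K →ᵇ ℝ) (_ : LipschitzWith 1 ψ), ENNReal.ofReal (∫ x, ψ x ∂ν₂ - ∫ x, ψ x ∂ν₁)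

/-! A velocity field assigns a function `V ν` on `K` to each probability measure `ν`. It is written
as a function of all measures, but only its values at probability measures are restricted. -/

/-- Uniform boundedness. -/
def VelocityBounded [MeasurableSpace K] (V : Measure K → K → ℝ) (C₁ : ℝ) : Prop :=
  ∀ ν : Measure K, IsProbabilityMeasure ν → ∀ x, |V ν x| ≤ C₁

/-- Uniform Lipschitz continuity in space. -/
def VelocityLipschitzSpace [MeasurableSpace K] (V : Measure K → K → ℝ) (C₂ : ℝ) : Prop :=
  ∀ ν : Measure K, IsProbabilityMeasure ν → ∀ x y, |V ν x - V ν y| ≤ C₂ * dist x y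

/-- Lipschitz continuity in the measure. -/
def VelocityLipschitzMeasure [MeasurableSpace K] (V : Measure K → K → ℝ) (C₃ : ℝ) : Prop :=
  ∀ ν₁ ν₂ : Measure K, IsProbabilityMeasure ν₁ → IsProbabilityMeasure ν₂ →
    ∀ x, ENNReal.ofReal |V ν₁ x - V ν₂ x| ≤ ENNReal.ofReal C₃ * dW ν₁ ν₂

/-- The space derivative exists and is uniformly Lipschitz. -/
def VelocityDerivLipschitz [MeasurableSpace K] (p : ℝ → K) (V : Measure K → K → ℝ) (C₄ : ℝ) :
    Prop :=
  ∀ ν : Measure K, IsProbabilityMeasure ν →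
    (∀ x, DifferentiableAt ℝ (fun h : ℝ => V ν (x + p h)) 0) ∧
    ∀ x y, |dx p (V ν) x - dx p (V ν) y| ≤ C₄ * dist x y

/-- Test functions: restrictions to `t ≥ 0` of smooth compactly supported functions on `K × ℝ`. -/
def IsTestFunction (p : ℝ → K) (φ : K × ℝ → ℝ) : Prop :=
  HasCompactSupport φ ∧ ContDiff ℝ ∞ (fun z : ℝ × ℝ => φ (p z.1, z.2))

/-- Measure-valued solutions of `∂ₜμ + ∂ₓ(V[μ]μ) = 0` with initial value `μ₀`: curves of
probability measures, weakly continuous on `[0, ∞)`, that satisfy the equation in the sense of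
distributions. The integrability clause says that the time integral is meaningful (only the values
`μ t` with `t ≥ 0` matter). -/
def IsMeasureValuedSolution [MeasurableSpace K] (p : ℝ → K) (V : Measure K → K → ℝ)
    (μ₀ : ProbabilityMeasure K) (μ : ℝ → ProbabilityMeasure K) : Prop :=
  (∀ φ : C₀(K, ℝ), ContinuousOn (fun t => ∫ x, φ x ∂(μ t : Measure K)) (Ici 0)) ∧
  ∀ φ : K × ℝ → ℝ, IsTestFunction p φ →
    IntegrableOn (fun t => ∫ x, (deriv (fun s => φ (x, s)) t
        + V (μ t) x * dx p (fun y => φ (y, t)) x) ∂(μ t : Measure K)) (Ioi 0) ∧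
    (∫ t in Ioi (0 : ℝ), ∫ x, (deriv (fun s => φ (x, s)) t
        + V (μ t) x * dx p (fun y => φ (y, t)) x) ∂(μ t : Measure K))
      + ∫ x, φ (x, 0) ∂(μ₀ : Measure K) = 0

end Continuous

/-- `ρ` is the density of the probability measure `μ` with respect to Lebesgue measure. -/
def IsDensity {K : Type} [MeasureSpace K] (μ : ProbabilityMeasure K) (ρ : K → ℝ) : Prop :=
  0 ≤ᵐ[volume] ρ ∧ (μ : Measure K) = volume.withDensity (fun x => ENNReal.ofReal (ρ x))

/-- `BV(ℝ)`: integrable functions that agree almost everywhere with one of finite variation. -/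
def MemBVLine (ρ : ℝ → ℝ) : Prop :=
  Integrable ρ ∧ ∃ g : ℝ → ℝ, g =ᵐ[volume] ρ ∧ BoundedVariationOn g univ

/-- `BV` of the torus; the variation is the one over a full period. -/
def MemBVTorus (ρ : Torus → ℝ) : Prop :=
  Integrable ρ ∧ ∃ g : Torus → ℝ, g =ᵐ[volume] ρ ∧
    BoundedVariationOn (fun x : ℝ => g (torusProj x)) (Icc 0 (2 * Real.pi))

/-- Data of a mesh on `K` with cells labelled by `ι`; the meshes used are `lineMesh` and
`torusMesh`. -/
structure Mesh (K ι : Type) where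
  /-- the mesh width `Δx` -/
  width : ℝ
  /-- the cell `[x_{i-1/2}, x_{i+1/2})` -/
  cell : ι → Set K
  /-- the midpoint `x_i` -/
  center : ι → K

/-- The uniform mesh of the line with width `h` and cells `[a + i h, a + (i + 1) h)`. -/
noncomputable def lineMesh (a h : ℝ) : Mesh ℝ ℤ where
  width := h
  cell i := Ico (a + i * h) (a + (i + 1) * h)
  center i := a + (i + 1 / 2) * h

/-- The uniform mesh of the torus with `N` cells of width `h = 2π / N`, the first of which starts
at `a`. The labels are integers modulo `N`. -/
noncomputable def torusMesh (N : ℕ) (a : ℝ) : Mesh Torus (ZMod N) where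
  width := 2 * Real.pi / N
  cell i := torusProj '' Ico (a + i.val * (2 * Real.pi / N)) (a + (i.val + 1) * (2 * Real.pi / N))
  center i := torusProj (a + (i.val + 1 / 2) * (2 * Real.pi / N))

/-- The two measures that cell densities `m` can be identified with when they are inserted in `V`:
`∑ᵢ Δx mᵢ δ_{xᵢ}` (`atoms`) or the one with piecewise constant density `∑ᵢ mᵢ 1_{cell i}`
(`cells`). -/
inductive Realization
  | atoms
  | cells

section Scheme

variable {K ι : Type}

/-- The piecewise constant function `∑ᵢ mᵢ 1_{cell i}`. -/
noncomputable def Mesh.stepFun (M : Mesh K ι) (m : ι → ℝ) (x : K) : ℝ :=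
  ∑' i, (M.cell i).indicator (fun _ => m i) x

/-- The measure that the cell densities `m` represent. -/
noncomputable def Mesh.realize [MeasureSpace K] (M : Mesh K ι) (m : ι → ℝ) :
    Realization → Measure K
  | .atoms => Measure.sum fun i => ENNReal.ofReal (M.width * m i) • Measure.dirac (M.center i)
  | .cells => volume.withDensity fun x => ENNReal.ofReal (M.stepFun m x)

/-- The cell densities after `n` steps of length `τ` of the unstaggered Lax–Friedrichs method,
started from the cell averages of `ρ₀`. -/
noncomputable def laxFriedrichs [MeasureSpace K] [AddGroupWithOne ι] (V : Measure K → K → ℝ)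
    (r : Realization) (M : Mesh K ι) (τ : ℝ) (ρ₀ : K → ℝ) : ℕ → ι → ℝ
  | 0 => fun i => 1 / M.width * ∫ x in M.cell i, ρ₀ x
  | n + 1 => fun i =>
      let m := laxFriedrichs V r M τ ρ₀ n
      let v : ι → ℝ := fun j => V (M.realize m r) (M.center j)
      (m (i - 1) + m (i + 1)) / 2
        - τ * ((v (i + 1) * m (i + 1) - v (i - 1) * m (i - 1)) / (2 * M.width))

/-- The approximate solution: piecewise constant in space and, between `tⁿ = n τ` and `tⁿ⁺¹`,
linear in time. -/
noncomputable def approxSolution [MeasureSpace K] [AddGroupWithOne ι] (V : Measure K → K → ℝ)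
    (r : Realization) (M : Mesh K ι) (τ : ℝ) (ρ₀ : K → ℝ) (t : ℝ) (x : K) : ℝ :=
  let n := ⌊t / τ⌋₊
  ((n + 1) * τ - t) / τ * M.stepFun (laxFriedrichs V r M τ ρ₀ n) x
    + (t - n * τ) / τ * M.stepFun (laxFriedrichs V r M τ ρ₀ (n + 1)) x

/-- `sup_{0 ≤ t ≤ T} ‖u t - dμ_t/dx‖_{L¹(K)}`. -/
noncomputable def supL1Dist [MeasureSpace K] (T : ℝ) (u : ℝ → K → ℝ)
    (μ : ℝ → ProbabilityMeasure K) : ℝ≥0∞ :=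
  ⨆ t ∈ Icc 0 T,
    eLpNorm (fun x => u t x - ((μ t : Measure K).rnDeriv volume x).toReal) 1 volume

end Scheme

end NonlocalLaw

open NonlocalLaw

namespace NonlocalLaw

open Filter Topology

set_option linter.unusedSectionVars false

/-! Solutions and numerical approximations are compared through one object: a sequence of
probability measures that satisfies, up to an error κ, the explicit Euler discretization of the weak
form, ∫ψ dα_{n+1} ≈ ∫ψ dα_n + τ∫V[α_n]ψ' dα_n, for bounded ψ with |ψ'| ≤ L and Lip(ψ') ≤ M, the
error being κ(L+M)τ (`EulerConsistent`). Up to O(τ²) the right side is ∫ψ∘Φ dα_n with Φ(x) = x +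
τV[α_n](x), and by (A2) and (A4) composition with Φ enlarges L and M only by a factor 1+O(τ) when L
≤ M. With (A3) controlling the change of Φ when the measure changes, a discrete Gronwall argument in
the weight L+εM shows that consistent sequences which start close in the Wasserstein distance remain
close (`EulerConsistent.wClose`). Compactness is not needed.

A solution sampled at the times nτ is consistent with κ = O(τ)
(`IsMeasureValuedSolution.eulerConsistent`), so two solutions with the same initial value coincide.
The Lax–Friedrichs densities, read as atoms at the midpoints, follow a random walk to neighbouring
cells with transition weights in [0,1] by the CFL condition. The mean displacement is exactly τ
times the velocity used, and the squared jump h² is O(hτ) because τ/h ≥ λ₀, so the scheme is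
consistent with κ = O(h) (`Mesh.IsUniform.eulerConsistent_laxFriedrichs`). Hence the scheme
converges to the solution in the Wasserstein distance. Existence is independent of the scheme: the
displacement of the characteristics solves an ODE with bounded Lipschitz right side in the Banach
space of bounded continuous functions (`exists_isMeasureValuedSolution`).

Convergence in L¹ comes from the variation. One step multiplies the total variation by at most
1+2C₂τ and adds C₄τ (`tv_lfStep_le`), so the approximations have uniformly bounded variation, used
as the bound ‖u(·+s) − u‖₁ ≤ Bs. Such a bound interpolates with the Wasserstein distance to control
the L¹ norm (`HasBVDensity.integral_abs_sub_le`). The approximations are then Cauchy in L¹ and their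
limit is a density of μ_t (`absolutelyContinuous_and_eLpNorm_le`). Line and torus are treated
together, through a norm-compatible surjective homomorphism p : ℝ → K. -/

/-- The properties of the projections `id : ℝ → ℝ` and `torusProj` that relate the metric and the
group structure of `K` to those of the line. -/
structure IsLineCover {K : Type} [NormedAddCommGroup K] (p : ℝ → K) : Prop where
  map_add : ∀ s t, p (s + t) = p s + p t
  norm_le : ∀ s, ‖p s‖ ≤ |s|
  exists_lift : ∀ x, ∃ s, p s = x ∧ |s| = ‖x‖

/-! ### Calculus along the projection p -/

namespace IsLineCover

variable {K : Type} [NormedAddCommGroup K] {p : ℝ → K}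

lemma map_zero (hp : IsLineCover p) : p 0 = 0 := by
  have := hp.map_add 0 0
  simpa using this

lemma map_neg (hp : IsLineCover p) (s : ℝ) : p (-s) = -p s := by
  have := hp.map_add (-s) s
  rw [neg_add_cancel, hp.map_zero] at this
  exact eq_neg_of_add_eq_zero_left this.symm

lemma map_sub (hp : IsLineCover p) (s t : ℝ) : p (s - t) = p s - p t := by
  rw [sub_eq_add_neg, hp.map_add, hp.map_neg, ← sub_eq_add_neg]

lemma lipschitz (hp : IsLineCover p) : LipschitzWith 1 p :=
  LipschitzWith.of_dist_le_mul fun s t => by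
    rw [dist_eq_norm, ← hp.map_sub, Real.dist_eq]
    simpa using hp.norm_le (s - t)

lemma continuous (hp : IsLineCover p) : Continuous p := hp.lipschitz.continuous

lemma dist_map_le (hp : IsLineCover p) (s t : ℝ) : dist (p s) (p t) ≤ |s - t| := by
  rw [dist_eq_norm, ← hp.map_sub]; exact hp.norm_le _

lemma surjective (hp : IsLineCover p) : Function.Surjective p := fun x =>
  let ⟨s, hs, _⟩ := hp.exists_lift x
  ⟨s, hs⟩

/-- Two points differ by the projection of a number whose modulus is their distance. -/
lemma exists_shift (hp : IsLineCover p) (x y : K) : ∃ s, y = x + p s ∧ |s| = dist x y := by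
  obtain ⟨s, hs, h⟩ := hp.exists_lift (y - x)
  exact ⟨s, by rw [hs]; abel, by rw [h, dist_comm, dist_eq_norm]⟩

lemma dist_add_self_le (hp : IsLineCover p) (x : K) (s : ℝ) : dist (x + p s) x ≤ |s| := by
  rw [dist_eq_norm, add_sub_cancel_left]; exact hp.norm_le s

/-- Derivatives on K are taken at parameter 0; additivity of p moves them to an arbitrary parameter,
so that one-variable calculus applies along q ↦ x + p q. -/
lemma hasDerivAt_shift (hp : IsLineCover p) {ψ : K → ℝ} {d : ℝ} {x : K} {s : ℝ}
    (h : HasDerivAt (fun q : ℝ => ψ (x + p s + p q)) d 0) :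
    HasDerivAt (fun q : ℝ => ψ (x + p q)) d s := by
  have h1 : HasDerivAt (fun q : ℝ => q - s) 1 s := (hasDerivAt_id s).sub_const s
  have h2 : HasDerivAt (fun q : ℝ => ψ (x + p s + p q)) d (s - s) := by simpa using h
  have := HasDerivAt.comp (h := fun q : ℝ => q - s) s h2 h1
  rw [mul_one] at this
  refine this.congr_of_eventuallyEq (Eventually.of_forall fun q => ?_)
  simp [Function.comp, add_assoc, ← hp.map_add]

lemma hasDerivAt_dx (hp : IsLineCover p) {ψ : K → ℝ}
    (hd : ∀ x, DifferentiableAt ℝ (fun q : ℝ => ψ (x + p q)) 0) (x : K) (s : ℝ) :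
    HasDerivAt (fun q : ℝ => ψ (x + p q)) (dx p ψ (x + p s)) s :=
  hp.hasDerivAt_shift (hd (x + p s)).hasDerivAt

/-- A function whose derivative along `p` is bounded is Lipschitz. -/
lemma abs_sub_le_of_dx (hp : IsLineCover p) {ψ : K → ℝ} {L : ℝ}
    (hd : ∀ x, DifferentiableAt ℝ (fun q : ℝ => ψ (x + p q)) 0) (hL : ∀ x, |dx p ψ x| ≤ L)
    (x y : K) : |ψ x - ψ y| ≤ L * dist x y := by
  obtain ⟨s, rfl, hs⟩ := hp.exists_shift x y
  have := Convex.norm_image_sub_le_of_norm_hasDerivWithin_le (f := fun q : ℝ => ψ (x + p q))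
    (f' := fun q => dx p ψ (x + p q)) (s := univ) (x := s) (y := 0) (C := L)
    (fun q _ => (hp.hasDerivAt_dx hd x q).hasDerivWithinAt) (fun q _ => hL _) convex_univ
    (mem_univ _) (mem_univ _)
  simpa [hp.map_zero, Real.norm_eq_abs, ← hs] using this

lemma abs_dx_le_of_lipschitz (hp : IsLineCover p) {ψ : K → ℝ} {L : ℝ} (hL0 : 0 ≤ L)
    (hL : ∀ x y, |ψ x - ψ y| ≤ L * dist x y) (x : K) : |dx p ψ x| ≤ L := by
  have h : LipschitzWith (Real.toNNReal L) (fun q : ℝ => ψ (x + p q)) :=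
    LipschitzWith.of_dist_le_mul fun s t => by
      rw [Real.coe_toNNReal _ hL0, Real.dist_eq]
      refine (hL _ _).trans (mul_le_mul_of_nonneg_left ?_ hL0)
      rw [dist_add_left]; exact hp.dist_map_le s t
  have := norm_deriv_le_of_lipschitz (x₀ := (0 : ℝ)) h
  rwa [Real.coe_toNNReal _ hL0, Real.norm_eq_abs] at this

end IsLineCover

/-! ### Test functions with Lipschitz derivative -/

section C11

variable {K : Type} [NormedAddCommGroup K] {p : ℝ → K}

/-- Bounded functions with derivative bounded by `L` and Lipschitz with constant `M`. -/
structure IsC11 (p : ℝ → K) (L M : ℝ) (ψ : K → ℝ) : Prop where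
  bdd : ∃ C, ∀ x, |ψ x| ≤ C
  diff : ∀ x, DifferentiableAt ℝ (fun q : ℝ => ψ (x + p q)) 0
  dx_le : ∀ x, |dx p ψ x| ≤ L
  dx_lip : ∀ x y, |dx p ψ x - dx p ψ y| ≤ M * dist x y

lemma continuous_of_abs_sub_le {f : K → ℝ} {L : ℝ} (h : ∀ x y, |f x - f y| ≤ L * dist x y) :
    Continuous f :=
  LipschitzWith.continuous (K := Real.toNNReal L) <| LipschitzWith.of_dist_le_mul fun x y => by
    rw [Real.dist_eq]
    exact (h x y).trans (mul_le_mul_of_nonneg_right (Real.le_coe_toNNReal L) dist_nonneg)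

namespace IsC11

variable {L M : ℝ} {ψ : K → ℝ}

lemma nonneg_left (h : IsC11 p L M ψ) : 0 ≤ L := (abs_nonneg _).trans (h.dx_le 0)

lemma lip (h : IsC11 p L M ψ) (hp : IsLineCover p) (x y : K) : |ψ x - ψ y| ≤ L * dist x y :=
  hp.abs_sub_le_of_dx h.diff h.dx_le x y

lemma continuous (h : IsC11 p L M ψ) (hp : IsLineCover p) : Continuous ψ :=
  continuous_of_abs_sub_le (h.lip hp)

lemma continuous_dx (h : IsC11 p L M ψ) : Continuous (dx p ψ) :=
  continuous_of_abs_sub_le h.dx_lip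

lemma mono (h : IsC11 p L M ψ) {L' M' : ℝ} (hL : L ≤ L') (hM : M ≤ M') : IsC11 p L' M' ψ :=
  ⟨h.bdd, h.diff, fun x => (h.dx_le x).trans hL, fun x y =>
    (h.dx_lip x y).trans (mul_le_mul_of_nonneg_right hM dist_nonneg)⟩

lemma neg (h : IsC11 p L M ψ) : IsC11 p L M (fun x => -ψ x) := by
  have e : ∀ x, dx p (fun x => -ψ x) x = -dx p ψ x := fun x => (h.diff x).hasDerivAt.neg.deriv
  refine ⟨?_, fun x => (h.diff x).neg, fun x => ?_, fun x y => ?_⟩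
  · obtain ⟨C, hC⟩ := h.bdd
    exact ⟨C, fun x => by rw [abs_neg]; exact hC x⟩
  · rw [e, abs_neg]; exact h.dx_le x
  · rw [e, e, neg_sub_neg, abs_sub_comm]; exact h.dx_lip x y

/-- Mean value inequality for ψ minus its linear part on [-|s|, |s|], where the derivative is at
most M|s|. The factor 1/2 is given up, as only the order matters. -/
lemma taylor (h : IsC11 p L M ψ) (hp : IsLineCover p) (hM : 0 ≤ M) (x : K) (s : ℝ) :
    |ψ (x + p s) - ψ x - s * dx p ψ x| ≤ M * s ^ 2 := by
  have hder : ∀ q : ℝ, HasDerivAt (fun q : ℝ => ψ (x + p q) - q * dx p ψ x)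
      (dx p ψ (x + p q) - dx p ψ x) q := fun q => by
    have := (hp.hasDerivAt_dx h.diff x q).sub ((hasDerivAt_id q).mul_const (dx p ψ x))
    rw [one_mul] at this
    exact this
  have := Convex.norm_image_sub_le_of_norm_hasDerivWithin_le
    (s := Icc (-|s|) |s|) (x := 0) (y := s) (C := M * |s|)
    (fun q _ => (hder q).hasDerivWithinAt) (fun q hq => ?_) (convex_Icc _ _)
    ⟨by simp, by simp⟩ ⟨neg_abs_le s, le_abs_self s⟩
  · simp only [hp.map_zero, add_zero, zero_mul, sub_zero, Real.norm_eq_abs] at this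
    calc _ = |ψ (x + p s) - s * dx p ψ x - ψ x| := by ring_nf
      _ ≤ M * |s| * |s| := this
      _ = M * s ^ 2 := by rw [mul_assoc, abs_mul_abs_self, sq]
  · rw [Real.norm_eq_abs]
    refine (h.dx_lip _ _).trans (mul_le_mul_of_nonneg_left ?_ hM)
    exact (hp.dist_add_self_le x q).trans (abs_le.2 hq)

/-- The class is stable under composition with the Euler step of a velocity in the class. -/
lemma comp_step (h : IsC11 p L M ψ) (hp : IsLineCover p) (hM : 0 ≤ M) {b : K → ℝ} {C₂ C₄ τ : ℝ}
    (hb : IsC11 p C₂ C₄ b) (hτ : 0 ≤ τ) :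
    IsC11 p (L * (1 + C₂ * τ)) (M * (1 + C₂ * τ) ^ 2 + L * C₄ * τ)
      (fun x => ψ (x + p (τ * b x))) := by
  have hC₂ := hb.nonneg_left
  have hL := h.nonneg_left
  have hder : ∀ x, HasDerivAt (fun q : ℝ => ψ (x + p q + p (τ * b (x + p q))))
      (dx p ψ (x + p (τ * b x)) * (1 + τ * dx p b x)) 0 := fun x => by
    have h1 : HasDerivAt (fun q : ℝ => q + τ * b (x + p q)) (1 + τ * dx p b x) 0 :=
      (hasDerivAt_id 0).add ((hb.diff x).hasDerivAt.const_mul τ)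
    have h2 := hp.hasDerivAt_dx h.diff x (0 + τ * b (x + p 0))
    have h3 := h2.comp (0 : ℝ) h1
    simp only [hp.map_zero, add_zero, zero_add] at h3
    refine h3.congr_of_eventuallyEq (Eventually.of_forall fun q => ?_)
    simp [Function.comp, add_assoc, hp.map_add]
  have e : ∀ x, dx p (fun x => ψ (x + p (τ * b x))) x
      = dx p ψ (x + p (τ * b x)) * (1 + τ * dx p b x) := fun x => (hder x).deriv
  have hfac : ∀ x, |1 + τ * dx p b x| ≤ 1 + C₂ * τ := fun x => by
    calc |1 + τ * dx p b x| ≤ |1| + |τ * dx p b x| := abs_add_le _ _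
      _ ≤ 1 + C₂ * τ := by
        rw [abs_one, abs_mul, abs_of_nonneg hτ, mul_comm]
        gcongr; exact hb.dx_le x
  refine ⟨?_, fun x => (hder x).differentiableAt, fun x => ?_, fun x y => ?_⟩
  · obtain ⟨C, hC⟩ := h.bdd
    exact ⟨C, fun x => hC _⟩
  · rw [e, abs_mul]
    exact mul_le_mul (h.dx_le _) (hfac x) (abs_nonneg _) hL
  · rw [e, e]
    have hd : dist (x + p (τ * b x)) (y + p (τ * b y)) ≤ (1 + C₂ * τ) * dist x y := by
      calc _ ≤ dist x y + dist (p (τ * b x)) (p (τ * b y)) := dist_add_add_le _ _ _ _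
        _ ≤ dist x y + |τ * b x - τ * b y| := by gcongr; exact hp.dist_map_le _ _
        _ ≤ dist x y + τ * (C₂ * dist x y) := by
          rw [← mul_sub, abs_mul, abs_of_nonneg hτ]
          gcongr; exact hb.lip hp x y
        _ = _ := by ring
    set A := dx p ψ (x + p (τ * b x))
    set B := dx p ψ (y + p (τ * b y))
    have hAB : |A - B| ≤ M * ((1 + C₂ * τ) * dist x y) :=
      (h.dx_lip _ _).trans (mul_le_mul_of_nonneg_left hd hM)
    calc |A * (1 + τ * dx p b x) - B * (1 + τ * dx p b y)|
        = |(A - B) * (1 + τ * dx p b x) + B * (τ * (dx p b x - dx p b y))| := by ring_nf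
      _ ≤ |(A - B)| * |1 + τ * dx p b x| + |B| * (τ * |dx p b x - dx p b y|) := by
        refine (abs_add_le _ _).trans ?_
        rw [abs_mul, abs_mul, abs_mul, abs_of_nonneg hτ]
      _ ≤ (M * ((1 + C₂ * τ) * dist x y)) * (1 + C₂ * τ) + L * (τ * (C₄ * dist x y)) := by
        have := hb.dx_lip x y
        have := hfac x
        have : |B| ≤ L := h.dx_le _
        gcongr
      _ = _ := by ring

end IsC11

/-- Averaging over intervals of half-length `ε` regularizes Lipschitz functions. -/
lemma exists_isC11_approx (hp : IsLineCover p) {ψ : K → ℝ} {C : ℝ} (hC : ∀ x, |ψ x| ≤ C)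
    (hψ : ∀ x y, |ψ x - ψ y| ≤ dist x y) {ε : ℝ} (hε : 0 < ε) :
    ∃ ψ' : K → ℝ, IsC11 p 1 (1 / ε) ψ' ∧ ∀ x, |ψ' x - ψ x| ≤ ε := by
  have hcont : Continuous ψ := continuous_of_abs_sub_le (L := 1) (by simpa using hψ)
  have hc : ∀ x, Continuous fun s => ψ (x + p s) := fun x =>
    hcont.comp (continuous_const.add hp.continuous)
  set ψ' : K → ℝ := fun x => (2 * ε)⁻¹ * ∫ s in -ε..ε, ψ (x + p s) with hψ'
  have hder : ∀ x, HasDerivAt (fun q : ℝ => ψ' (x + p q))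
      ((2 * ε)⁻¹ * (ψ (x + p ε) - ψ (x + p (-ε)))) 0 := fun x => by
    -- Translating the window turns the average into a difference of two primitives in q, so its
    -- derivative is a difference quotient of ψ, with no differentiability of ψ required.
    have e : (fun q : ℝ => ψ' (x + p q)) = fun q : ℝ => (2 * ε)⁻¹ *
        ((∫ s in (0 : ℝ)..q + ε, ψ (x + p s)) - ∫ s in (0 : ℝ)..q + -ε, ψ (x + p s)) := by
      ext q
      simp only [hψ']
      rw [intervalIntegral.integral_interval_sub_left ((hc x).intervalIntegrable _ _)
        ((hc x).intervalIntegrable _ _)]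
      have := intervalIntegral.integral_comp_add_left (a := -ε) (b := ε)
        (fun s => ψ (x + p s)) q
      rw [← this]
      simp [add_assoc, hp.map_add]
    rw [e]
    refine HasDerivAt.const_mul _ (HasDerivAt.sub ?_ ?_)
    · have h1 : HasDerivAt (fun q : ℝ => q + ε) 1 0 := (hasDerivAt_id 0).add_const ε
      have h2 := intervalIntegral.integral_hasDerivAt_right ((hc x).intervalIntegrable 0 (0 + ε))
        ((hc x).stronglyMeasurableAtFilter _ _) (hc x).continuousAt
      have := HasDerivAt.comp (0 : ℝ) h2 h1
      rw [mul_one, zero_add] at this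
      exact this
    · have h1 : HasDerivAt (fun q : ℝ => q + -ε) 1 0 := (hasDerivAt_id 0).add_const (-ε)
      have h2 := intervalIntegral.integral_hasDerivAt_right ((hc x).intervalIntegrable 0 (0 + -ε))
        ((hc x).stronglyMeasurableAtFilter _ _) (hc x).continuousAt
      have := HasDerivAt.comp (0 : ℝ) h2 h1
      rw [mul_one, zero_add] at this
      exact this
  have e : ∀ x, dx p ψ' x = (2 * ε)⁻¹ * (ψ (x + p ε) - ψ (x + p (-ε))) := fun x => (hder x).deriv
  have hbd : ∀ x, |ψ' x - ψ x| ≤ ε := fun x => by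
    have : ψ' x - ψ x = (2 * ε)⁻¹ * ∫ s in -ε..ε, (ψ (x + p s) - ψ x) := by
      rw [intervalIntegral.integral_sub ((hc x).intervalIntegrable _ _) (by simp)]
      simp only [hψ', intervalIntegral.integral_const, smul_eq_mul]
      field_simp; ring
    rw [this, abs_mul, abs_of_pos (by positivity)]
    have h2 := intervalIntegral.norm_integral_le_of_norm_le_const (a := -ε) (b := ε)
      (f := fun s => ψ (x + p s) - ψ x) (C := ε) (fun s hs => by
        rw [uIoc_of_le (by linarith)] at hs
        exact (hψ _ _).trans ((hp.dist_add_self_le x s).trans (abs_le.2 ⟨hs.1.le, hs.2⟩)))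
    rw [Real.norm_eq_abs, abs_of_pos (by linarith : 0 < ε - -ε)] at h2
    calc _ ≤ (2 * ε)⁻¹ * (ε * (ε - -ε)) := by gcongr
      _ = ε := by field_simp; ring
  refine ⟨ψ', ⟨⟨C + ε, fun x => ?_⟩, fun x => (hder x).differentiableAt, fun x => ?_,
    fun x y => ?_⟩, hbd⟩
  · have := hbd x; have := hC x
    rw [abs_le] at *; constructor <;> linarith
  · rw [e, abs_mul, abs_of_pos (by positivity)]
    have h1 : |ψ (x + p ε) - ψ (x + p (-ε))| ≤ 2 * ε := by
      refine (hψ _ _).trans ?_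
      rw [dist_add_left]
      refine (hp.dist_map_le _ _).trans (le_of_eq ?_)
      rw [abs_of_pos] <;> linarith
    calc _ ≤ (2 * ε)⁻¹ * (2 * ε) := by gcongr
      _ = 1 := by field_simp
  · rw [e, e, ← mul_sub, abs_mul, abs_of_pos (by positivity : 0 < (2 * ε)⁻¹)]
    have h1 := hψ (x + p ε) (y + p ε)
    have h2 := hψ (x + p (-ε)) (y + p (-ε))
    rw [dist_add_right] at h1 h2
    have : |ψ (x + p ε) - ψ (x + p (-ε)) - (ψ (y + p ε) - ψ (y + p (-ε)))| ≤ 2 * dist x y := by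
      rw [abs_le] at *; constructor <;> linarith
    calc _ ≤ (2 * ε)⁻¹ * (2 * dist x y) := by gcongr
      _ = _ := by field_simp

end C11

/-! ### Wasserstein closeness and stability of Euler-consistent sequences -/

section WClose

variable {K : Type} [NormedAddCommGroup K] [MeasurableSpace K] [BorelSpace K] {p : ℝ → K}

lemma integrable_of_continuous_bdd {ν : Measure K} [IsFiniteMeasure ν] {f : K → ℝ}
    (hf : Continuous f) {C : ℝ} (hC : ∀ x, |f x| ≤ C) : Integrable f ν :=
  Integrable.of_bound hf.aestronglyMeasurable C (Eventually.of_forall hC)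

lemma abs_integral_le_of_forall {ν : Measure K} [IsProbabilityMeasure ν] {f : K → ℝ} {c : ℝ}
    (h : ∀ x, |f x| ≤ c) : |∫ x, f x ∂ν| ≤ c := by
  simpa using norm_integral_le_of_norm_le_const (μ := ν) (f := f) (Eventually.of_forall h)

lemma abs_integral_sub_le {ν : Measure K} [IsProbabilityMeasure ν] {f g : K → ℝ} {c : ℝ}
    (hf : Integrable f ν) (hg : Integrable g ν) (h : ∀ x, |f x - g x| ≤ c) :
    |∫ x, f x ∂ν - ∫ x, g x ∂ν| ≤ c := by
  rw [← integral_sub hf hg]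
  exact abs_integral_le_of_forall h

/-- The Wasserstein distance of `ν₁` and `ν₂` is at most `r`, in terms of real integrals. -/
def WClose (ν₁ ν₂ : Measure K) (r : ℝ) : Prop :=
  ∀ ψ : K → ℝ, (∃ C, ∀ x, |ψ x| ≤ C) → (∀ x y, |ψ x - ψ y| ≤ dist x y) →
    |∫ x, ψ x ∂ν₁ - ∫ x, ψ x ∂ν₂| ≤ r

namespace WClose

variable {ν₁ ν₂ ν₃ : Measure K} {r s : ℝ}

lemma symm (h : WClose ν₁ ν₂ r) : WClose ν₂ ν₁ r := fun ψ hb hl => by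
  rw [abs_sub_comm]; exact h ψ hb hl

lemma trans (h : WClose ν₁ ν₂ r) (h' : WClose ν₂ ν₃ s) : WClose ν₁ ν₃ (r + s) :=
  fun ψ hb hl => (abs_sub_le _ _ _).trans (add_le_add (h ψ hb hl) (h' ψ hb hl))

lemma mono (h : WClose ν₁ ν₂ r) (hrs : r ≤ s) : WClose ν₁ ν₂ s :=
  fun ψ hb hl => (h ψ hb hl).trans hrs

lemma nonneg (h : WClose ν₁ ν₂ r) : 0 ≤ r :=
  (abs_nonneg _).trans (h (fun _ => 0) ⟨0, by simp⟩ (by simp))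

lemma refl (ν : Measure K) : WClose ν ν 0 := fun ψ _ _ => by simp

lemma abs_integral_le (h : WClose ν₁ ν₂ r) {L : ℝ} (hL : 0 ≤ L) {ψ : K → ℝ}
    (hb : ∃ C, ∀ x, |ψ x| ≤ C) (hl : ∀ x y, |ψ x - ψ y| ≤ L * dist x y) :
    |∫ x, ψ x ∂ν₁ - ∫ x, ψ x ∂ν₂| ≤ L * r := by
  have hr := h.nonneg
  -- Rescaling by L + δ instead of L covers the case L = 0.
  have key : ∀ δ : ℝ, 0 < δ → |∫ x, ψ x ∂ν₁ - ∫ x, ψ x ∂ν₂| ≤ (L + δ) * r := fun δ hδ => by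
    have hpos : 0 < L + δ := by linarith
    have := h (fun x => (L + δ)⁻¹ * ψ x) ?_ ?_
    · rw [integral_const_mul, integral_const_mul, ← mul_sub, abs_mul,
        abs_of_pos (inv_pos.2 hpos), inv_mul_le_iff₀ hpos] at this
      exact this
    · obtain ⟨C, hC⟩ := hb
      refine ⟨(L + δ)⁻¹ * C, fun x => ?_⟩
      rw [abs_mul, abs_of_pos (inv_pos.2 hpos)]
      exact mul_le_mul_of_nonneg_left (hC x) (inv_pos.2 hpos).le
    · intro x y
      rw [← mul_sub, abs_mul, abs_of_pos (inv_pos.2 hpos), inv_mul_le_iff₀ hpos]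
      exact (hl x y).trans (mul_le_mul_of_nonneg_right (by linarith) dist_nonneg)
  refine le_of_forall_pos_le_add fun e he => ?_
  refine (key (e / (r + 1)) (by positivity)).trans ?_
  rw [add_mul]
  gcongr
  rw [div_mul_eq_mul_div, div_le_iff₀ (by positivity)]
  nlinarith

lemma dW_le (h : WClose ν₁ ν₂ r) : dW ν₁ ν₂ ≤ ENNReal.ofReal r := by
  refine iSup₂_le fun ψ hψ => ENNReal.ofReal_le_ofReal ?_
  have := h.symm ψ ⟨‖ψ‖, fun x => ψ.norm_coe_le_norm x⟩ fun x y => by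
    simpa [Real.dist_eq] using hψ.dist_le_mul x y
  exact (le_abs_self _).trans this

/-- Thickened indicators are Lipschitz and decrease to the indicator of a closed set, and the closed
sets are a π-system generating the Borel sets. -/
lemma eq_of_forall [IsFiniteMeasure ν₁] [IsFiniteMeasure ν₂] (h : ∀ r > 0, WClose ν₁ ν₂ r) :
    ν₁ = ν₂ := by
  have h0 : ∀ ψ : K → ℝ, (∃ C, ∀ x, |ψ x| ≤ C) → ∀ L : ℝ, 0 ≤ L →
      (∀ x y, |ψ x - ψ y| ≤ L * dist x y) → ∫ x, ψ x ∂ν₁ = ∫ x, ψ x ∂ν₂ := by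
    intro ψ hb L hL hl
    rw [← sub_eq_zero, ← abs_nonpos_iff]
    refine le_of_forall_pos_le_add fun e he => ?_
    refine ((h (e / (L + 1)) (by positivity)).abs_integral_le hL hb hl).trans ?_
    rw [zero_add, mul_div_assoc', div_le_iff₀ (by positivity)]
    nlinarith
  have hF : ∀ F : Set K, IsClosed F → ν₁ F = ν₂ F := by
    intro F hF
    have hd : ∀ n : ℕ, (0 : ℝ) < 1 / (n + 1) := fun n => by positivity
    have e : ∀ n : ℕ, ∫ x, (thickenedIndicator (hd n) F x : ℝ) ∂ν₁
        = ∫ x, (thickenedIndicator (hd n) F x : ℝ) ∂ν₂ := fun n => by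
      refine h0 _ ⟨1, fun x => ?_⟩ (((1 : ℝ) / (n + 1)).toNNReal⁻¹ : NNReal) (NNReal.coe_nonneg _)
        fun x y => ?_
      · rw [abs_of_nonneg (NNReal.coe_nonneg _)]
        exact_mod_cast thickenedIndicator_le_one (hd n) F x
      · exact (lipschitzWith_thickenedIndicator (hd n) F).dist_le_mul x y
    have t1 := tendsto_integral_thickenedIndicator_of_isClosed ν₁ hF hd
      tendsto_one_div_add_atTop_nhds_zero_nat
    have t2 := tendsto_integral_thickenedIndicator_of_isClosed ν₂ hF hd
      tendsto_one_div_add_atTop_nhds_zero_nat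
    have := tendsto_nhds_unique t1 (t2.congr fun n => (e n).symm)
    exact (measureReal_eq_measureReal_iff).1 this
  have hgen : (inferInstance : MeasurableSpace K) = MeasurableSpace.generateFrom {s | IsClosed s} := by
    rw [BorelSpace.measurable_eq (α := K), borel_eq_generateFrom_isClosed]
  exact ext_of_generate_finite _ hgen (fun s hs t ht _ => IsClosed.inter hs ht)
    (fun s hs => hF s hs) (hF univ isClosed_univ)

/-- Regularizing a 1-Lipschitz function at scale ε gives L = 1 and M = 1/ε and costs ε in each of
the two integrals. A one-sided bound suffices because the class is closed under negation. -/
lemma of_isC11 (hp : IsLineCover p) [IsProbabilityMeasure ν₁] [IsProbabilityMeasure ν₂] {ε : ℝ}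
    (hε : 0 < ε)
    (h : ∀ ψ, IsC11 p 1 (1 / ε) ψ → ∫ x, ψ x ∂ν₁ - ∫ x, ψ x ∂ν₂ ≤ r) :
    WClose ν₁ ν₂ (r + 2 * ε) := by
  intro ψ ⟨C, hC⟩ hl
  obtain ⟨ψ', hψ', happ⟩ := exists_isC11_approx hp hC hl hε
  have h1 := h ψ' hψ'
  have h2 := h _ hψ'.neg
  rw [integral_neg, integral_neg] at h2
  obtain ⟨C', hC'⟩ := hψ'.bdd
  have hcψ : Continuous ψ := continuous_of_abs_sub_le (L := 1) (by simpa using hl)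
  have i1 := abs_integral_sub_le (ν := ν₁)
    (integrable_of_continuous_bdd (hψ'.continuous hp) hC') (integrable_of_continuous_bdd hcψ hC) happ
  have i2 := abs_integral_sub_le (ν := ν₂)
    (integrable_of_continuous_bdd (hψ'.continuous hp) hC') (integrable_of_continuous_bdd hcψ hC) happ
  rw [abs_le] at *
  constructor <;> linarith

end WClose

/-- The assumptions on the velocity field. -/
structure IsVelocity (p : ℝ → K) (V : Measure K → K → ℝ) (C₁ C₂ C₃ C₄ : ℝ) : Prop where
  pos₁ : 0 < C₁
  pos₂ : 0 < C₂
  pos₃ : 0 < C₃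
  pos₄ : 0 < C₄
  bounded : VelocityBounded V C₁
  lipSpace : VelocityLipschitzSpace V C₂
  lipMeasure : VelocityLipschitzMeasure V C₃
  derivLip : VelocityDerivLipschitz p V C₄

namespace IsVelocity

variable {V : Measure K → K → ℝ} {C₁ C₂ C₃ C₄ : ℝ}

lemma isC11 (hV : IsVelocity p V C₁ C₂ C₃ C₄) (hp : IsLineCover p) (ν : Measure K)
    [hν : IsProbabilityMeasure ν] : IsC11 p C₂ C₄ (V ν) :=
  ⟨⟨C₁, hV.bounded ν hν⟩, (hV.derivLip ν hν).1,
    hp.abs_dx_le_of_lipschitz hV.pos₂.le (hV.lipSpace ν hν), (hV.derivLip ν hν).2⟩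

lemma abs_sub_le (hV : IsVelocity p V C₁ C₂ C₃ C₄) {ν₁ ν₂ : Measure K}
    [h₁ : IsProbabilityMeasure ν₁] [h₂ : IsProbabilityMeasure ν₂] {r : ℝ} (h : WClose ν₁ ν₂ r)
    (x : K) : |V ν₁ x - V ν₂ x| ≤ C₃ * r := by
  have h3 := hV.pos₃
  have hr := h.nonneg
  have := (hV.lipMeasure ν₁ ν₂ h₁ h₂ x).trans (mul_le_mul_right h.dW_le _)
  rw [← ENNReal.ofReal_mul h3.le] at this
  exact (ENNReal.ofReal_le_ofReal_iff (by positivity)).1 this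

lemma continuous (hV : IsVelocity p V C₁ C₂ C₃ C₄) (hp : IsLineCover p) (ν : Measure K)
    [IsProbabilityMeasure ν] : Continuous (V ν) := (hV.isC11 hp ν).continuous hp

/-- The Euler step agrees with the transport term up to second order in the step. -/
lemma abs_integral_step_sub_le (hV : IsVelocity p V C₁ C₂ C₃ C₄) (hp : IsLineCover p)
    (ν : Measure K) [hν : IsProbabilityMeasure ν] {L M τ : ℝ} (hM : 0 ≤ M) {ψ : K → ℝ}
    (h : IsC11 p L M ψ) :
    |∫ x, ψ (x + p (τ * V ν x)) ∂ν - ∫ x, ψ x ∂ν - τ * ∫ x, V ν x * dx p ψ x ∂ν|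
      ≤ M * (τ ^ 2 * C₁ ^ 2) := by
  obtain ⟨C, hC⟩ := h.bdd
  have hVc := hV.continuous hp ν
  have hψc := h.continuous hp
  have i1 : Integrable (fun x => ψ (x + p (τ * V ν x))) ν :=
    integrable_of_continuous_bdd (hψc.comp (continuous_id.add
      (hp.continuous.comp (continuous_const.mul hVc)))) fun x => hC _
  have i2 : Integrable ψ ν := integrable_of_continuous_bdd hψc hC
  have i3 : Integrable (fun x => V ν x * dx p ψ x) ν :=
    integrable_of_continuous_bdd (hVc.mul h.continuous_dx) (C := C₁ * L) fun x => by
      rw [abs_mul]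
      exact mul_le_mul (hV.bounded ν hν x) (h.dx_le x) (abs_nonneg _) hV.pos₁.le
  have e : ∫ x, ψ (x + p (τ * V ν x)) ∂ν - ∫ x, ψ x ∂ν - τ * ∫ x, V ν x * dx p ψ x ∂ν
      = ∫ x, (ψ (x + p (τ * V ν x)) - ψ x - τ * (V ν x * dx p ψ x)) ∂ν := by
    rw [← integral_const_mul, ← integral_sub i1 i2]
    exact (integral_sub (i1.sub i2) (i3.const_mul τ)).symm
  rw [e]
  refine abs_integral_le_of_forall fun x => ?_
  have := h.taylor hp hM x (τ * V ν x)
  rw [mul_assoc] at this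
  refine this.trans (mul_le_mul_of_nonneg_left ?_ hM)
  rw [mul_pow]
  gcongr 1
  rw [sq_le_sq, abs_of_pos hV.pos₁]
  exact hV.bounded ν hν x

end IsVelocity

/-- Up to the error `κ`, the sequence `α` satisfies an explicit Euler discretization, with step
`τ`, of the weak form of the conservation law. -/
def EulerConsistent (p : ℝ → K) (V : Measure K → K → ℝ) (τ κ : ℝ) (α : ℕ → Measure K) : Prop :=
  ∀ n ψ L M, 0 ≤ M → IsC11 p L M ψ →
    |∫ x, ψ x ∂α (n + 1) - ∫ x, ψ x ∂α n - τ * ∫ x, V (α n) x * dx p ψ x ∂α n| ≤ κ * (L + M) * τ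

/-- Stability: consistent sequences that start close to each other remain close. -/
theorem EulerConsistent.wClose {V : Measure K → K → ℝ} {C₁ C₂ C₃ C₄ : ℝ}
    (hV : IsVelocity p V C₁ C₂ C₃ C₄) (hp : IsLineCover p) {τ κ d ε : ℝ} (hτ : 0 < τ)
    (hτ1 : τ ≤ 1) (hκ : τ * C₁ ^ 2 ≤ κ) (hε : 0 < ε) (hε1 : ε ≤ 1) {α β : ℕ → Measure K}
    [∀ n, IsProbabilityMeasure (α n)] [∀ n, IsProbabilityMeasure (β n)]
    (hα : EulerConsistent p V τ κ α) (hβ : EulerConsistent p V τ κ β)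
    (h0 : WClose (α 0) (β 0) d) (n : ℕ) :
    WClose (α n) (β n) (2 * (Real.exp ((2 * C₂ + C₂ ^ 2 + C₄ + 2 * C₃) * (n * τ))
      * (d + n * τ * (2 * C₃ * ε + 6 * κ / ε))) + 2 * ε) := by
  have h1 := hV.pos₁; have h2 := hV.pos₂; have h3 := hV.pos₃; have h4 := hV.pos₄
  have hd := h0.nonneg
  have hκ0 : 0 ≤ κ := le_trans (by positivity) hκ
  set c₀ := 2 * C₂ + C₂ ^ 2 + C₄ with hc₀
  set q := 2 * C₃ * ε + 6 * κ / ε with hq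
  -- Chosen to satisfy e (n+1) ≥ (1 + (c₀ + 2C₃)τ) e n + τq, the recursion that the induction
  -- produces.
  set e : ℕ → ℝ := fun n => Real.exp ((c₀ + 2 * C₃) * (n * τ)) * (d + n * τ * q) with he
  have hc₀0 : 0 ≤ c₀ := by positivity
  have hq0 : 0 ≤ q := by positivity
  have he0 : ∀ n, 0 ≤ e n := fun n => by positivity
  have hεinv : 1 ≤ 1 / ε := by rw [le_div_iff₀ hε]; linarith
  -- For L = 1 and M = 1/ε the weight L + εM is 2; this converts the inductive bound into the
  -- Wasserstein bound needed to compare velocities in the next step.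
  have wc : ∀ n, (∀ ψ L M, L ≤ M → IsC11 p L M ψ →
      ∫ x, ψ x ∂α n - ∫ x, ψ x ∂β n ≤ (L + ε * M) * e n) →
      WClose (α n) (β n) (2 * e n + 2 * ε) := fun n ih => by
    refine WClose.of_isC11 hp hε fun ψ hψ => ?_
    have := ih ψ 1 (1 / ε) hεinv hψ
    rwa [mul_one_div_cancel hε.ne', one_add_one_eq_two] at this
  -- The restriction L ≤ M lets the cross term L·C₄·τ from the chain rule be absorbed into M·(1 +
  -- c₀τ). It survives the induction because both constants grow by the same factor.
  suffices H : ∀ n, ∀ ψ L M, L ≤ M → IsC11 p L M ψ →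
      ∫ x, ψ x ∂α n - ∫ x, ψ x ∂β n ≤ (L + ε * M) * e n from wc n (H n)
  intro n
  induction n with
  | zero =>
    intro ψ L M hLM hψ
    have hL := hψ.nonneg_left
    have := h0.abs_integral_le hL hψ.bdd (hψ.lip hp)
    simp only [he, Nat.cast_zero, zero_mul, mul_zero, Real.exp_zero, add_zero, one_mul]
    refine (le_abs_self _).trans (this.trans ?_)
    gcongr
    have : 0 ≤ ε * M := mul_nonneg hε.le (hL.trans hLM)
    linarith
  | succ n ih =>
    intro ψ L M hLM hψ
    have hL := hψ.nonneg_left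
    have hM := hL.trans hLM
    have hW := wc n ih
    -- Both new integrals are replaced by integrals of ψ after an Euler step: `a1`, `b1` are
    -- consistency errors, `a2`, `b2` Taylor errors. Then `a3` compares α n and β n on the same
    -- composed function, with the velocity of α n, and `b3` pays for replacing that velocity by the
    -- one of β n.
    have a1 := hα n ψ L M hM hψ
    have b1 := hβ n ψ L M hM hψ
    have a2 := hV.abs_integral_step_sub_le hp (α n) (τ := τ) hM hψ
    have b2 := hV.abs_integral_step_sub_le hp (β n) (τ := τ) hM hψ
    have hstep := hψ.comp_step hp hM (hV.isC11 hp (α n)) hτ.le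
    have hstep' : IsC11 p (L * (1 + c₀ * τ)) (M * (1 + c₀ * τ))
        (fun x => ψ (x + p (τ * V (α n) x))) := by
      refine hstep.mono ?_ ?_
      · gcongr; rw [hc₀]; nlinarith
      · have k1 : L * C₄ * τ ≤ M * C₄ * τ := by gcongr
        have k2 : C₂ ^ 2 * τ * τ ≤ C₂ ^ 2 * τ * 1 := by gcongr
        have k3 : M * (C₂ ^ 2 * τ * τ) ≤ M * (C₂ ^ 2 * τ * 1) := by gcongr
        rw [hc₀]; nlinarith
    have a3 := ih _ _ _ (mul_le_mul_of_nonneg_right hLM (by positivity)) hstep'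
    have hψc := hψ.continuous hp
    obtain ⟨C, hC⟩ := hψ.bdd
    have i : ∀ ν : Measure K, IsProbabilityMeasure ν →
        Integrable (fun x => ψ (x + p (τ * V ν x))) (β n) := fun ν hν =>
      integrable_of_continuous_bdd (hψc.comp (continuous_id.add
        (hp.continuous.comp (continuous_const.mul (hV.continuous hp ν))))) fun x => hC _
    have b3 := abs_integral_sub_le (i (α n) inferInstance) (i (β n) inferInstance)
      (c := L * (τ * (C₃ * (2 * e n + 2 * ε)))) fun x => by
        refine (hψ.lip hp _ _).trans ?_
        rw [dist_add_left]
        gcongr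
        refine (hp.dist_map_le _ _).trans ?_
        rw [← mul_sub, abs_mul, abs_of_pos hτ]
        gcongr
        exact hV.abs_sub_le hW x
    have k4 : M * (τ ^ 2 * C₁ ^ 2) ≤ M * (τ * κ) := by
      rw [sq τ, mul_assoc τ τ]; gcongr
    have k5 : κ * (L + M) * τ ≤ κ * (M + M) * τ := by gcongr
    -- The two consistency errors give at most 4κMτ, since L ≤ M, and the two Taylor errors 2κMτ.
    -- Bounding M by (L + εM)/ε produces the 1/ε in q.
    have k6 : 6 * κ * M * τ ≤ (L + ε * M) * (τ * (6 * κ / ε)) := by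
      have : ε * M * (τ * (6 * κ / ε)) = 6 * κ * M * τ := by field_simp
      have : 0 ≤ L * (τ * (6 * κ / ε)) := by positivity
      nlinarith
    have k7 : L * (τ * (C₃ * (2 * e n + 2 * ε))) ≤ (L + ε * M) * (τ * (C₃ * (2 * e n + 2 * ε))) := by
      have := he0 n
      have : 0 ≤ ε * M := by positivity
      gcongr; linarith
    have k8 : (1 + (c₀ + 2 * C₃) * τ) * e n + τ * q ≤ e (n + 1) := by
      have x1 : 1 + (c₀ + 2 * C₃) * τ ≤ Real.exp ((c₀ + 2 * C₃) * τ) := by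
        rw [add_comm]; exact Real.add_one_le_exp _
      have x2 : e (n + 1) = Real.exp ((c₀ + 2 * C₃) * τ) * e n
          + Real.exp ((c₀ + 2 * C₃) * ((n + 1 : ℕ) * τ)) * (τ * q) := by
        have x3 : Real.exp ((c₀ + 2 * C₃) * ((n + 1 : ℕ) * τ))
            = Real.exp ((c₀ + 2 * C₃) * τ) * Real.exp ((c₀ + 2 * C₃) * (n * τ)) := by
          rw [← Real.exp_add]
          push_cast; ring_nf
        simp only [he]
        rw [x3]
        push_cast; ring
      rw [x2]
      refine add_le_add (mul_le_mul_of_nonneg_right x1 (he0 n)) ?_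
      exact le_mul_of_one_le_left (by positivity) (Real.one_le_exp (by positivity))
    have k9 := mul_le_mul_of_nonneg_left k8 (show 0 ≤ L + ε * M by positivity)
    refine le_trans ?_ k9
    have k10 : (L + ε * M) * ((1 + (c₀ + 2 * C₃) * τ) * e n + τ * q)
      = (L * (1 + c₀ * τ) + ε * (M * (1 + c₀ * τ))) * e n
        + (L + ε * M) * (τ * (C₃ * (2 * e n + 2 * ε))) + (L + ε * M) * (τ * (6 * κ / ε)) := by
      rw [hq]; ring
    rw [k10]
    rw [abs_le] at a1 a2 b1 b2 b3
    linarith [a1.2, a2.1, b1.1, b2.2, b3.2]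

/-- Version of the stability estimate with unspecified constants. -/
theorem exists_wClose_of_eulerConsistent {V : Measure K → K → ℝ} {C₁ C₂ C₃ C₄ : ℝ}
    (hV : IsVelocity p V C₁ C₂ C₃ C₄) (hp : IsLineCover p) (T : ℝ) {η : ℝ} (hη : 0 < η) :
    ∃ κ > 0, ∀ τ > 0, τ ≤ 1 → τ * C₁ ^ 2 ≤ κ → ∀ α β : ℕ → Measure K,
      (∀ n, IsProbabilityMeasure (α n)) → (∀ n, IsProbabilityMeasure (β n)) →
      EulerConsistent p V τ κ α → EulerConsistent p V τ κ β → WClose (α 0) (β 0) κ →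
      ∀ n : ℕ, n * τ ≤ T → WClose (α n) (β n) η := by
  have h1 := hV.pos₁; have h2 := hV.pos₂; have h3 := hV.pos₃; have h4 := hV.pos₄
  set E := Real.exp ((2 * C₂ + C₂ ^ 2 + C₄ + 2 * C₃) * |T|) with hE
  have hE0 : 0 < E := Real.exp_pos _
  -- First ε makes the terms that do not involve κ at most η/2; then κ = η/(2D), with D depending on
  -- this ε, makes the rest equal to η/2.
  set ε := min 1 (η / (2 * (2 * (E * (|T| * (2 * C₃))) + 2))) with hεdef
  have hε : 0 < ε := by positivity
  set D := 2 * (E * (1 + |T| * (6 / ε))) with hD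
  have hD0 : 0 < D := by positivity
  refine ⟨η / (2 * D), by positivity, fun τ hτ hτ1 hκ α β _ _ hα hβ h0 n hn => ?_⟩
  refine (EulerConsistent.wClose hV hp hτ hτ1 hκ hε (min_le_left _ _) hα hβ h0 n).mono ?_
  set κ := η / (2 * D) with hκd
  have hκ0 : 0 < κ := by positivity
  have hnT : n * τ ≤ |T| := hn.trans (le_abs_self T)
  calc _ ≤ 2 * (E * (κ + |T| * (2 * C₃ * ε + 6 * κ / ε))) + 2 * ε := by
        have : Real.exp ((2 * C₂ + C₂ ^ 2 + C₄ + 2 * C₃) * (n * τ)) ≤ E := by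
          rw [hE]; gcongr
        gcongr
    _ = κ * D + ε * (2 * (E * (|T| * (2 * C₃))) + 2) := by
        rw [hD]; field_simp; ring
    _ ≤ η / 2 + η / 2 := by
        gcongr
        · rw [hκd]; field_simp; exact le_rfl
        · have : ε ≤ η / (2 * (2 * (E * (|T| * (2 * C₃))) + 2)) := min_le_right _ _
          rw [le_div_iff₀ (by positivity)] at this
          linarith
    _ = η := by ring

end WClose

/-! ### Global solutions of ODEs, and calculus with space-time test functions -/

/-- Bounded Lipschitz autonomous ordinary differential equations have global solutions. -/
lemma exists_forall_hasDerivAt_of_lipschitz {E : Type*} [NormedAddCommGroup E] [NormedSpace ℝ E]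
    [CompleteSpace E] {F : E → E} {k : NNReal} (hF : LipschitzWith k F) {C : NNReal}
    (hC : ∀ x, ‖F x‖ ≤ C) (x₀ : E) :
    ∃ Y : ℝ → E, Y 0 = x₀ ∧ ∀ t, HasDerivAt Y (F (Y t)) t := by
  have hloc : ∀ n : ℕ, ∃ α : ℝ → E, α 0 = x₀ ∧
      ∀ t ∈ Ioo (-(n + 1 : ℝ)) (n + 1), HasDerivAt α (F (α t)) t := by
    intro n
    have h0 : (0 : ℝ) ∈ Icc (-(n + 1 : ℝ)) (n + 1) := ⟨by linarith [n.cast_nonneg (α := ℝ)],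
      by positivity⟩
    -- As F is bounded by C everywhere, a ball of radius C(n+1) cannot be left during time n+1, so
    -- Picard–Lindelöf applies on the whole interval.
    have hPL : IsPicardLindelof (fun _ => F) (⟨0, h0⟩ : Icc (-(n + 1 : ℝ)) (n + 1)) x₀
        (C * (n + 1)) 0 C k :=
      IsPicardLindelof.of_time_independent (fun x _ => hC x) hF.lipschitzOnWith (by simp)
    obtain ⟨α, h1, h2⟩ := hPL.exists_eq_forall_mem_Icc_hasDerivWithinAt₀
    exact ⟨α, h1, fun t ht => (h2 t (Ioo_subset_Icc_self ht)).hasDerivAt (Icc_mem_nhds ht.1 ht.2)⟩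
  choose α hα0 hα using hloc
  have hagree : ∀ n m : ℕ, n ≤ m → ∀ t : ℝ, |t| < n + 1 → α n t = α m t := by
    intro n m hnm t ht
    have hn : (n : ℝ) ≤ m := by exact_mod_cast hnm
    refine ODE_solution_unique_of_mem_Ioo (v := fun _ => F) (s := fun _ => univ) (t₀ := 0)
      (a := -(n + 1 : ℝ)) (b := n + 1) (fun _ _ => hF.lipschitzOnWith)
      ⟨by linarith [n.cast_nonneg (α := ℝ)], by positivity⟩
      (fun s hs => ⟨hα n s hs, trivial⟩)
      (fun s hs => ⟨hα m s ⟨by linarith [hs.1], by linarith [hs.2]⟩, trivial⟩)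
      (by rw [hα0, hα0]) (abs_lt.1 ht)
  -- The local solutions are glued along their index; near a given t all of them agree with the
  -- single solution numbered N.
  refine ⟨fun t => α ⌈|t|⌉₊ t, hα0 _, fun t => ?_⟩
  set N := ⌈|t|⌉₊ + 1 with hN
  have key : ∀ s : ℝ, |s| < N → α ⌈|s|⌉₊ s = α N s := fun s hs =>
    hagree _ _ (Nat.ceil_le.2 hs.le) s ((Nat.le_ceil _).trans_lt (lt_add_one _))
  have htN : |t| < N := (Nat.le_ceil _).trans_lt (by rw [hN]; push_cast; exact lt_add_one _)
  have hd := hα N t (abs_lt.1 (htN.trans (lt_add_one _)))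
  simp only [key t htN]
  refine hd.congr_of_eventuallyEq ?_
  filter_upwards [(isOpen_lt continuous_abs continuous_const).mem_nhds htN] with s hs
  exact key s hs

namespace IsLineCover

variable {K : Type} [NormedAddCommGroup K] {p : ℝ → K}

/-- Shifts of length equal to the distance lift balls of K to the line. Openness allows continuity
on K × ℝ to be checked on ℝ × ℝ, where test functions are smooth. -/
lemma isOpenQuotientMap (hp : IsLineCover p) : IsOpenQuotientMap p := by
  refine ⟨hp.surjective, hp.continuous, fun U hU => ?_⟩
  rw [Metric.isOpen_iff] at hU ⊢
  rintro _ ⟨s, hs, rfl⟩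
  obtain ⟨ε, hε, h⟩ := hU s hs
  refine ⟨ε, hε, fun y hy => ?_⟩
  obtain ⟨r, rfl, hr⟩ := hp.exists_shift (p s) y
  refine ⟨s + r, h ?_, hp.map_add _ _⟩
  rw [Metric.mem_ball, dist_comm] at hy
  simpa [hr] using hy

lemma isOpenQuotientMap_prod (hp : IsLineCover p) :
    IsOpenQuotientMap (Prod.map p (id : ℝ → ℝ)) :=
  hp.isOpenQuotientMap.prodMap IsOpenQuotientMap.id

end IsLineCover

namespace IsTestFunction

variable {K : Type} [NormedAddCommGroup K] {p : ℝ → K} {φ : K × ℝ → ℝ}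

lemma hasFDerivAt (h : IsTestFunction p φ) (z : ℝ × ℝ) :
    HasFDerivAt (fun z : ℝ × ℝ => φ (p z.1, z.2))
      (fderiv ℝ (fun z : ℝ × ℝ => φ (p z.1, z.2)) z) z :=
  (h.2.differentiable (by simp) z).hasFDerivAt

lemma deriv_time_eq (h : IsTestFunction p φ) (s t : ℝ) :
    deriv (fun r => φ (p s, r)) t
      = fderiv ℝ (fun z : ℝ × ℝ => φ (p z.1, z.2)) (s, t) (0, 1) := by
  have h1 : HasDerivAt (fun r : ℝ => (s, r)) ((0 : ℝ), (1 : ℝ)) t :=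
    (hasDerivAt_const t s).prodMk (hasDerivAt_id t)
  exact ((h.hasFDerivAt (s, t)).comp_hasDerivAt t h1).deriv

lemma dx_eq (h : IsTestFunction p φ) (hp : IsLineCover p) (s t : ℝ) :
    dx p (fun y => φ (y, t)) (p s)
      = fderiv ℝ (fun z : ℝ × ℝ => φ (p z.1, z.2)) (s, t) (1, 0) := by
  have h1 : HasDerivAt (fun r : ℝ => (s + r, t)) ((1 : ℝ), (0 : ℝ)) 0 :=
    ((hasDerivAt_id 0).const_add s).prodMk (hasDerivAt_const 0 t)
  have h2 : HasFDerivAt (fun z : ℝ × ℝ => φ (p z.1, z.2))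
      (fderiv ℝ (fun z : ℝ × ℝ => φ (p z.1, z.2)) (s, t)) (s + 0, t) := by
    simpa using h.hasFDerivAt (s, t)
  have h3 := h2.comp_hasDerivAt (0 : ℝ) h1
  simp only [dx, ← hp.map_add]
  exact h3.deriv

lemma continuous (h : IsTestFunction p φ) (hp : IsLineCover p) : Continuous φ :=
  hp.isOpenQuotientMap_prod.isQuotientMap.continuous_iff.2 h.2.continuous

lemma continuous_deriv_time (h : IsTestFunction p φ) (hp : IsLineCover p) :
    Continuous fun z : K × ℝ => deriv (fun s => φ (z.1, s)) z.2 := by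
  refine hp.isOpenQuotientMap_prod.isQuotientMap.continuous_iff.2 ?_
  have : Continuous fun z : ℝ × ℝ =>
      fderiv ℝ (fun z : ℝ × ℝ => φ (p z.1, z.2)) z ((0 : ℝ), (1 : ℝ)) :=
    (h.2.continuous_fderiv (by simp)).clm_apply continuous_const
  exact this.congr fun z => (h.deriv_time_eq z.1 z.2).symm

lemma continuous_dx (h : IsTestFunction p φ) (hp : IsLineCover p) :
    Continuous fun z : K × ℝ => dx p (fun y => φ (y, z.2)) z.1 := by
  refine hp.isOpenQuotientMap_prod.isQuotientMap.continuous_iff.2 ?_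
  have : Continuous fun z : ℝ × ℝ =>
      fderiv ℝ (fun z : ℝ × ℝ => φ (p z.1, z.2)) z ((1 : ℝ), (0 : ℝ)) :=
    (h.2.continuous_fderiv (by simp)).clm_apply continuous_const
  exact this.congr fun z => (h.dx_eq hp z.1 z.2).symm

/-- Used with y the displacement of a characteristic: the derivative is then the integrand of the
weak form. -/
lemma hasDerivAt_comp (h : IsTestFunction p φ) (hp : IsLineCover p) (x : K) {y : ℝ → ℝ}
    {y' t : ℝ} (hy : HasDerivAt y y' t) :
    HasDerivAt (fun s => φ (x + p (y s), s))
      (deriv (fun s => φ (x + p (y t), s)) t + y' * dx p (fun z => φ (z, t)) (x + p (y t))) t := by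
  obtain ⟨s₀, rfl⟩ := hp.surjective x
  simp only [← hp.map_add]
  rw [h.deriv_time_eq, h.dx_eq hp]
  have h1 : HasDerivAt (fun s : ℝ => (s₀ + y s, s)) (y', (1 : ℝ)) t :=
    (hy.const_add s₀).prodMk (hasDerivAt_id t)
  have := HasFDerivAt.comp_hasDerivAt (f := fun s : ℝ => (s₀ + y s, s)) t
    (h.hasFDerivAt (s₀ + y t, t)) h1
  convert! this using 1
  have : (y', (1 : ℝ)) = (0, 1) + y' • ((1 : ℝ), (0 : ℝ)) := by simp
  rw [this, _root_.map_add, map_smul, smul_eq_mul]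

lemma eventually_eq_zero {z : K × ℝ} (hz : z ∉ tsupport φ) : ∀ᶠ w in 𝓝 z, φ w = 0 := by
  filter_upwards [(isClosed_tsupport φ).isOpen_compl.mem_nhds hz] with w hw
  exact image_eq_zero_of_notMem_tsupport hw

lemma deriv_time_eq_zero {z : K × ℝ} (hz : z ∉ tsupport φ) :
    deriv (fun s => φ (z.1, s)) z.2 = 0 := by
  have : (fun s => φ (z.1, s)) =ᶠ[𝓝 z.2] fun _ => 0 :=
    (Continuous.tendsto (f := fun s : ℝ => (z.1, s)) (by fun_prop) z.2).eventually
      (eventually_eq_zero hz)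
  rw [this.deriv_eq]; simp

lemma dx_eq_zero (hp : IsLineCover p) {z : K × ℝ} (hz : z ∉ tsupport φ) :
    dx p (fun y => φ (y, z.2)) z.1 = 0 := by
  have h1 : Tendsto (fun q : ℝ => (z.1 + p q, z.2)) (𝓝 0) (𝓝 z) := by
    have := (Continuous.tendsto (f := fun q : ℝ => (z.1 + p q, z.2))
      (by have := hp.continuous; fun_prop) 0)
    simpa [hp.map_zero] using this
  have : (fun q : ℝ => φ (z.1 + p q, z.2)) =ᶠ[𝓝 0] fun _ => 0 :=
    h1.eventually (eventually_eq_zero hz)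
  rw [dx, this.deriv_eq]; simp

lemma exists_bound_time (h : IsTestFunction p φ) :
    ∃ R > 0, ∀ z : K × ℝ, R ≤ |z.2| → z ∉ tsupport φ := by
  obtain ⟨R, hR⟩ := (h.1.isCompact.image continuous_snd).isBounded.exists_norm_le
  refine ⟨|R| + 1, by positivity, fun z hz hm => ?_⟩
  have := hR z.2 ⟨z, hm, rfl⟩
  rw [Real.norm_eq_abs] at this
  linarith [le_abs_self R]

lemma exists_bound_deriv_time (h : IsTestFunction p φ) (hp : IsLineCover p) :
    ∃ C, ∀ z : K × ℝ, |deriv (fun s => φ (z.1, s)) z.2| ≤ C := by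
  have hc : HasCompactSupport fun z : K × ℝ => deriv (fun s => φ (z.1, s)) z.2 :=
    h.1.mono' fun z hz => by_contra fun h' => hz (deriv_time_eq_zero h')
  obtain ⟨C, hC⟩ := hc.exists_bound_of_continuous (h.continuous_deriv_time hp)
  exact ⟨C, hC⟩

lemma exists_bound_dx (h : IsTestFunction p φ) (hp : IsLineCover p) :
    ∃ C, ∀ z : K × ℝ, |dx p (fun y => φ (y, z.2)) z.1| ≤ C := by
  have hc : HasCompactSupport fun z : K × ℝ => dx p (fun y => φ (y, z.2)) z.1 :=
    h.1.mono' fun z hz => by_contra fun h' => hz (dx_eq_zero hp h')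
  obtain ⟨C, hC⟩ := hc.exists_bound_of_continuous (h.continuous_dx hp)
  exact ⟨C, hC⟩

end IsTestFunction

/-! ### Existence by characteristics -/

section Existence

variable {K : Type} [NormedAddCommGroup K] [MeasurableSpace K] [BorelSpace K] {p : ℝ → K}
  {V : Measure K → K → ℝ} {C₁ C₂ C₃ C₄ : ℝ}

/-- The image of `μ₀` under the displacement `Y`. -/
noncomputable def displace (p : ℝ → K) (μ₀ : Measure K) (Y : K →ᵇ ℝ) : Measure K :=
  μ₀.map fun x => x + p (Y x)

lemma continuous_displacement (hp : IsLineCover p) (Y : K →ᵇ ℝ) :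
    Continuous fun x => x + p (Y x) :=
  continuous_id.add (hp.continuous.comp Y.continuous)

lemma isProbabilityMeasure_displace (hp : IsLineCover p) (μ₀ : Measure K)
    [IsProbabilityMeasure μ₀] (Y : K →ᵇ ℝ) : IsProbabilityMeasure (displace p μ₀ Y) :=
  Measure.isProbabilityMeasure_map (continuous_displacement hp Y).measurable.aemeasurable

lemma integral_displace (hp : IsLineCover p) (μ₀ : Measure K) (Y : K →ᵇ ℝ) {f : K → ℝ}
    (hf : Continuous f) : ∫ x, f x ∂displace p μ₀ Y = ∫ x, f (x + p (Y x)) ∂μ₀ :=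
  integral_map (continuous_displacement hp Y).measurable.aemeasurable hf.aestronglyMeasurable

lemma wClose_displace (hp : IsLineCover p) (μ₀ : Measure K) [IsProbabilityMeasure μ₀]
    (Y Z : K →ᵇ ℝ) : WClose (displace p μ₀ Y) (displace p μ₀ Z) (dist Y Z) := by
  intro ψ ⟨C, hC⟩ hl
  have hψ : Continuous ψ := continuous_of_abs_sub_le (L := 1) (by simpa using hl)
  rw [integral_displace hp _ _ hψ, integral_displace hp _ _ hψ]
  refine abs_integral_sub_le
    (integrable_of_continuous_bdd (hψ.comp (continuous_displacement hp Y)) fun x => hC _)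
    (integrable_of_continuous_bdd (hψ.comp (continuous_displacement hp Z)) fun x => hC _)
    fun x => (hl _ _).trans ?_
  rw [dist_add_left]
  exact (hp.dist_map_le _ _).trans (by simpa [Real.dist_eq] using Y.dist_coe_le_dist (g := Z) x)

/-- The vector field whose integral curve from `0` is the displacement of the flow. -/
noncomputable def displacementField (hV : IsVelocity p V C₁ C₂ C₃ C₄) (hp : IsLineCover p)
    (μ₀ : Measure K) [IsProbabilityMeasure μ₀] (Y : K →ᵇ ℝ) : K →ᵇ ℝ :=
  haveI := isProbabilityMeasure_displace hp μ₀ Y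
  BoundedContinuousFunction.ofNormedAddCommGroup
    (fun x => V (displace p μ₀ Y) (x + p (Y x)))
    ((hV.continuous hp _).comp (continuous_displacement hp Y)) C₁
    fun _ => hV.bounded _ inferInstance _

/-- C₂ accounts for the moved point and C₃ for the moved measure, whose Wasserstein displacement is
at most the sup distance of Y and Z. -/
lemma lipschitzWith_displacementField (hV : IsVelocity p V C₁ C₂ C₃ C₄) (hp : IsLineCover p)
    (μ₀ : Measure K) [IsProbabilityMeasure μ₀] :
    LipschitzWith (Real.toNNReal (C₂ + C₃)) (displacementField hV hp μ₀) := by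
  have h2 := hV.pos₂; have h3 := hV.pos₃
  refine LipschitzWith.of_dist_le_mul fun Y Z => ?_
  rw [Real.coe_toNNReal _ (by positivity)]
  refine (BoundedContinuousFunction.dist_le (by positivity)).2 fun x => ?_
  have := isProbabilityMeasure_displace hp μ₀ Y
  have := isProbabilityMeasure_displace hp μ₀ Z
  change |V (displace p μ₀ Y) (x + p (Y x)) - V (displace p μ₀ Z) (x + p (Z x))| ≤ _
  refine (_root_.abs_sub_le _ (V (displace p μ₀ Y) (x + p (Z x))) _).trans ?_
  rw [add_mul]
  refine add_le_add ((hV.lipSpace _ inferInstance _ _).trans ?_)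
    (hV.abs_sub_le (wClose_displace hp μ₀ Y Z) _)
  rw [dist_add_left]
  gcongr
  exact (hp.dist_map_le _ _).trans (by simpa [Real.dist_eq] using Y.dist_coe_le_dist (g := Z) x)

/-- The unknown is the displacement Y of the flow rather than the flow itself, because Y lies in a
Banach space also when K is the torus or the flow is unbounded. The push-forward of μ₀ by x + p(Y t
x) solves the equation: integrate the derivative of φ along each characteristic and apply Fubini. -/
theorem exists_isMeasureValuedSolution (hV : IsVelocity p V C₁ C₂ C₃ C₄) (hp : IsLineCover p)
    (μ₀ : ProbabilityMeasure K) :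
    ∃ μ : ℝ → ProbabilityMeasure K, IsMeasureValuedSolution p V μ₀ μ := by
  have h1 := hV.pos₁
  set F := displacementField hV hp (μ₀ : Measure K) with hF
  obtain ⟨Y, hY0, hY⟩ := exists_forall_hasDerivAt_of_lipschitz
    (lipschitzWith_displacementField hV hp (μ₀ : Measure K)) (C := Real.toNNReal C₁)
    (fun Z => by
      rw [Real.coe_toNNReal _ h1.le]
      exact BoundedContinuousFunction.norm_ofNormedAddCommGroup_le _ h1.le _) 0
  have hprob := fun t => isProbabilityMeasure_displace hp (μ₀ : Measure K) (Y t)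
  have hYc : Continuous Y := continuous_iff_continuousAt.2 fun t => (hY t).continuousAt
  have hXc : Continuous fun z : K × ℝ => z.1 + p (Y z.2 z.1) :=
    continuous_fst.add (hp.continuous.comp
      (continuous_eval.comp
        ((hYc.comp continuous_snd).prodMk continuous_fst)))
  have hWc : Continuous fun z : K × ℝ =>
      V (displace p (μ₀ : Measure K) (Y z.2)) (z.1 + p (Y z.2 z.1)) :=
    continuous_eval.comp
      ((((lipschitzWith_displacementField hV hp (μ₀ : Measure K)).continuous.comp hYc).comp
        continuous_snd).prodMk continuous_fst)
  refine ⟨fun t => ⟨displace p μ₀ (Y t), hprob t⟩, fun φ => ?_, fun φ hφ => ?_⟩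
  · refine Continuous.continuousOn ?_
    change Continuous fun t => ∫ x, φ x ∂displace p (μ₀ : Measure K) (Y t)
    simp_rw [fun t => integral_displace hp (μ₀ : Measure K) (Y t) (map_continuous φ)]
    obtain ⟨C, hC⟩ : ∃ C, ∀ x, ‖φ x‖ ≤ C :=
      ⟨‖φ.toBCF‖, fun x => φ.toBCF.norm_coe_le_norm x⟩
    refine continuous_of_dominated (bound := fun _ => C)
      (fun t => ((map_continuous φ).comp (continuous_displacement hp (Y t))).aestronglyMeasurable)
      (fun t => Eventually.of_forall fun x => hC _) (integrable_const _)
      (Eventually.of_forall fun x => (map_continuous φ).comp (hXc.comp (by fun_prop : Continuous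
        fun t : ℝ => (x, t))))
  · set g : K → ℝ → ℝ := fun x t => deriv (fun s => φ (x + p (Y t x), s)) t
        + V (displace p (μ₀ : Measure K) (Y t)) (x + p (Y t x))
          * dx p (fun y => φ (y, t)) (x + p (Y t x)) with hg
    have hgc : Continuous (Function.uncurry g) :=
      ((hφ.continuous_deriv_time hp).comp (hXc.prodMk continuous_snd)).add
        (hWc.mul ((hφ.continuous_dx hp).comp (hXc.prodMk continuous_snd)))
    have e : ∀ t, ∫ x, (deriv (fun s => φ (x, s)) t + V (displace p (μ₀ : Measure K) (Y t)) x
        * dx p (fun y => φ (y, t)) x) ∂displace p (μ₀ : Measure K) (Y t)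
        = ∫ x, g x t ∂(μ₀ : Measure K) := fun t =>
      integral_displace hp _ _ (((hφ.continuous_deriv_time hp).comp (by fun_prop : Continuous
        fun x : K => (x, t))).add (((hV.continuous hp _ (K := K))).mul
          ((hφ.continuous_dx hp).comp (by fun_prop : Continuous fun x : K => (x, t)))))
    have hder : ∀ x t, HasDerivAt (fun s => φ (x + p (Y s x), s)) (g x t) t := fun x t => by
      refine hφ.hasDerivAt_comp hp x ?_
      exact (BoundedContinuousFunction.evalCLM ℝ x).hasFDerivAt.comp_hasDerivAt t (hY t)
    obtain ⟨R, hR, hRφ⟩ := hφ.exists_bound_time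
    obtain ⟨A, hA⟩ := hφ.exists_bound_deriv_time hp
    obtain ⟨B, hB⟩ := hφ.exists_bound_dx hp
    have hgint : Integrable (Function.uncurry g)
        ((μ₀ : Measure K).prod (volume.restrict (Ioi 0))) := by
      -- A dominating function for Fubini: bounded, and zero for t > R, where φ vanishes.
      have hbase : Integrable (fun z : K × ℝ => (1 : ℝ) * (Ioc (0 : ℝ) R).indicator
          (fun _ => A + C₁ * B) z.2) ((μ₀ : Measure K).prod (volume.restrict (Ioi 0))) := by
        refine (integrable_const (1 : ℝ)).mul_prod ?_
        exact ((integrableOn_const (by simp)).integrable_indicator measurableSet_Ioc).mono_measure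
          Measure.restrict_le_self
      refine hbase.mono' hgc.aestronglyMeasurable ?_
      have hpos : ∀ᵐ z ∂((μ₀ : Measure K).prod (volume.restrict (Ioi (0 : ℝ)))), 0 < z.2 :=
        Measure.quasiMeasurePreserving_snd.ae (ae_restrict_mem measurableSet_Ioi)
      filter_upwards [hpos] with z hz
      rw [one_mul]
      by_cases hzR : z.2 ≤ R
      · rw [indicator_of_mem (show z.2 ∈ Ioc 0 R from ⟨hz, hzR⟩)]
        refine (norm_add_le _ _).trans (add_le_add (hA (_, _)) ?_)
        rw [norm_mul]
        exact mul_le_mul (hV.bounded _ (hprob _) _) (hB (_, _)) (norm_nonneg _) h1.le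
      · have hns : (z.1 + p (Y z.2 z.1), z.2) ∉ tsupport φ :=
          hRφ _ ((not_le.1 hzR).le.trans (le_abs_self _))
        rw [indicator_of_notMem (fun h => hzR h.2)]
        have q1 := IsTestFunction.deriv_time_eq_zero hns
        have q2 := IsTestFunction.dx_eq_zero hp hns
        simp only [Function.uncurry, hg]
        simp only at q1 q2
        rw [q1, q2]; simp
    constructor
    · change IntegrableOn (fun t => ∫ x, (deriv (fun s => φ (x, s)) t
        + V (displace p (μ₀ : Measure K) (Y t)) x
        * dx p (fun y => φ (y, t)) x) ∂displace p (μ₀ : Measure K) (Y t)) (Ioi 0)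
      simp_rw [e]
      exact hgint.integral_prod_right
    · change (∫ t in Ioi (0 : ℝ), ∫ x, (deriv (fun s => φ (x, s)) t
        + V (displace p (μ₀ : Measure K) (Y t)) x
        * dx p (fun y => φ (y, t)) x) ∂displace p (μ₀ : Measure K) (Y t)) + _ = 0
      simp_rw [e]
      rw [← integral_integral_swap hgint]
      -- Fundamental theorem of calculus along one characteristic: φ vanishes for large times and
      -- only the initial value remains.
      have e2 : ∀ᵐ x ∂(μ₀ : Measure K), ∫ t in Ioi (0 : ℝ), g x t = -φ (x, 0) := by
        filter_upwards [hgint.prod_right_ae] with x hx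
        have hlim : Tendsto (fun s => φ (x + p (Y s x), s)) atTop (𝓝 0) := by
          refine tendsto_const_nhds.congr' ?_
          filter_upwards [eventually_ge_atTop R] with s hs
          exact (image_eq_zero_of_notMem_tsupport
            (hRφ (x + p (Y s x), s) (hs.trans (le_abs_self _)))).symm
        rw [integral_Ioi_of_hasDerivAt_of_tendsto' (fun t _ => hder x t) hx hlim]
        simp [hY0, hp.map_zero]
      rw [integral_congr_ae e2, integral_neg, neg_add_cancel]

end Existence

/-! ### Weak derivatives in time -/

/-- A continuous function whose weak derivative on the half line, with initial value `c₀`, is `b`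
is the integral of `b`. -/
lemma eq_add_integral_of_weak_deriv {a b : ℝ → ℝ} {c₀ : ℝ} (ha : ContinuousOn a (Ici 0))
    (h : ∀ θ : ℝ → ℝ, ContDiff ℝ ∞ θ → HasCompactSupport θ →
      IntegrableOn (fun t => deriv θ t * a t + θ t * b t) (Ioi 0) ∧
      (∫ t in Ioi (0 : ℝ), (deriv θ t * a t + θ t * b t)) + θ 0 * c₀ = 0) :
    (∀ t, 0 ≤ t → IntervalIntegrable b volume 0 t) ∧
      ∀ t, 0 ≤ t → a t = c₀ + ∫ s in (0 : ℝ)..t, b s := by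
  have hplateau : ∀ R : ℝ, 0 ≤ R → ∃ χ : ℝ → ℝ, ContDiff ℝ ∞ χ ∧ HasCompactSupport χ ∧
      ∀ t ∈ Ioo (-(R + 1)) (R + 1), χ =ᶠ[𝓝 t] fun _ => 1 := fun R hR => by
    let χ : ContDiffBump (0 : ℝ) := ⟨R + 1, R + 2, by linarith, by linarith⟩
    refine ⟨χ, χ.contDiff, χ.hasCompactSupport, fun t ht => ?_⟩
    filter_upwards [isOpen_Ioo.mem_nhds ht] with s hs
    refine χ.one_of_mem_closedBall ?_
    rw [mem_closedBall_zero_iff, Real.norm_eq_abs]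
    exact (abs_lt.2 hs).le
  -- Where the plateau function is locally 1, the assumed integrand is b itself, so local
  -- integrability of b need not be assumed.
  have hb : ∀ t, 0 ≤ t → IntervalIntegrable b volume 0 t := fun t ht => by
    obtain ⟨χ, h1, h2, h3⟩ := hplateau t ht
    rw [intervalIntegrable_iff_integrableOn_Ioc_of_le ht]
    refine (((h χ h1 h2).1).mono_set Ioc_subset_Ioi_self).congr_fun (fun s hs => ?_)
      measurableSet_Ioc
    have := h3 s ⟨by linarith [hs.1], by linarith [hs.2]⟩
    simp [this.deriv_eq, this.eq_of_nhds]
  refine ⟨hb, ?_⟩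
  set B : ℝ → ℝ := fun t => ∫ s in (0 : ℝ)..t, b s with hB
  have hBc : ∀ R, 0 ≤ R → ContinuousOn B (Icc 0 R) := fun R hR => by
    have := intervalIntegral.continuousOn_primitive_interval (a := 0) (b := R) (f := b)
      (μ := volume) (by
        rw [uIcc_of_le hR, integrableOn_Icc_iff_integrableOn_Ioc]
        exact (intervalIntegrable_iff_integrableOn_Ioc_of_le hR).1 (hb R hR))
    rwa [uIcc_of_le hR] at this
  have hBc' : ContinuousOn B (Ici 0) := fun t ht => by
    have ht0 : (0 : ℝ) ≤ t := ht
    refine (hBc (t + 1) (by linarith) t ⟨ht, by linarith⟩).mono_of_mem_nhdsWithin ?_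
    exact mem_nhdsWithin.2 ⟨Iio (t + 1), isOpen_Iio, by simp, fun s hs => ⟨hs.2, hs.1.le⟩⟩
  have hfc : ContinuousOn (fun t => a t - B t - c₀) (Ici 0) :=
    (ha.sub hBc').sub continuousOn_const
  have hae : ∀ᵐ t, t ∈ Ioi (0 : ℝ) → a t - B t - c₀ = 0 := by
    refine isOpen_Ioi.ae_eq_zero_of_integral_contDiff_smul_eq_zero
      ((hfc.mono Ioi_subset_Ici_self).locallyIntegrableOn measurableSet_Ioi) fun g hg hgc hgs => ?_
    obtain ⟨R, hR0, hR⟩ : ∃ R : ℝ, 0 < R ∧ ∀ t, R ≤ t → g t = 0 := by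
      obtain ⟨R, hR⟩ := hgc.isCompact.isBounded.exists_norm_le
      refine ⟨|R| + 1, by positivity, fun t ht => ?_⟩
      by_contra hne
      have := hR t (subset_tsupport _ hne)
      rw [Real.norm_eq_abs] at this
      linarith [le_abs_self R, le_abs_self t]
    have hg0 : ∀ t, t ≤ 0 → g t = 0 := fun t ht =>
      image_eq_zero_of_notMem_tsupport fun hm => absurd (hgs hm) (not_lt.2 ht)
    -- The primitive of g that vanishes beyond R. It is constant for t ≤ 0, so multiplication by the
    -- plateau χ gives it compact support without changing it on [0, R]; the value G 0 = -∫g yields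
    -- the constant c₀.
    set G : ℝ → ℝ := fun t => (∫ s in (0 : ℝ)..t, g s) - ∫ s in (0 : ℝ)..R, g s with hG
    have hGd : ∀ t, HasDerivAt G (g t) t := fun t =>
      (intervalIntegral.integral_hasDerivAt_right (hg.continuous.intervalIntegrable _ _)
        (hg.continuous.stronglyMeasurableAtFilter _ _) hg.continuous.continuousAt).sub_const _
    have hGs : ContDiff ℝ ∞ G := by
      rw [contDiff_infty_iff_deriv]
      refine ⟨fun t => (hGd t).differentiableAt, ?_⟩
      rwa [show deriv G = g from funext fun t => (hGd t).deriv]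
    have hGR : ∀ t, R ≤ t → G t = 0 := fun t ht => by
      simp only [hG]
      rw [intervalIntegral.integral_interval_sub_left (hg.continuous.intervalIntegrable _ _)
        (hg.continuous.intervalIntegrable _ _)]
      refine (intervalIntegral.integral_congr fun s hs => ?_).trans
        intervalIntegral.integral_zero
      rw [uIcc_of_le ht] at hs
      exact hR s hs.1
    obtain ⟨χ, h1, h2, h3⟩ := hplateau R hR0.le
    have hθ := h (fun t => G t * χ t) (hGs.mul h1) h2.mul_left
    have e1 : ∀ t ∈ Ioi (0 : ℝ), deriv (fun t => G t * χ t) t * a t + G t * χ t * b t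
        = (Ioc 0 R).indicator (fun t => g t * a t + G t * b t) t := fun t ht => by
      by_cases htR : t ≤ R
      · have hχ := h3 t ⟨by linarith [mem_Ioi.1 ht], by linarith⟩
        have hd : deriv (fun t => G t * χ t) t = g t := by
          have : (fun t => G t * χ t) =ᶠ[𝓝 t] G := by
            filter_upwards [hχ] with s hs
            rw [hs, mul_one]
          rw [this.deriv_eq, (hGd t).deriv]
        rw [indicator_of_mem (show t ∈ Ioc 0 R from ⟨ht, htR⟩), hd, hχ.eq_of_nhds, mul_one]
      · push Not at htR
        have hz : (fun t => G t * χ t) =ᶠ[𝓝 t] fun _ => 0 := by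
          filter_upwards [isOpen_Ioi.mem_nhds htR] with s hs
          rw [hGR s hs.le, zero_mul]
        rw [indicator_of_notMem (fun h => absurd h.2 (not_le.2 htR)), hz.deriv_eq, hGR t htR.le]
        simp
    have hgB : IntervalIntegrable (fun t => g t * B t) volume 0 R :=
      (hg.continuous.continuousOn.mul (by rw [uIcc_of_le hR0.le]; exact hBc R hR0.le)).intervalIntegrable
    have hga : IntervalIntegrable (fun t => g t * a t) volume 0 R :=
      (hg.continuous.continuousOn.mul (ha.mono (by
        rw [uIcc_of_le hR0.le]; exact Icc_subset_Ici_self))).intervalIntegrable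
    have hGb : IntervalIntegrable (fun t => G t * b t) volume 0 R :=
      (hb R hR0.le).continuousOn_mul hGs.continuous.continuousOn
    -- Integration by parts for absolutely continuous functions, B being no better than that; the
    -- boundary terms vanish since G R = 0 and B 0 = 0.
    have parts : ∫ t in (0 : ℝ)..R, G t * b t = -∫ t in (0 : ℝ)..R, g t * B t := by
      have hBac := (hb R hR0.le).absolutelyContinuousOnInterval_intervalIntegral
        (c := 0) (by simp)
      have hGac : AbsolutelyContinuousOnInterval G 0 R :=
        (hGs.of_le (by simp)).contDiffOn.absolutelyContinuousOnInterval
      have := hGac.integral_mul_deriv_eq_deriv_mul hBac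
      rw [show deriv G = g from funext fun t => (hGd t).deriv, hGR R le_rfl] at this
      simp only [intervalIntegral.integral_same, mul_zero, zero_mul, sub_zero, zero_sub] at this
      rw [← this]
      refine intervalIntegral.integral_congr_ae ?_
      filter_upwards [(hb R hR0.le).ae_hasDerivAt_integral] with t ht ht2
      rw [(ht (uIoc_subset_uIcc ht2) 0 (by simp)).deriv]
    have e2 : ∫ t in Ioi (0 : ℝ), (deriv (fun t => G t * χ t) t * a t + G t * χ t * b t)
        = (∫ t in (0 : ℝ)..R, g t * a t) + ∫ t in (0 : ℝ)..R, G t * b t := by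
      rw [setIntegral_congr_fun measurableSet_Ioi e1,
        setIntegral_indicator measurableSet_Ioc, inter_eq_self_of_subset_right Ioc_subset_Ioi_self,
        ← intervalIntegral.integral_of_le hR0.le, intervalIntegral.integral_add hga hGb]
    have hχ0 : χ 0 = 1 := (h3 0 ⟨by linarith, by linarith⟩).eq_of_nhds
    have hG0 : G 0 = -∫ t in (0 : ℝ)..R, g t := by simp [hG]
    have h5 := hθ.2
    rw [e2, parts, hχ0, hG0, mul_one] at h5
    have e3 : ∫ t, g t • (a t - B t - c₀) = ∫ t in (0 : ℝ)..R, g t * (a t - B t - c₀) := by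
      rw [intervalIntegral.integral_of_le hR0.le, setIntegral_eq_integral_of_forall_compl_eq_zero]
      · rfl
      · intro t ht
        rw [mem_Ioc, not_and_or, not_lt, not_le] at ht
        rcases ht with ht | ht
        · rw [hg0 t ht, zero_mul]
        · rw [hR t ht.le, zero_mul]
    have e4 : ∫ t in (0 : ℝ)..R, g t * (a t - B t - c₀)
        = (∫ t in (0 : ℝ)..R, g t * a t) - (∫ t in (0 : ℝ)..R, g t * B t)
          - ∫ t in (0 : ℝ)..R, g t * c₀ := by
      have hgc₀ : IntervalIntegrable (fun t => g t * c₀) volume 0 R :=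
        (hg.continuous.mul continuous_const).intervalIntegrable _ _
      have hgab : IntervalIntegrable (fun t => g t * a t - g t * B t) volume 0 R := hga.sub hgB
      rw [← intervalIntegral.integral_sub hga hgB, ← intervalIntegral.integral_sub hgab hgc₀]
      exact intervalIntegral.integral_congr fun t _ => by ring
    rw [e3, e4, intervalIntegral.integral_mul_const]
    linarith
  have hEq : EqOn (fun t => a t - B t - c₀) (fun _ => 0) (Ioi 0) := by
    refine Measure.eqOn_open_of_ae_eq (μ := volume) ?_ isOpen_Ioi
      (hfc.mono Ioi_subset_Ici_self) continuousOn_const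
    exact (ae_restrict_iff' measurableSet_Ioi).2 hae
  have hEq' : EqOn (fun t => a t - B t - c₀) (fun _ => 0) (Ici 0) :=
    hEq.of_subset_closure hfc continuousOn_const Ioi_subset_Ici_self (by rw [closure_Ioi])
  intro t ht
  have := hEq' (mem_Ici.2 ht)
  simp only at this
  linarith

/-! ### Smooth compactly supported approximation of test functions -/

section Approximation

variable {K : Type} [NormedAddCommGroup K] {p : ℝ → K}

/-- Existence of smooth cutoff functions with small derivatives. -/
def HasCutoffs (p : ℝ → K) : Prop :=
  ∃ χ : ℕ → K → ℝ, (∀ n, HasCompactSupport (χ n) ∧ ContDiff ℝ ∞ (fun s => χ n (p s)) ∧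
      (∀ x, |χ n x| ≤ 1) ∧ (∀ x, |dx p (χ n) x| ≤ 1 / (n + 1)) ∧
      ∀ x y, |dx p (χ n) x - dx p (χ n) y| ≤ 1 / (n + 1) * dist x y) ∧
    ∀ x, Tendsto (fun n => χ n x) atTop (𝓝 1)

lemma IsLineCover.differentiableAt_of_contDiff (hp : IsLineCover p) {f : K → ℝ}
    (hf : ContDiff ℝ ∞ fun s => f (p s)) (x : K) :
    DifferentiableAt ℝ (fun q : ℝ => f (x + p q)) 0 := by
  obtain ⟨s, rfl⟩ := hp.surjective x
  simp only [← hp.map_add]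
  exact ((hf.differentiable (by simp)).comp
    ((differentiable_const s).add differentiable_id)).differentiableAt

/-- The average of `f` along `p` with weight `η`. -/
noncomputable def pavg (p : ℝ → K) (η : ℝ → ℝ) (f : K → ℝ) (x : K) : ℝ :=
  ∫ s, η s * f (x - p s)

section Bump

variable (η : ContDiffBump (0 : ℝ))

lemma abs_integral_bump_mul_le {h : ℝ → ℝ} {c : ℝ} (hc : ∀ s, |s| ≤ η.rOut → |h s| ≤ c) :
    |∫ s, η.normed volume s * h s| ≤ c := by
  have := norm_integral_le_of_norm_le (μ := volume) (f := fun s => η.normed volume s * h s)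
    (g := fun s => η.normed volume s * c) (η.integrable_normed.mul_const c)
    (Eventually.of_forall fun s => by
      rw [norm_mul, Real.norm_of_nonneg (η.nonneg_normed s)]
      by_cases hs : |s| ≤ η.rOut
      · exact mul_le_mul_of_nonneg_left (hc s hs) (η.nonneg_normed s)
      · have : η.normed volume s = 0 := by
          rw [← Function.notMem_support, η.support_normed_eq, mem_ball_zero_iff, Real.norm_eq_abs]
          exact fun h' => hs h'.le
        simp [this])
  rwa [integral_mul_const, η.integral_normed, one_mul] at this

lemma integrable_bump_mul {h : ℝ → ℝ} (hh : Continuous h) :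
    Integrable fun s => η.normed volume s * h s :=
  (η.continuous_normed.mul hh).integrable_of_hasCompactSupport
    η.hasCompactSupport_normed.mul_right

lemma continuous_comp_sub (hp : IsLineCover p) {f : K → ℝ} (hf : Continuous f) (x : K) :
    Continuous fun s => f (x - p s) :=
  hf.comp (continuous_const.sub hp.continuous)

lemma abs_pavg_le {f : K → ℝ} {C : ℝ} (hC : ∀ x, |f x| ≤ C) (x : K) :
    |pavg p (η.normed volume) f x| ≤ C :=
  abs_integral_bump_mul_le η fun _ _ => hC _

lemma abs_pavg_sub_le (hp : IsLineCover p) {f : K → ℝ} {L : ℝ}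
    (hL : ∀ x y, |f x - f y| ≤ L * dist x y) (x y : K) :
    |pavg p (η.normed volume) f x - pavg p (η.normed volume) f y| ≤ L * dist x y := by
  have hf := continuous_of_abs_sub_le hL
  have : pavg p (η.normed volume) f x - pavg p (η.normed volume) f y
      = ∫ s, η.normed volume s * (f (x - p s) - f (y - p s)) := by
    simp only [pavg]
    rw [← integral_sub (integrable_bump_mul η (continuous_comp_sub hp hf x))
      (integrable_bump_mul η (continuous_comp_sub hp hf y))]
    simp only [mul_sub]
  rw [this]
  refine abs_integral_bump_mul_le η fun s _ => (hL _ _).trans ?_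
  rw [dist_sub_right]

lemma abs_pavg_sub_self_le (hp : IsLineCover p) {f : K → ℝ} {L : ℝ} (hL0 : 0 ≤ L)
    (hL : ∀ x y, |f x - f y| ≤ L * dist x y) (x : K) :
    |pavg p (η.normed volume) f x - f x| ≤ L * η.rOut := by
  have hf := continuous_of_abs_sub_le hL
  have : pavg p (η.normed volume) f x - f x
      = ∫ s, η.normed volume s * (f (x - p s) - f x) := by
    simp only [mul_sub]
    rw [integral_sub (integrable_bump_mul η (continuous_comp_sub hp hf x))
      (integrable_bump_mul η continuous_const), integral_mul_const, η.integral_normed, one_mul]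
    rfl
  rw [this]
  refine abs_integral_bump_mul_le η fun s hs => (hL _ _).trans ?_
  gcongr
  rw [sub_eq_add_neg, ← hp.map_neg]
  exact (hp.dist_add_self_le x _).trans (by rwa [abs_neg])

lemma contDiff_pavg (hp : IsLineCover p) {f : K → ℝ} (hf : Continuous f) :
    ContDiff ℝ ∞ fun s => pavg p (η.normed volume) f (p s) := by
  have := η.hasCompactSupport_normed.contDiff_convolution_left (μ := volume) (n := ⊤)
    (ContinuousLinearMap.lsmul ℝ ℝ) (η.contDiff_normed (μ := volume))
    (g := fun s => f (p s)) (hf.comp hp.continuous).locallyIntegrable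
  convert! this using 1
  ext s
  simp [convolution, pavg, hp.map_sub]

/-- The derivative is put on ψ and not on the weight, so the average inherits the constants L and M
without loss. -/
lemma hasDerivAt_pavg (hp : IsLineCover p) {ψ : K → ℝ} {L M : ℝ} (hψ : IsC11 p L M ψ) (x : K) :
    HasDerivAt (fun q : ℝ => pavg p (η.normed volume) ψ (x + p q))
      (pavg p (η.normed volume) (dx p ψ) x) 0 := by
  have hc := fun x => continuous_comp_sub hp (hψ.continuous hp) x
  have hc' := fun x => continuous_comp_sub hp hψ.continuous_dx x
  have := (hasDerivAt_integral_of_dominated_loc_of_deriv_le (μ := volume) (𝕜 := ℝ)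
    (F := fun q s => η.normed volume s * ψ (x + p q - p s))
    (F' := fun q s => η.normed volume s * dx p ψ (x + p q - p s)) (x₀ := 0) (s := univ)
    (bound := fun s => η.normed volume s * L) univ_mem
    (Eventually.of_forall fun q => (integrable_bump_mul η (hc _)).aestronglyMeasurable)
    (integrable_bump_mul η (hc _)) (integrable_bump_mul η (hc' _)).aestronglyMeasurable
    (Eventually.of_forall fun s q _ => by
      rw [norm_mul, Real.norm_of_nonneg (η.nonneg_normed s)]
      exact mul_le_mul_of_nonneg_left (hψ.dx_le _) (η.nonneg_normed s))
    (η.integrable_normed.mul_const L)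
    (Eventually.of_forall fun s q _ => by
      have := (hp.hasDerivAt_dx hψ.diff (x - p s) q).const_mul (η.normed volume s)
      simpa only [add_sub_right_comm] using this)).2
  simpa [pavg, hp.map_zero] using this

end Bump

/-- Approximation of functions of class `IsC11` by smooth functions with compact support. -/
lemma IsC11.exists_smooth_approx (hp : IsLineCover p) (hcut : HasCutoffs p) {ψ : K → ℝ} {L M : ℝ}
    (hM : 0 ≤ M) (hψ : IsC11 p L M ψ) :
    ∃ (Ψ : ℕ → K → ℝ) (D : ℝ), 0 ≤ D ∧ (∀ k x, |Ψ k x| ≤ D) ∧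
      (∀ k, HasCompactSupport (Ψ k) ∧ ContDiff ℝ ∞ (fun s => Ψ k (p s)) ∧
        IsC11 p (L + D / (k + 1)) (M + D / (k + 1)) (Ψ k)) ∧
      (∀ x, Tendsto (fun k => Ψ k x) atTop (𝓝 (ψ x))) ∧
      ∀ x, Tendsto (fun k => dx p (Ψ k) x) atTop (𝓝 (dx p ψ x)) := by
  obtain ⟨χ, hχ, hχ1⟩ := hcut
  obtain ⟨C, hC⟩ := hψ.bdd
  have hC0 : 0 ≤ C := (abs_nonneg _).trans (hC 0)
  have hL := hψ.nonneg_left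
  -- Mollify at radius 1/(k+1), then multiply by the k-th cutoff, whose derivative and its Lipschitz
  -- constant are at most 1/(k+1).
  let η : ℕ → ContDiffBump (0 : ℝ) := fun k =>
    ⟨1 / (2 * ((k : ℝ) + 1)), 1 / ((k : ℝ) + 1), by positivity, by
      apply one_div_lt_one_div_of_lt <;> linarith [k.cast_nonneg (α := ℝ)]⟩
  set m : ℕ → K → ℝ := fun k => pavg p ((η k).normed volume) ψ with hm
  set m' : ℕ → K → ℝ := fun k => pavg p ((η k).normed volume) (dx p ψ) with hm'
  have mb : ∀ k x, |m k x| ≤ C := fun k x => abs_pavg_le (η k) hC x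
  have mb' : ∀ k x, |m' k x| ≤ L := fun k x => abs_pavg_le (η k) hψ.dx_le x
  have ml : ∀ k x y, |m k x - m k y| ≤ L * dist x y := fun k =>
    abs_pavg_sub_le (η k) hp (hψ.lip hp)
  have ml' : ∀ k x y, |m' k x - m' k y| ≤ M * dist x y := fun k =>
    abs_pavg_sub_le (η k) hp hψ.dx_lip
  have hder : ∀ k x, HasDerivAt (fun q : ℝ => χ k (x + p q) * m k (x + p q))
      (dx p (χ k) x * m k x + χ k x * m' k x) 0 := fun k x => by
    have h1 := (hp.differentiableAt_of_contDiff (hχ k).2.1 x).hasDerivAt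
    have := h1.mul (hasDerivAt_pavg (η k) hp hψ x)
    simp only [hp.map_zero, add_zero] at this
    exact this
  have hdx : ∀ k x, dx p (fun x => χ k x * m k x) x = dx p (χ k) x * m k x + χ k x * m' k x :=
    fun k x => (hder k x).deriv
  have lim0 : Tendsto (fun k : ℕ => (1 : ℝ) / (k + 1)) atTop (𝓝 0) :=
    tendsto_one_div_add_atTop_nhds_zero_nat
  have tm : ∀ x, Tendsto (fun k => m k x) atTop (𝓝 (ψ x)) := fun x => by
    refine tendsto_iff_norm_sub_tendsto_zero.2 (squeeze_zero (fun _ => norm_nonneg _)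
      (fun k => abs_pavg_sub_self_le (η k) hp hL (hψ.lip hp) x) ?_)
    have := lim0.const_mul L
    rwa [mul_zero] at this
  have tm' : ∀ x, Tendsto (fun k => m' k x) atTop (𝓝 (dx p ψ x)) := fun x => by
    refine tendsto_iff_norm_sub_tendsto_zero.2 (squeeze_zero (fun _ => norm_nonneg _)
      (fun k => abs_pavg_sub_self_le (η k) hp hM hψ.dx_lip x) ?_)
    have := lim0.const_mul M
    rwa [mul_zero] at this
  have tχ' : ∀ x, Tendsto (fun k => dx p (χ k) x) atTop (𝓝 0) := fun x =>
    squeeze_zero_norm (fun k => (hχ k).2.2.2.1 x) lim0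
  have hb : ∀ k x, |χ k x * m k x| ≤ C := fun k x => by
    rw [abs_mul]
    calc _ ≤ 1 * C := mul_le_mul ((hχ k).2.2.1 x) (mb k x) (abs_nonneg _) zero_le_one
      _ = C := one_mul C
  -- By the product rule the cutoff adds C/(k+1) to L and (C + 2L)/(k+1) to M, where C bounds ψ.
  refine ⟨fun k x => χ k x * m k x, C + 2 * L, by positivity, fun k x => (hb k x).trans (by linarith),
    fun k => ⟨(hχ k).1.mul_right, (hχ k).2.1.mul (contDiff_pavg (η k) hp (hψ.continuous hp)),
      ⟨C, hb k⟩, fun x => (hder k x).differentiableAt, fun x => ?_, fun x y => ?_⟩,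
    fun x => by simpa using (hχ1 x).mul (tm x), fun x => ?_⟩
  · obtain ⟨-, -, c1, c2, -⟩ := hχ k
    rw [hdx]
    have k1 : |dx p (χ k) x| * |m k x| ≤ 1 / (k + 1) * C :=
      mul_le_mul (c2 x) (mb k x) (abs_nonneg _) (by positivity)
    have k2 : |χ k x| * |m' k x| ≤ 1 * L :=
      mul_le_mul (c1 x) (mb' k x) (abs_nonneg _) zero_le_one
    calc _ ≤ |dx p (χ k) x| * |m k x| + |χ k x| * |m' k x| := by
          rw [← abs_mul, ← abs_mul]; exact abs_add_le _ _
      _ ≤ 1 / (k + 1) * C + 1 * L := add_le_add k1 k2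
      _ ≤ 1 / (k + 1) * (C + 2 * L) + 1 * L := by gcongr; linarith
      _ = _ := by ring
  · obtain ⟨-, hχs, c1, c2, c3⟩ := hχ k
    have c4 := hp.abs_sub_le_of_dx (hp.differentiableAt_of_contDiff hχs) c2 x y
    rw [hdx, hdx]
    set δ : ℝ := 1 / (k + 1)
    have hδ : 0 ≤ δ := by positivity
    have k1 : |(dx p (χ k) x - dx p (χ k) y) * m k x| ≤ δ * dist x y * C := by
      rw [abs_mul]
      exact mul_le_mul (c3 x y) (mb k x) (abs_nonneg _) (by positivity)
    have k2 : |dx p (χ k) y * (m k x - m k y)| ≤ δ * (L * dist x y) := by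
      rw [abs_mul]
      exact mul_le_mul (c2 y) (ml k x y) (abs_nonneg _) (by positivity)
    have k3 : |(χ k x - χ k y) * m' k x| ≤ δ * dist x y * L := by
      rw [abs_mul]
      exact mul_le_mul c4 (mb' k x) (abs_nonneg _) (by positivity)
    have k4 : |χ k y * (m' k x - m' k y)| ≤ 1 * (M * dist x y) := by
      rw [abs_mul]
      exact mul_le_mul (c1 y) (ml' k x y) (abs_nonneg _) zero_le_one
    calc _ = |(dx p (χ k) x - dx p (χ k) y) * m k x + dx p (χ k) y * (m k x - m k y)
          + (χ k x - χ k y) * m' k x + χ k y * (m' k x - m' k y)| := by ring_nf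
      _ ≤ δ * dist x y * C + δ * (L * dist x y) + δ * dist x y * L + 1 * (M * dist x y) := by
        refine (abs_add_le _ _).trans (add_le_add ((abs_add_le _ _).trans (add_le_add
          ((abs_add_le _ _).trans (add_le_add k1 k2)) k3)) k4)
      _ = (M + (C + 2 * L) * δ) * dist x y := by ring
      _ = _ := by rw [mul_one_div]
  · simp only [hdx]
    simpa using ((tχ' x).mul (tm x)).add ((hχ1 x).mul (tm' x))

end Approximation

/-! ### Regularity in time and uniqueness of measure-valued solutions -/

section Solutions

variable {K : Type} [NormedAddCommGroup K] [MeasurableSpace K] [BorelSpace K] {p : ℝ → K}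
  {V : Measure K → K → ℝ} {C₁ C₂ C₃ C₄ : ℝ} {μ₀ : ProbabilityMeasure K}
  {μ : ℝ → ProbabilityMeasure K}

lemma IsC11.integrable_velocity_mul_dx (hV : IsVelocity p V C₁ C₂ C₃ C₄) (hp : IsLineCover p)
    {ψ : K → ℝ} {L M : ℝ} (hψ : IsC11 p L M ψ) (ν ν' : Measure K) [hν : IsProbabilityMeasure ν]
    [IsProbabilityMeasure ν'] : Integrable (fun x => V ν x * dx p ψ x) ν' :=
  integrable_of_continuous_bdd ((hV.continuous hp ν).mul hψ.continuous_dx) (C := C₁ * L) fun x => by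
    rw [abs_mul]
    exact mul_le_mul (hV.bounded ν hν x) (hψ.dx_le x) (abs_nonneg _) hV.pos₁.le

lemma IsC11.integrable (hp : IsLineCover p) {ψ : K → ℝ} {L M : ℝ} (hψ : IsC11 p L M ψ)
    (ν : Measure K) [IsProbabilityMeasure ν] : Integrable ψ ν :=
  let ⟨_, hC⟩ := hψ.bdd
  integrable_of_continuous_bdd (hψ.continuous hp) hC

lemma IsC11.abs_integral_velocity_le (hV : IsVelocity p V C₁ C₂ C₃ C₄)
    {ψ : K → ℝ} {L M : ℝ} (hψ : IsC11 p L M ψ) (ν ν' : Measure K) [hν : IsProbabilityMeasure ν]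
    [IsProbabilityMeasure ν'] : |∫ x, V ν x * dx p ψ x ∂ν'| ≤ C₁ * L :=
  abs_integral_le_of_forall fun x => by
    rw [abs_mul]
    exact mul_le_mul (hV.bounded ν hν x) (hψ.dx_le x) (abs_nonneg _) hV.pos₁.le

namespace IsMeasureValuedSolution

/-- The weak form, tested with functions of space only. -/
lemma integral_eq (hμ : IsMeasureValuedSolution p V μ₀ μ) (hV : IsVelocity p V C₁ C₂ C₃ C₄)
    (hp : IsLineCover p) {ψ : K → ℝ} {L M : ℝ} (hψ : IsC11 p L M ψ) (hψc : HasCompactSupport ψ)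
    (hψs : ContDiff ℝ ∞ fun s => ψ (p s)) :
    (∀ t, 0 ≤ t → IntervalIntegrable
      (fun s => ∫ x, V (μ s) x * dx p ψ x ∂(μ s : Measure K)) volume 0 t) ∧
    ∀ t, 0 ≤ t → ∫ x, ψ x ∂(μ t : Measure K) = ∫ x, ψ x ∂(μ₀ : Measure K)
      + ∫ s in (0 : ℝ)..t, ∫ x, V (μ s) x * dx p ψ x ∂(μ s : Measure K) := by
  refine eq_add_integral_of_weak_deriv ?_ fun θ hθ hθc => ?_
  · exact hμ.1 ⟨⟨ψ, hψ.continuous hp⟩, hψc.is_zero_at_infty⟩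
  -- Products ψ(x)θ(t) reduce the equation to a weak ODE for t ↦ ∫ψ dμ_t.
  · have htest : IsTestFunction p (fun z : K × ℝ => ψ z.1 * θ z.2) := by
      refine ⟨HasCompactSupport.intro (hψc.isCompact.prod hθc.isCompact) fun z hz => ?_,
        (hψs.comp contDiff_fst).mul (hθ.comp contDiff_snd)⟩
      rw [mem_prod, not_and_or] at hz
      rcases hz with hz | hz
      · rw [image_eq_zero_of_notMem_tsupport hz, zero_mul]
      · rw [image_eq_zero_of_notMem_tsupport hz, mul_zero]
    have e : ∀ t, ∫ x, (deriv (fun s => ψ x * θ s) t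
        + V (μ t) x * dx p (fun y => ψ y * θ t) x) ∂(μ t : Measure K)
        = deriv θ t * (∫ x, ψ x ∂(μ t : Measure K))
          + θ t * ∫ x, V (μ t) x * dx p ψ x ∂(μ t : Measure K) := fun t => by
      rw [← integral_const_mul, ← integral_const_mul,
        ← integral_add ((hψ.integrable hp _).const_mul _)
          ((hψ.integrable_velocity_mul_dx hV hp _ _).const_mul _)]
      congr 1 with x
      rw [deriv_const_mul_field, show dx p (fun y => ψ y * θ t) x = dx p ψ x * θ t from
        deriv_mul_const_field _]
      ring
    have h := hμ.2 _ htest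
    simp only [e, integral_mul_const] at h
    exact ⟨h.1, by rw [mul_comm (θ 0)]; exact h.2⟩

lemma tendsto_integral {ν : Measure K} [IsProbabilityMeasure ν] {f : ℕ → K → ℝ} {g : K → ℝ} {D : ℝ}
    (hf : ∀ k, Continuous (f k)) (hD : ∀ k x, |f k x| ≤ D)
    (h : ∀ x, Tendsto (fun k => f k x) atTop (𝓝 (g x))) :
    Tendsto (fun k => ∫ x, f k x ∂ν) atTop (𝓝 (∫ x, g x ∂ν)) :=
  tendsto_integral_of_dominated_convergence (fun _ => D)
    (fun k => (hf k).aestronglyMeasurable) (integrable_const D)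
    (fun k => Eventually.of_forall (hD k)) (Eventually.of_forall h)

/-- Mass moves with speed at most C₁. The bound follows from the integral identity for smooth
approximations of regularized 1-Lipschitz functions. -/
lemma wClose (hμ : IsMeasureValuedSolution p V μ₀ μ) (hV : IsVelocity p V C₁ C₂ C₃ C₄)
    (hp : IsLineCover p) (hcut : HasCutoffs p) {s t : ℝ} (hs : 0 ≤ s) (hst : s ≤ t) :
    WClose (μ t : Measure K) (μ s : Measure K) (C₁ * (t - s)) := by
  have h1 := hV.pos₁
  have hts : 0 ≤ t - s := sub_nonneg.2 hst
  have key : ∀ ε : ℝ, 0 < ε → WClose (μ t : Measure K) (μ s : Measure K)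
      (C₁ * (t - s) + 2 * ε) := fun ε hε => by
    refine WClose.of_isC11 hp hε fun ψ hψ => ?_
    obtain ⟨Ψ, D, hD, hb, hΨ, hl, -⟩ := hψ.exists_smooth_approx hp hcut (by positivity)
    have lim0 : Tendsto (fun k : ℕ => (1 + D * ((1 : ℝ) / (k + 1))) * (C₁ * (t - s))) atTop
        (𝓝 ((1 + D * 0) * (C₁ * (t - s)))) :=
      ((tendsto_one_div_add_atTop_nhds_zero_nat.const_mul D).const_add 1).mul_const _
    rw [mul_zero, add_zero, one_mul] at lim0
    refine le_of_tendsto_of_tendsto' ((tendsto_integral (fun k => (hΨ k).2.2.continuous hp) hb hl).sub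
      (tendsto_integral (fun k => (hΨ k).2.2.continuous hp) hb hl)) lim0 fun k => ?_
    obtain ⟨c1, c2, c3⟩ := hΨ k
    obtain ⟨i1, i2⟩ := hμ.integral_eq hV hp c3 c1 c2
    rw [i2 t (hs.trans hst), i2 s hs, add_sub_add_left_eq_sub,
      intervalIntegral.integral_interval_sub_left (i1 t (hs.trans hst)) (i1 s hs)]
    refine (Real.le_norm_self _).trans ((intervalIntegral.norm_integral_le_of_norm_le_const
      fun r _ => c3.abs_integral_velocity_le hV _ _).trans (le_of_eq ?_))
    rw [abs_of_nonneg hts]; ring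
  intro ψ hb hl
  refine le_of_forall_pos_le_add fun e he => ?_
  have := key (e / 2) (by positivity) ψ hb hl
  linarith

/-- A solution is nearly given by Euler steps. -/
lemma abs_integral_sub_le (hμ : IsMeasureValuedSolution p V μ₀ μ)
    (hV : IsVelocity p V C₁ C₂ C₃ C₄) (hp : IsLineCover p) (hcut : HasCutoffs p) {s τ : ℝ}
    (hs : 0 ≤ s) (hτ : 0 ≤ τ) {ψ : K → ℝ} {L M : ℝ} (hM : 0 ≤ M) (hψ : IsC11 p L M ψ) :
    |∫ x, ψ x ∂(μ (s + τ) : Measure K) - ∫ x, ψ x ∂(μ s : Measure K)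
      - τ * ∫ x, V (μ s) x * dx p ψ x ∂(μ s : Measure K)|
      ≤ C₁ * (C₁ + C₂ + C₃) * τ * (L + M) * τ := by
  have h1 := hV.pos₁; have h2 := hV.pos₂; have h3 := hV.pos₃
  have hL := hψ.nonneg_left
  obtain ⟨Ψ, D, hD, hb, hΨ, hl, hl'⟩ := hψ.exists_smooth_approx hp hcut hM
  have tψ : ∀ t, Tendsto (fun k => ∫ x, Ψ k x ∂(μ t : Measure K)) atTop
      (𝓝 (∫ x, ψ x ∂(μ t : Measure K))) := fun t =>
    tendsto_integral (fun k => (hΨ k).2.2.continuous hp) hb hl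
  have tV : Tendsto (fun k => ∫ x, V (μ s) x * dx p (Ψ k) x ∂(μ s : Measure K)) atTop
      (𝓝 (∫ x, V (μ s) x * dx p ψ x ∂(μ s : Measure K))) := by
    refine tendsto_integral (D := C₁ * (L + D)) (fun k => (hV.continuous hp _).mul
      (hΨ k).2.2.continuous_dx) (fun k x => ?_) fun x => (hl' x).const_mul _
    rw [abs_mul]
    refine mul_le_mul (hV.bounded _ inferInstance x) (((hΨ k).2.2.dx_le x).trans ?_)
      (abs_nonneg _) h1.le
    gcongr
    exact div_le_self hD (by linarith [k.cast_nonneg (α := ℝ)])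
  have lim0 : Tendsto (fun k : ℕ => C₁ * (C₁ + C₂ + C₃) * τ
      * (L + M + 2 * D * ((1 : ℝ) / (k + 1))) * τ) atTop
      (𝓝 (C₁ * (C₁ + C₂ + C₃) * τ * (L + M + 2 * D * 0) * τ)) :=
    (((tendsto_one_div_add_atTop_nhds_zero_nat.const_mul (2 * D)).const_add _).const_mul _).mul_const _
  rw [mul_zero, add_zero] at lim0
  refine le_of_tendsto_of_tendsto' (((tψ _).sub (tψ _)).sub (tV.const_mul τ)).abs lim0 fun k => ?_
  obtain ⟨c1, c2, c3⟩ := hΨ k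
  obtain ⟨i1, i2⟩ := hμ.integral_eq hV hp c3 c1 c2
  set L' := L + D / (k + 1) with hL'
  set M' := M + D / (k + 1) with hM'
  have hL'0 := c3.nonneg_left
  have hM'0 : 0 ≤ M' := by positivity
  have hint := (i1 (s + τ) (by positivity))
  have hint2 : IntervalIntegrable
      (fun s => ∫ x, V (μ s) x * dx p (Ψ k) x ∂(μ s : Measure K)) volume s (s + τ) :=
    (i1 s hs).symm.trans hint
  have e : ∫ x, Ψ k x ∂(μ (s + τ) : Measure K) - ∫ x, Ψ k x ∂(μ s : Measure K)
      - τ * ∫ x, V (μ s) x * dx p (Ψ k) x ∂(μ s : Measure K)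
      = ∫ r in s..(s + τ), ((∫ x, V (μ r) x * dx p (Ψ k) x ∂(μ r : Measure K))
        - ∫ x, V (μ s) x * dx p (Ψ k) x ∂(μ s : Measure K)) := by
    rw [intervalIntegral.integral_sub hint2 (by simp), intervalIntegral.integral_const,
      i2 _ (by positivity), i2 s hs, add_sub_add_left_eq_sub,
      intervalIntegral.integral_interval_sub_left hint (i1 s hs), smul_eq_mul, add_sub_cancel_left]
  rw [e, ← Real.norm_eq_abs]
  refine (intervalIntegral.norm_integral_le_of_norm_le_const
    (C := C₁ * (C₁ + C₂ + C₃) * τ * (L' + M')) fun r hr => ?_).trans (le_of_eq ?_)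
  · rw [uIoc_of_le (by linarith)] at hr
    have hw := (hμ.wClose hV hp hcut hs hr.1.le).mono
      (show C₁ * (r - s) ≤ C₁ * τ by gcongr; linarith [hr.2])
    -- The transport term varies over time τ in two ways: the velocity field changes by C₃·C₁τ, and
    -- the measure moves by C₁τ while the integrand has Lipschitz constant C₂L' + C₁M'.
    have q1 := NonlocalLaw.abs_integral_sub_le (c3.integrable_velocity_mul_dx hV hp (μ r) (μ r))
      (c3.integrable_velocity_mul_dx hV hp (μ s) (μ r)) (c := C₃ * (C₁ * τ) * L') fun x => by
        rw [← sub_mul, abs_mul]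
        exact mul_le_mul (hV.abs_sub_le hw x) (c3.dx_le x) (abs_nonneg _) (by positivity)
    have q2 := hw.abs_integral_le (L := C₂ * L' + C₁ * M') (by positivity)
      (ψ := fun x => V (μ s) x * dx p (Ψ k) x) ⟨C₁ * L', fun x => by
        rw [abs_mul]
        exact mul_le_mul (hV.bounded _ inferInstance x) (c3.dx_le x) (abs_nonneg _) h1.le⟩
      fun x y => by
        have a1 : |(V (μ s) x - V (μ s) y) * dx p (Ψ k) x| ≤ C₂ * dist x y * L' := by
          rw [abs_mul]
          exact mul_le_mul (hV.lipSpace _ inferInstance x y) (c3.dx_le x) (abs_nonneg _)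
            (by positivity)
        have a2 : |V (μ s) y * (dx p (Ψ k) x - dx p (Ψ k) y)| ≤ C₁ * (M' * dist x y) := by
          rw [abs_mul]
          exact mul_le_mul (hV.bounded _ inferInstance y) (c3.dx_lip x y) (abs_nonneg _) h1.le
        calc _ = |(V (μ s) x - V (μ s) y) * dx p (Ψ k) x
              + V (μ s) y * (dx p (Ψ k) x - dx p (Ψ k) y)| := by ring_nf
          _ ≤ C₂ * dist x y * L' + C₁ * (M' * dist x y) :=
            (abs_add_le _ _).trans (add_le_add a1 a2)
          _ = _ := by ring
    refine (_root_.abs_sub_le _ _ _).trans ((add_le_add q1 q2).trans ?_)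
    have : 0 ≤ C₁ * τ * (C₁ * L' + C₂ * M' + C₃ * M') := by positivity
    nlinarith
  · rw [add_sub_cancel_left, abs_of_nonneg hτ, hL', hM']
    ring

/-- The initial value enters only through the weak form, so it has to be recovered by evaluating the
integral identity at t = 0. -/
lemma initial_eq (hμ : IsMeasureValuedSolution p V μ₀ μ)
    (hV : IsVelocity p V C₁ C₂ C₃ C₄) (hp : IsLineCover p) (hcut : HasCutoffs p) :
    (μ 0 : Measure K) = μ₀ := by
  refine WClose.eq_of_forall fun r hr => ?_
  have : WClose (μ 0 : Measure K) (μ₀ : Measure K) (0 + 2 * (r / 2)) := by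
    refine WClose.of_isC11 hp (by positivity) fun ψ hψ => ?_
    obtain ⟨Ψ, D, hD, hb, hΨ, hl, -⟩ := hψ.exists_smooth_approx hp hcut (by positivity)
    refine le_of_tendsto' ((tendsto_integral (fun k => (hΨ k).2.2.continuous hp) hb hl).sub
      (tendsto_integral (fun k => (hΨ k).2.2.continuous hp) hb hl)) fun k => ?_
    obtain ⟨c1, c2, c3⟩ := hΨ k
    rw [(hμ.integral_eq hV hp c3 c1 c2).2 0 le_rfl]
    simp
  exact this.mono (by linarith)

lemma eulerConsistent (hμ : IsMeasureValuedSolution p V μ₀ μ)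
    (hV : IsVelocity p V C₁ C₂ C₃ C₄) (hp : IsLineCover p) (hcut : HasCutoffs p) {τ κ : ℝ}
    (hτ : 0 ≤ τ) (hκ : C₁ * (C₁ + C₂ + C₃) * τ ≤ κ) :
    EulerConsistent p V τ κ fun n : ℕ => (μ (n * τ) : Measure K) := by
  intro n ψ L M hM hψ
  have hL := hψ.nonneg_left
  have := hμ.abs_integral_sub_le hV hp hcut (s := n * τ) (by positivity) hτ hM hψ
  push_cast
  rw [show ((n : ℝ) + 1) * τ = n * τ + τ by ring]
  exact this.trans (by gcongr)

/-- Sampled with step t/N, both solutions are consistent with an error that tends to zero and they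
start at the same measure, so stability makes them arbitrarily close at time t. -/
theorem eqOn (hμ : IsMeasureValuedSolution p V μ₀ μ) {μ' : ℝ → ProbabilityMeasure K}
    (hμ' : IsMeasureValuedSolution p V μ₀ μ') (hV : IsVelocity p V C₁ C₂ C₃ C₄)
    (hp : IsLineCover p) (hcut : HasCutoffs p) : EqOn μ' μ (Ici 0) := by
  intro t ht
  have h1 := hV.pos₁; have h2 := hV.pos₂; have h3 := hV.pos₃
  have h0 : (μ' 0 : Measure K) = μ 0 :=
    (hμ'.initial_eq hV hp hcut).trans (hμ.initial_eq hV hp hcut).symm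
  apply Subtype.ext
  rcases (mem_Ici.1 ht).eq_or_lt with rfl | ht0
  · exact h0
  refine WClose.eq_of_forall (ν₁ := (μ' t : Measure K)) (ν₂ := (μ t : Measure K)) fun η hη => ?_
  obtain ⟨κ, hκ, H⟩ := exists_wClose_of_eulerConsistent hV hp t hη
  -- The single inequality (t/N)·c ≤ 1 implies the three smallness conditions on the step, one for
  -- each summand.
  set c := 1 + C₁ ^ 2 / κ + C₁ * (C₁ + C₂ + C₃) / κ with hc
  obtain ⟨N, hN⟩ := exists_nat_gt (t * c)
  have hc0 : 0 < c := by positivity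
  have hN0 : (0 : ℝ) < N := lt_of_le_of_lt (by positivity) hN
  have hτc : t / N * c ≤ 1 := by
    rw [div_mul_eq_mul_div, div_le_one hN0]; exact hN.le
  have hτ0 : 0 < t / N := by positivity
  have b1 : t / N ≤ 1 := by
    refine le_trans (le_mul_of_one_le_right hτ0.le ?_) hτc
    have : 0 ≤ C₁ ^ 2 / κ + C₁ * (C₁ + C₂ + C₃) / κ := by positivity
    linarith
  have b2 : t / N * C₁ ^ 2 ≤ κ := by
    rw [← div_le_one hκ, mul_div_assoc]
    refine le_trans (mul_le_mul_of_nonneg_left ?_ hτ0.le) hτc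
    have : 0 ≤ C₁ * (C₁ + C₂ + C₃) / κ := by positivity
    linarith
  have b3 : C₁ * (C₁ + C₂ + C₃) * (t / N) ≤ κ := by
    rw [mul_comm, ← div_le_one hκ, mul_div_assoc]
    refine le_trans (mul_le_mul_of_nonneg_left ?_ hτ0.le) hτc
    have : 0 ≤ C₁ ^ 2 / κ := by positivity
    linarith
  have e : (N : ℝ) * (t / N) = t := by field_simp
  have := H (t / N) hτ0 b1 b2 (fun n : ℕ => (μ' (n * (t / N)) : Measure K))
    (fun n : ℕ => (μ (n * (t / N)) : Measure K)) (fun n => inferInstance) (fun n => inferInstance)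
    (hμ'.eulerConsistent hV hp hcut hτ0.le b3) (hμ.eulerConsistent hV hp hcut hτ0.le b3)
    (by simp only [Nat.cast_zero, zero_mul, h0]; exact (WClose.refl _).mono hκ.le) N e.le
  simpa only [e] using this

end IsMeasureValuedSolution

end Solutions

/-! ### Uniform meshes, step functions and the measures they represent -/

/-- Uniform meshes with cells that are the projections of `[o i, o i + h)`. -/
structure Mesh.IsUniform {K ι : Type} [NormedAddCommGroup K] [MeasureSpace K] [AddGroupWithOne ι]
    (M : Mesh K ι) (p : ℝ → K) (o : ι → ℝ) : Prop where
  width_pos : 0 < M.width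
  cell_eq : ∀ i, M.cell i = p '' Ico (o i) (o i + M.width)
  center_eq : ∀ i, M.center i = p (o i + M.width / 2)
  origin_succ : ∀ i, p (o (i + 1)) = p (o i + M.width)
  disjoint : Pairwise (Function.onFun Disjoint M.cell)
  cover : ⋃ i, M.cell i = univ
  measurableSet_arc : ∀ α s, 0 ≤ s → s ≤ M.width → MeasurableSet (p '' Ico α (α + s))
  volume_arc : ∀ α s, 0 ≤ s → s ≤ M.width → volume (p '' Ico α (α + s)) = ENNReal.ofReal s

/-- The cell densities `m` describe a probability measure. -/
structure Mesh.IsProb {K ι : Type} (M : Mesh K ι) (m : ι → ℝ) : Prop where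
  nonneg : ∀ i, 0 ≤ m i
  hasSum : HasSum (fun i => M.width * m i) 1

/-- Convex combinations. -/
lemma abs_tsum_le_of_weights {ι : Type} {w g : ι → ℝ} {c : ℝ} (hw : ∀ i, 0 ≤ w i)
    (hs : HasSum w 1) (hg : ∀ i, |g i| ≤ c) :
    Summable (fun i => w i * g i) ∧ |∑' i, w i * g i| ≤ c := by
  have hb : ∀ i, ‖w i * g i‖ ≤ w i * c := fun i => by
    rw [norm_mul, Real.norm_of_nonneg (hw i)]
    exact mul_le_mul_of_nonneg_left (hg i) (hw i)
  have hsc : HasSum (fun i => w i * c) (1 * c) := hs.mul_right c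
  exact ⟨Summable.of_norm_bounded hsc.summable hb, by
    simpa using tsum_of_norm_bounded hsc hb⟩

/-- Translation estimate in `L¹`, which holds for functions of variation at most `B`. -/
def TransBound {K : Type} [NormedAddCommGroup K] [MeasureSpace K] (p : ℝ → K) (B : ℝ)
    (u : K → ℝ) : Prop :=
  ∀ s, 0 ≤ s → ∫⁻ x, ‖u (x + p s) - u x‖ₑ ≤ ENNReal.ofReal (B * s)

namespace Mesh.IsUniform

variable {K ι : Type} [NormedAddCommGroup K] [MeasureSpace K] [BorelSpace K] [AddGroupWithOne ι]
  [Countable ι] {M : Mesh K ι} {p : ℝ → K} {o : ι → ℝ}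

lemma mem_cell_iff (hM : M.IsUniform p o) (hp : IsLineCover p) {i : ι} {x : K} :
    x ∈ M.cell i ↔ ∃ r ∈ Ico 0 M.width, x = p (o i) + p r := by
  rw [hM.cell_eq]
  constructor
  · rintro ⟨s, ⟨h1, h2⟩, rfl⟩
    exact ⟨s - o i, ⟨by linarith, by linarith⟩, by rw [← hp.map_add, add_sub_cancel]⟩
  · rintro ⟨r, ⟨h1, h2⟩, rfl⟩
    exact ⟨o i + r, ⟨by linarith, by linarith⟩, hp.map_add _ _⟩

lemma measurableSet_cell (hM : M.IsUniform p o) (i : ι) : MeasurableSet (M.cell i) := by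
  rw [hM.cell_eq]
  exact hM.measurableSet_arc _ _ hM.width_pos.le le_rfl

lemma volume_cell (hM : M.IsUniform p o) (i : ι) :
    volume (M.cell i) = ENNReal.ofReal M.width := by
  rw [hM.cell_eq]
  exact hM.volume_arc _ _ hM.width_pos.le le_rfl

lemma volume_real_cell (hM : M.IsUniform p o) (i : ι) : volume.real (M.cell i) = M.width := by
  rw [Measure.real, hM.volume_cell, ENNReal.toReal_ofReal hM.width_pos.le]

lemma dist_center_le (hM : M.IsUniform p o) (hp : IsLineCover p) {i : ι} {x : K}
    (hx : x ∈ M.cell i) : dist x (M.center i) ≤ M.width := by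
  obtain ⟨r, ⟨h1, h2⟩, rfl⟩ := (hM.mem_cell_iff hp).1 hx
  rw [hM.center_eq, hp.map_add, dist_add_left]
  refine (hp.dist_map_le _ _).trans (abs_le.2 ⟨?_, ?_⟩) <;> linarith [hM.width_pos]

lemma center_succ (hM : M.IsUniform p o) (hp : IsLineCover p) (i : ι) :
    M.center (i + 1) = M.center i + p M.width := by
  rw [hM.center_eq, hM.center_eq, hp.map_add, hM.origin_succ, hp.map_add, hp.map_add]
  abel

lemma mem_cell_succ_iff (hM : M.IsUniform p o) (hp : IsLineCover p) {i : ι} {x : K} :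
    x + p M.width ∈ M.cell (i + 1) ↔ x ∈ M.cell i := by
  rw [hM.mem_cell_iff hp, hM.mem_cell_iff hp]
  refine exists_congr fun r => and_congr_right fun _ => ?_
  rw [hM.origin_succ, hp.map_add, add_right_comm, add_left_inj]

lemma exists_mem_cell (hM : M.IsUniform p o) (x : K) : ∃ i, x ∈ M.cell i := by
  have : x ∈ ⋃ i, M.cell i := by rw [hM.cover]; trivial
  exact mem_iUnion.1 this

lemma stepFun_eq (hM : M.IsUniform p o) (m : ι → ℝ) {i : ι} {x : K} (hx : x ∈ M.cell i) :
    M.stepFun m x = m i := by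
  rw [Mesh.stepFun, tsum_eq_single i, indicator_of_mem hx]
  intro j hj
  exact indicator_of_notMem (fun h => (disjoint_left.1 (hM.disjoint hj)) h hx) _

/-- The step function factors through the map from a point to the label of its cell, and the set of
labels is countable and may be given the discrete σ-algebra. -/
lemma measurable_stepFun (hM : M.IsUniform p o) (m : ι → ℝ) : Measurable (M.stepFun m) := by
  choose f hf using hM.exists_mem_cell
  have e : M.stepFun m = m ∘ f := funext fun x => hM.stepFun_eq m (hf x)
  let _ : MeasurableSpace ι := ⊤
  have hfm : Measurable f := by
    refine measurable_to_countable' fun i => ?_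
    have : f ⁻¹' {i} = M.cell i := by
      ext x
      refine ⟨fun h => ?_, fun h => ?_⟩
      · have := hf x
        rwa [show f x = i from h] at this
      · by_contra hne
        exact disjoint_left.1 (hM.disjoint hne) (hf x) h
    rw [this]
    exact hM.measurableSet_cell i
  rw [e]
  exact measurable_from_top.comp hfm

lemma lintegral_eq_tsum (hM : M.IsUniform p o) (f : K → ℝ≥0∞) :
    ∫⁻ x, f x = ∑' i, ∫⁻ x in M.cell i, f x := by
  rw [← lintegral_iUnion hM.measurableSet_cell hM.disjoint, hM.cover, Measure.restrict_univ]

lemma hasSum_integral (hM : M.IsUniform p o) {f : K → ℝ} (hf : Integrable f) :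
    HasSum (fun i => ∫ x in M.cell i, f x) (∫ x, f x) := by
  have := hasSum_integral_iUnion hM.measurableSet_cell hM.disjoint hf.integrableOn
  rwa [hM.cover, setIntegral_univ] at this

lemma lintegral_comp_stepFun (hM : M.IsUniform p o) (m : ι → ℝ) (F : ℝ → ℝ≥0∞) :
    ∫⁻ x, F (M.stepFun m x) = ∑' i, F (m i) * ENNReal.ofReal M.width := by
  rw [hM.lintegral_eq_tsum]
  congr 1 with i
  rw [setLIntegral_congr_fun (hM.measurableSet_cell i) (g := fun _ => F (m i))
    fun x hx => by simp only [hM.stepFun_eq m hx], setLIntegral_const, hM.volume_cell]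

lemma integrable_stepFun (hM : M.IsUniform p o) {m : ι → ℝ} (hm : Summable m) :
    Integrable (M.stepFun m) := by
  refine ⟨(hM.measurable_stepFun m).aestronglyMeasurable, ?_⟩
  rw [HasFiniteIntegral, hM.lintegral_comp_stepFun m (fun y => ‖y‖ₑ), ENNReal.tsum_mul_right]
  refine ENNReal.mul_lt_top ?_ ENNReal.ofReal_lt_top
  simp_rw [← ofReal_norm]
  exact hm.norm.tsum_ofReal_lt_top

lemma hasSum_integral_mul_stepFun (hM : M.IsUniform p o) {m : ι → ℝ} (hm : Summable m)
    {ψ : K → ℝ} (hψ : Continuous ψ) {C : ℝ} (hC : ∀ x, |ψ x| ≤ C) :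
    HasSum (fun i => m i * ∫ x in M.cell i, ψ x) (∫ x, M.stepFun m x * ψ x) := by
  have := hM.hasSum_integral ((hM.integrable_stepFun hm).mul_bdd (c := C)
    hψ.aestronglyMeasurable (Eventually.of_forall hC))
  refine this.congr_fun fun i => ?_
  rw [← integral_const_mul]
  exact (setIntegral_congr_fun (hM.measurableSet_cell i) fun x hx => by
    simp only [hM.stepFun_eq m hx]).symm

lemma summable_of_isProb (hM : M.IsUniform p o) {m : ι → ℝ} (hm : M.IsProb m) : Summable m :=
  (summable_mul_left_iff hM.width_pos.ne').1 hm.hasSum.summable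

lemma stepFun_nonneg (hM : M.IsUniform p o) {m : ι → ℝ} (hm : ∀ i, 0 ≤ m i) (x : K) :
    0 ≤ M.stepFun m x := by
  obtain ⟨i, hi⟩ := hM.exists_mem_cell x
  rw [hM.stepFun_eq m hi]
  exact hm i

lemma tsum_ofReal_eq_one (hm : M.IsProb m) (hw : 0 < M.width) :
    ∑' i, ENNReal.ofReal (M.width * m i) = 1 := by
  rw [← ENNReal.ofReal_tsum_of_nonneg (fun i => mul_nonneg hw.le (hm.nonneg i)) hm.hasSum.summable,
    hm.hasSum.tsum_eq, ENNReal.ofReal_one]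

lemma isProbabilityMeasure_realize (hM : M.IsUniform p o) {m : ι → ℝ} (hm : M.IsProb m)
    (r : Realization) : IsProbabilityMeasure (M.realize m r) := by
  refine ⟨?_⟩
  cases r with
  | atoms =>
    rw [Mesh.realize, Measure.sum_apply _ MeasurableSet.univ]
    simpa using tsum_ofReal_eq_one hm hM.width_pos
  | cells =>
    rw [Mesh.realize, withDensity_apply _ MeasurableSet.univ, Measure.restrict_univ,
      hM.lintegral_comp_stepFun m ENNReal.ofReal, ← tsum_ofReal_eq_one hm hM.width_pos]
    congr 1 with i
    rw [mul_comm, ENNReal.ofReal_mul hM.width_pos.le]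

lemma hasSum_integral_atoms (hM : M.IsUniform p o) {m : ι → ℝ} (hm : M.IsProb m)
    {ψ : K → ℝ} (hψ : Continuous ψ) {C : ℝ} (hC : ∀ x, |ψ x| ≤ C) :
    HasSum (fun i => M.width * m i * ψ (M.center i)) (∫ x, ψ x ∂M.realize m .atoms) := by
  have := hM.isProbabilityMeasure_realize hm .atoms
  have h := hasSum_integral_measure
    (integrable_of_continuous_bdd (ν := M.realize m .atoms) hψ hC)
  refine h.congr_fun fun i => ?_
  rw [integral_smul_measure, integral_dirac, smul_eq_mul,
    ENNReal.toReal_ofReal (mul_nonneg hM.width_pos.le (hm.nonneg i))]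

lemma integral_cells (hM : M.IsUniform p o) {m : ι → ℝ} (hm : ∀ i, 0 ≤ m i) (ψ : K → ℝ) :
    ∫ x, ψ x ∂M.realize m .cells = ∫ x, M.stepFun m x * ψ x := by
  rw [Mesh.realize, integral_withDensity_eq_integral_toReal_smul
    (hM.measurable_stepFun m).ennreal_ofReal (Eventually.of_forall fun _ => ENNReal.ofReal_lt_top)]
  congr 1 with x
  rw [ENNReal.toReal_ofReal (hM.stepFun_nonneg hm x), smul_eq_mul]

/-- Both measures give each cell the same mass, so no mass travels further than one cell width. -/
lemma wClose_atoms_cells (hM : M.IsUniform p o) (hp : IsLineCover p) {m : ι → ℝ}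
    (hm : M.IsProb m) : WClose (M.realize m .atoms) (M.realize m .cells) M.width := by
  intro ψ ⟨C, hC⟩ hl
  have hψ : Continuous ψ := continuous_of_abs_sub_le (L := 1) (by simpa using hl)
  have h1 := hM.hasSum_integral_atoms hm hψ hC
  have h2 := hM.hasSum_integral_mul_stepFun (hM.summable_of_isProb hm) hψ hC
  rw [← hM.integral_cells hm.nonneg] at h2
  have hw := hM.width_pos
  rw [← (h1.sub h2).tsum_eq]
  have e : ∀ i, M.width * m i * ψ (M.center i) - m i * ∫ x in M.cell i, ψ x
      = M.width * m i * (ψ (M.center i) - M.width⁻¹ * ∫ x in M.cell i, ψ x) := fun i => by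
    field_simp
  simp_rw [e]
  refine (abs_tsum_le_of_weights (fun i => mul_nonneg hw.le (hm.nonneg i)) hm.hasSum
    fun i => ?_).2
  have hfin : volume (M.cell i) < ⊤ := by rw [hM.volume_cell]; exact ENNReal.ofReal_lt_top
  have hint : IntegrableOn ψ (M.cell i) :=
    Measure.integrableOn_of_bounded hfin.ne hψ.aestronglyMeasurable (Eventually.of_forall hC)
  have : ψ (M.center i) - M.width⁻¹ * ∫ x in M.cell i, ψ x
      = M.width⁻¹ * ∫ x in M.cell i, (ψ (M.center i) - ψ x) := by
    have hconst : IntegrableOn (fun _ => ψ (M.center i)) (M.cell i) := integrableOn_const hfin.ne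
    rw [integral_sub hconst hint, setIntegral_const, hM.volume_real_cell,
      smul_eq_mul]
    field_simp
  rw [this, abs_mul, abs_of_pos (inv_pos.2 hw)]
  have hb := norm_setIntegral_le_of_norm_le_const hfin (f := fun x => ψ (M.center i) - ψ x)
    (C := M.width) fun x hx => by
      refine (hl _ _).trans ?_
      rw [dist_comm]; exact hM.dist_center_le hp hx
  rw [hM.volume_real_cell, Real.norm_eq_abs] at hb
  calc _ ≤ M.width⁻¹ * (M.width * M.width) := by gcongr
    _ = M.width := by field_simp

lemma wClose_atoms (hM : M.IsUniform p o) (hp : IsLineCover p) {m : ι → ℝ}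
    (hm : M.IsProb m) (r : Realization) :
    WClose (M.realize m r) (M.realize m .atoms) M.width := by
  cases r with
  | atoms => exact (WClose.refl _).mono hM.width_pos.le
  | cells => exact (hM.wClose_atoms_cells hp hm).symm

end Mesh.IsUniform

/-! ### Translation estimates -/

section Trans

variable {K : Type} [NormedAddCommGroup K] [MeasureSpace K] [BorelSpace K]
  [(volume : Measure K).IsAddLeftInvariant] {p : ℝ → K}

/-- A long translation is a composition of n short ones, and each costs the same by translation
invariance of the measure. -/
lemma transBound_of_le (hp : IsLineCover p) {u : K → ℝ} (hu : Measurable u) {B h : ℝ}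
    (hB : 0 ≤ B) (hh : 0 < h)
    (H : ∀ s, 0 ≤ s → s ≤ h → ∫⁻ x, ‖u (x + p s) - u x‖ₑ ≤ ENNReal.ofReal (B * s)) :
    TransBound p B u := by
  have hmeas : ∀ s t, Measurable fun x => ‖u (x + p s) - u (x + p t)‖ₑ := fun s t =>
    ((hu.comp (measurable_add_const _)).sub (hu.comp (measurable_add_const _))).enorm
  have key : ∀ n : ℕ, ∀ σ, 0 ≤ σ → σ ≤ h →
      ∫⁻ x, ‖u (x + p (n * σ)) - u x‖ₑ ≤ ENNReal.ofReal (B * (n * σ)) := by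
    intro n σ h0 h1
    induction n with
    | zero => simp [hp.map_zero]
    | succ n ih =>
      calc ∫⁻ x, ‖u (x + p ((n + 1 : ℕ) * σ)) - u x‖ₑ
          ≤ ∫⁻ x, (‖u (x + p σ + p (n * σ)) - u (x + p σ)‖ₑ + ‖u (x + p σ) - u x‖ₑ) := by
            refine lintegral_mono fun x => ?_
            have : u (x + p ((n + 1 : ℕ) * σ)) - u x
                = (u (x + p σ + p (n * σ)) - u (x + p σ)) + (u (x + p σ) - u x) := by
              rw [add_assoc, ← hp.map_add, show σ + n * σ = (n + 1 : ℕ) * σ by push_cast; ring]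
              ring
            rw [this]
            exact enorm_add_le _ _
        _ = (∫⁻ x, ‖u (x + p (n * σ)) - u x‖ₑ) + ∫⁻ x, ‖u (x + p σ) - u x‖ₑ := by
            rw [lintegral_add_left (by
              simpa only [add_assoc, ← hp.map_add] using hmeas (σ + n * σ) σ),
              lintegral_add_right_eq_self (fun x => ‖u (x + p (n * σ)) - u x‖ₑ) (p σ)]
        _ ≤ ENNReal.ofReal (B * (n * σ)) + ENNReal.ofReal (B * σ) := add_le_add ih (H σ h0 h1)
        _ = ENNReal.ofReal (B * ((n + 1 : ℕ) * σ)) := by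
            rw [← ENNReal.ofReal_add (by positivity) (by positivity)]
            push_cast; ring_nf
  intro s hs
  obtain ⟨n, hn⟩ := exists_nat_gt (s / h)
  have hn0 : (0 : ℝ) < n := lt_of_le_of_lt (by positivity) hn
  have := key n (s / n) (by positivity) (by
    rw [div_le_iff₀ hn0]; rw [div_lt_iff₀ hh] at hn; linarith)
  rwa [mul_div_cancel₀ _ hn0.ne'] at this

/-- The translation estimate for step functions. -/
lemma Mesh.IsUniform.transBound_stepFun {ι : Type} [AddGroupWithOne ι] [Countable ι]
    {M : Mesh K ι} {o : ι → ℝ} (hM : M.IsUniform p o) (hp : IsLineCover p) {m : ι → ℝ} {B : ℝ}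
    (hm : Summable fun i => |m (i + 1) - m i|) (hB : ∑' i, |m (i + 1) - m i| ≤ B) :
    TransBound p B (M.stepFun m) := by
  have hB0 : 0 ≤ B := (tsum_nonneg fun i => abs_nonneg _).trans hB
  refine transBound_of_le hp (hM.measurable_stepFun m) hB0 hM.width_pos fun s hs0 hsh => ?_
  rw [hM.lintegral_eq_tsum]
  have hcell : ∀ i, ∫⁻ x in M.cell i, ‖M.stepFun m (x + p s) - M.stepFun m x‖ₑ
      ≤ ENNReal.ofReal (|m (i + 1) - m i| * s) := fun i => by
    -- The arc of length s at the right end of the cell contains exactly the points that a shift by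
    -- s ≤ h carries into the next cell; elsewhere in the cell the difference is zero.
    set A := p '' Ico (o i + M.width - s) (o i + M.width - s + s) with hA
    have hAm : MeasurableSet A := hM.measurableSet_arc _ _ hs0 hsh
    calc ∫⁻ x in M.cell i, ‖M.stepFun m (x + p s) - M.stepFun m x‖ₑ
        ≤ ∫⁻ x in M.cell i, A.indicator (fun _ => ENNReal.ofReal |m (i + 1) - m i|) x := by
          refine setLIntegral_mono' (hM.measurableSet_cell i) fun x hx => ?_
          obtain ⟨r, hr, hxr⟩ := (hM.mem_cell_iff hp).1 hx
          rw [hM.stepFun_eq m hx]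
          by_cases hrs : r + s < M.width
          · have : x + p s ∈ M.cell i := (hM.mem_cell_iff hp).2
              ⟨r + s, ⟨by linarith [hr.1], hrs⟩, by rw [hxr, hp.map_add]; abel⟩
            rw [hM.stepFun_eq m this, sub_self, enorm_zero]
            exact zero_le
          · push Not at hrs
            have h1 : x + p s ∈ M.cell (i + 1) := (hM.mem_cell_iff hp).2
              ⟨r + s - M.width, ⟨by linarith, by linarith [hr.2]⟩, by
                rw [hxr, hM.origin_succ, ← hp.map_add, ← hp.map_add, ← hp.map_add]
                congr 1; ring⟩
            have h2 : x ∈ A := ⟨o i + r, ⟨by linarith, by linarith [hr.2]⟩, by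
              rw [hxr, hp.map_add]⟩
            rw [hM.stepFun_eq m h1, indicator_of_mem h2, ← ofReal_norm, Real.norm_eq_abs]
      _ ≤ ∫⁻ x, A.indicator (fun _ => ENNReal.ofReal |m (i + 1) - m i|) x :=
          setLIntegral_le_lintegral _ _
      _ = ENNReal.ofReal (|m (i + 1) - m i| * s) := by
          rw [lintegral_indicator hAm, setLIntegral_const, hM.volume_arc _ _ hs0 hsh,
            ENNReal.ofReal_mul (abs_nonneg _)]
  refine (ENNReal.tsum_le_tsum hcell).trans ?_
  rw [← ENNReal.ofReal_tsum_of_nonneg (fun i => by positivity) (hm.mul_right s), tsum_mul_right]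
  exact ENNReal.ofReal_le_ofReal (by gcongr)

end Trans

/-! ### One Lax–Friedrichs step for given velocities -/

section Step

variable {ι : Type} [AddGroupWithOne ι]

/-- One step of the Lax–Friedrichs method for given velocities `v` at the midpoints. -/
noncomputable def lfStep (h τ : ℝ) (v m : ι → ℝ) (i : ι) : ℝ :=
  (m (i - 1) + m (i + 1)) / 2
    - τ * ((v (i + 1) * m (i + 1) - v (i - 1) * m (i - 1)) / (2 * h))

/-- Under the CFL condition the coefficients are jump probabilities: mass in cell j goes right with
weight (1 + λv_j)/2 and left with weight (1 − λv_j)/2. Positivity and conservation of mass are read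
off from this form. -/
lemma lfStep_eq (h τ : ℝ) (v m : ι → ℝ) (i : ι) :
    lfStep h τ v m i = (1 + τ / h * v (i - 1)) / 2 * m (i - 1)
      + (1 - τ / h * v (i + 1)) / 2 * m (i + 1) := by
  rw [lfStep, mul_comm 2 h, ← div_div]; ring

lemma hasSum_comp_add_one {f : ι → ℝ} {S : ℝ} (h : HasSum f S) : HasSum (fun i => f (i + 1)) S :=
  (Equiv.addRight (1 : ι)).hasSum_iff.2 h

lemma hasSum_comp_sub_one {f : ι → ℝ} {S : ℝ} (h : HasSum f S) : HasSum (fun i => f (i - 1)) S :=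
  (Equiv.subRight (1 : ι)).hasSum_iff.2 h

variable {h τ : ℝ} {v m : ι → ℝ}

lemma lfStep_nonneg (hv : ∀ i, |τ / h * v i| ≤ 1) (hm : ∀ i, 0 ≤ m i) (i : ι) :
    0 ≤ lfStep h τ v m i := by
  rw [lfStep_eq]
  have h1 := abs_le.1 (hv (i - 1))
  have h2 := abs_le.1 (hv (i + 1))
  exact add_nonneg (mul_nonneg (by linarith) (hm _)) (mul_nonneg (by linarith) (hm _))

/-- Summation by parts: the step is a random walk with jumps to the neighbouring cells. -/
lemma exists_hasSum_lfStep_mul (hv : ∀ i, |τ / h * v i| ≤ 1) (hm : Summable m) {g : ι → ℝ} {C : ℝ}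
    (hg : ∀ i, |g i| ≤ C) :
    ∃ S, HasSum (fun i => lfStep h τ v m i * g i) S ∧
      HasSum (fun j => m j * ((1 + τ / h * v j) / 2 * g (j + 1)
        + (1 - τ / h * v j) / 2 * g (j - 1))) S := by
  have hb : ∀ (w f : ι → ℝ), (∀ i, |w i| ≤ 1) → (∀ i, |f i| ≤ C) →
      Summable fun j => w j * m j * f j := fun w f hw hf => by
    refine Summable.of_norm_bounded (g := fun j => ‖m j‖ * C) (hm.norm.mul_right C) fun j => ?_
    rw [norm_mul, norm_mul]
    refine mul_le_mul ?_ (hf j) (norm_nonneg _) (norm_nonneg _)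
    exact mul_le_of_le_one_left (norm_nonneg _) (hw j)
  have h1 := hb (fun j => (1 + τ / h * v j) / 2) (fun j => g (j + 1)) (fun j => by
    have := abs_le.1 (hv j)
    rw [abs_le]; constructor <;> linarith) (fun j => hg _)
  have h2 := hb (fun j => (1 - τ / h * v j) / 2) (fun j => g (j - 1)) (fun j => by
    have := abs_le.1 (hv j)
    rw [abs_le]; constructor <;> linarith) (fun j => hg _)
  refine ⟨_, ?_, (h1.hasSum.add h2.hasSum).congr_fun fun j => by ring⟩
  refine ((hasSum_comp_sub_one h1.hasSum).add (hasSum_comp_add_one h2.hasSum)).congr_fun fun i => ?_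
  rw [lfStep_eq, sub_add_cancel, add_sub_cancel_right]
  ring

/-- Growth of the total variation in one step. -/
lemma tv_lfStep_le (hh : 0 < h) (hτ : 0 ≤ τ) {C₂ C₄ : ℝ} (hC₂ : 0 ≤ C₂)
    (hv : ∀ i, |τ / h * v i| ≤ 1)
    (hv1 : ∀ i, |v (i + 1) - v i| ≤ C₂ * h)
    (hv2 : ∀ i, |(v (i + 1 + 1 + 1) - v (i + 1 + 1)) - (v (i + 1) - v i)| ≤ 2 * C₄ * h ^ 2)
    (hm0 : ∀ i, 0 ≤ m i) (hm : HasSum (fun i => h * m i) 1) :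
    Summable (fun i => |lfStep h τ v m (i + 1) - lfStep h τ v m i|) ∧
    ∑' i, |lfStep h τ v m (i + 1) - lfStep h τ v m i|
      ≤ (1 + 2 * C₂ * τ) * (∑' i, |m (i + 1) - m i|) + C₄ * τ := by
  set D : ι → ℝ := fun i => |m (i + 1) - m i| with hD
  have hms : Summable m := (summable_mul_left_iff hh.ne').1 hm.summable
  have hDs : Summable D := ((hasSum_comp_add_one hms.hasSum).summable.sub hms).abs
  set E := ∑' i, D i with hE
  have hDE : HasSum D E := hDs.hasSum
  have hD0 : ∀ i, 0 ≤ D i := fun i => abs_nonneg _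
  set lam := τ / h with hlam
  have hlam0 : 0 ≤ lam := by positivity
  set a : ι → ℝ := fun j => (1 + lam * v j) / 2 with ha
  set b : ι → ℝ := fun j => (1 - lam * v j) / 2 with hb
  have ha0 : ∀ j, 0 ≤ a j ∧ a j ≤ 1 := fun j => by
    have := abs_le.1 (hv j)
    simp only [ha]; constructor <;> linarith
  have hb0 : ∀ j, 0 ≤ b j ∧ b j ≤ 1 := fun j => by
    have := abs_le.1 (hv j)
    simp only [hb]; constructor <;> linarith
  have sa : Summable fun j => a (j + 1) * D j :=
    hDs.of_nonneg_of_le (fun j => mul_nonneg (ha0 _).1 (hD0 j))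
      fun j => mul_le_of_le_one_left (hD0 j) (ha0 _).2
  have sb : Summable fun j => b j * D j :=
    hDs.of_nonneg_of_le (fun j => mul_nonneg (hb0 _).1 (hD0 j))
      fun j => mul_le_of_le_one_left (hD0 j) (hb0 _).2
  -- After reindexing, the coefficients of D j add up to a(j+1) + b(j) = 1 + λ(v_{j+1} − v_j)/2,
  -- hence the main part of the step increases the variation by at most a factor 1 + O(τ).
  have hab : (∑' j, a (j + 1) * D j) + ∑' j, b j * D j ≤ (1 + lam * (C₂ * h) / 2) * E := by
    refine hasSum_le (fun j => ?_) (sa.hasSum.add sb.hasSum) (hDE.mul_left _)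
    rw [← add_mul]
    refine mul_le_mul_of_nonneg_right ?_ (hD0 j)
    have : lam * (v (j + 1) - v j) ≤ lam * (C₂ * h) :=
      mul_le_mul_of_nonneg_left ((le_abs_self _).trans (hv1 j)) hlam0
    simp only [ha, hb]
    linarith
  have hpt : ∀ j, |lfStep h τ v m (j + 1 + 1) - lfStep h τ v m (j + 1)|
      ≤ a (j + 1) * D j + b (j + 1 + 1) * D (j + 1 + 1)
        + lam / 2 * (2 * C₄ * h * (h * m j) + C₂ * h * (D j + D (j + 1) + D (j + 1 + 1))) := by
    intro j
    rw [lfStep_eq, lfStep_eq, add_sub_cancel_right, add_sub_cancel_right]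
    -- The differences of v are arranged so that m j is multiplied only by a difference of two
    -- increments of v, of size h² by (A4). As the m j sum to 1/h, this costs C₄τ in total; the
    -- remaining term is again a multiple of the variation.
    have e : (1 + τ / h * v (j + 1)) / 2 * m (j + 1)
          + (1 - τ / h * v (j + 1 + 1 + 1)) / 2 * m (j + 1 + 1 + 1)
        - ((1 + τ / h * v j) / 2 * m j + (1 - τ / h * v (j + 1 + 1)) / 2 * m (j + 1 + 1))
      = a (j + 1) * (m (j + 1) - m j) + b (j + 1 + 1) * (m (j + 1 + 1 + 1) - m (j + 1 + 1))
        + -(lam / 2 * ((v (j + 1 + 1 + 1) - v (j + 1 + 1) - (v (j + 1) - v j)) * m j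
          + (v (j + 1 + 1 + 1) - v (j + 1 + 1)) * (m (j + 1 + 1 + 1) - m j))) := by
      simp only [ha, hb, hlam]; ring
    rw [e]
    refine (abs_add_le _ _).trans (add_le_add ((abs_add_le _ _).trans (add_le_add ?_ ?_)) ?_)
    · rw [abs_mul, abs_of_nonneg (ha0 _).1]
    · rw [abs_mul, abs_of_nonneg (hb0 _).1]
    · rw [abs_neg, abs_mul, abs_of_nonneg (by positivity)]
      refine mul_le_mul_of_nonneg_left ?_ (by positivity)
      refine (abs_add_le _ _).trans (add_le_add ?_ ?_)
      · rw [abs_mul, abs_of_nonneg (hm0 j)]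
        calc _ ≤ 2 * C₄ * h ^ 2 * m j := mul_le_mul_of_nonneg_right (hv2 j) (hm0 j)
          _ = _ := by ring
      · rw [abs_mul]
        refine mul_le_mul (hv1 _) ?_ (abs_nonneg _) (by positivity)
        have : m (j + 1 + 1 + 1) - m j = (m (j + 1) - m j) + (m (j + 1 + 1) - m (j + 1))
          + (m (j + 1 + 1 + 1) - m (j + 1 + 1)) := by ring
        rw [this]
        exact (abs_add_le _ _).trans (add_le_add (abs_add_le _ _) le_rfl)
  have hR : HasSum (fun j => a (j + 1) * D j + b (j + 1 + 1) * D (j + 1 + 1)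
      + lam / 2 * (2 * C₄ * h * (h * m j) + C₂ * h * (D j + D (j + 1) + D (j + 1 + 1))))
      ((∑' j, a (j + 1) * D j) + (∑' j, b j * D j)
        + lam / 2 * (2 * C₄ * h * 1 + C₂ * h * (E + E + E))) := by
    have s1 := hasSum_comp_add_one hDE
    have s2 := hasSum_comp_add_one s1
    have s3 := hasSum_comp_add_one (hasSum_comp_add_one sb.hasSum)
    exact (sa.hasSum.add s3).add (((hm.mul_left _).add
      (((hDE.add s1).add s2).mul_left _)).mul_left _)
  have hs : Summable fun j => |lfStep h τ v m (j + 1 + 1) - lfStep h τ v m (j + 1)| :=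
    hR.summable.of_nonneg_of_le (fun j => abs_nonneg _) hpt
  have hs' := hasSum_comp_sub_one hs.hasSum
  simp only [sub_add_cancel] at hs'
  refine ⟨hs'.summable, ?_⟩
  rw [hs'.tsum_eq]
  refine (hasSum_le hpt hs.hasSum hR).trans ?_
  have hlh : lam * h = τ := by rw [hlam]; field_simp
  have hE0 : 0 ≤ E := tsum_nonneg hD0
  calc _ ≤ (1 + lam * (C₂ * h) / 2) * E + lam / 2 * (2 * C₄ * h * 1 + C₂ * h * (E + E + E)) := by
        gcongr
    _ = (1 + 2 * C₂ * (lam * h)) * E + C₄ * (lam * h) := by ring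
    _ = _ := by rw [hlh]

end Step

/-! ### The Lax–Friedrichs method: positivity, variation, consistency -/

section LaxFriedrichs

variable {K ι : Type} [NormedAddCommGroup K] [MeasureSpace K] [BorelSpace K] [AddGroupWithOne ι]
  [Countable ι] {M : Mesh K ι} {p : ℝ → K} {o : ι → ℝ} {V : Measure K → K → ℝ}
  {C₁ C₂ C₃ C₄ : ℝ} {r : Realization} {τ : ℝ} {ρ₀ : K → ℝ}

/-- Second differences of functions with Lipschitz derivative. -/
lemma IsC11.abs_second_diff_le {L N : ℝ} {f : K → ℝ} (hf : IsC11 p L N f) (hp : IsLineCover p)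
    (hN : 0 ≤ N) (x : K) {h : ℝ} (hh : 0 ≤ h) :
    |(f (x + p h + p h + p h) - f (x + p h + p h)) - (f (x + p h) - f x)| ≤ 2 * N * h ^ 2 := by
  have hder : ∀ x, HasDerivAt (fun q : ℝ => f (x + p q + p h) - f (x + p q))
      (dx p f (x + p h) - dx p f x) 0 := fun x => by
    have h1 : HasDerivAt (fun q : ℝ => f (x + p h + p q)) (dx p f (x + p h)) 0 :=
      (hf.diff (x + p h)).hasDerivAt
    have h2 : HasDerivAt (fun q : ℝ => f (x + p q)) (dx p f x) 0 := (hf.diff x).hasDerivAt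
    simp only [add_right_comm x (p h)] at h1
    exact h1.sub h2
  have := hp.abs_sub_le_of_dx (ψ := fun x => f (x + p h) - f x) (L := N * h)
    (fun x => (hder x).differentiableAt) (fun x => by
      rw [show dx p (fun x => f (x + p h) - f x) x = _ from (hder x).deriv]
      refine (hf.dx_lip _ _).trans (mul_le_mul_of_nonneg_left ?_ hN)
      exact (hp.dist_add_self_le x h).trans (abs_of_nonneg hh).le) (x + p h + p h) x
  refine this.trans ?_
  have hd : dist (x + p h + p h) x ≤ 2 * h := by
    rw [add_assoc, ← hp.map_add]
    refine (hp.dist_add_self_le x _).trans ?_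
    rw [abs_of_nonneg (by positivity)]; linarith
  calc _ ≤ N * h * (2 * h) := by gcongr
    _ = _ := by ring

/-- What the method needs to know about the initial density. -/
structure IsInitialDensity (p : ℝ → K) (μ₀ : ProbabilityMeasure K) (ρ₀ : K → ℝ) (B : ℝ) :
    Prop where
  isDensity : IsDensity μ₀ ρ₀
  integrable : Integrable ρ₀
  nonneg : 0 ≤ B
  transBound : TransBound p B ρ₀

variable {μ₀ : ProbabilityMeasure K} {B : ℝ}

namespace IsInitialDensity

lemma integral_eq_one (hρ : IsInitialDensity p μ₀ ρ₀ B) : ∫ x, ρ₀ x = 1 := by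
  have h1 : (μ₀ : Measure K) univ = 1 := measure_univ
  rw [hρ.isDensity.2, withDensity_apply _ MeasurableSet.univ, Measure.restrict_univ,
    ← ofReal_integral_eq_lintegral_ofReal hρ.integrable hρ.isDensity.1] at h1
  exact ENNReal.ofReal_eq_one.1 h1

lemma integral_eq (hρ : IsInitialDensity p μ₀ ρ₀ B) (ψ : K → ℝ) :
    ∫ x, ψ x ∂(μ₀ : Measure K) = ∫ x, ρ₀ x * ψ x := by
  rw [hρ.isDensity.2, integral_withDensity_eq_integral_toReal_smul₀
    hρ.integrable.aestronglyMeasurable.aemeasurable.ennreal_ofReal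
    (Eventually.of_forall fun _ => ENNReal.ofReal_lt_top)]
  refine integral_congr_ae ?_
  filter_upwards [hρ.isDensity.1] with x hx
  rw [ENNReal.toReal_ofReal hx, smul_eq_mul]

end IsInitialDensity

namespace Mesh.IsUniform

lemma isProb_initial (hM : M.IsUniform p o) (hρ : IsInitialDensity p μ₀ ρ₀ B) :
    M.IsProb (laxFriedrichs V r M τ ρ₀ 0) := by
  have hw := hM.width_pos
  refine ⟨fun i => mul_nonneg (by positivity)
    (setIntegral_nonneg_of_ae_restrict (ae_restrict_of_ae hρ.isDensity.1)), ?_⟩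
  have := hM.hasSum_integral hρ.integrable
  rw [hρ.integral_eq_one] at this
  refine this.congr_fun fun i => ?_
  rw [laxFriedrichs]; field_simp

/-- Averaging keeps the mass of every cell, and moving it to the midpoint displaces it by at most
the cell width. -/
lemma wClose_initial (hM : M.IsUniform p o) (hp : IsLineCover p)
    (hρ : IsInitialDensity p μ₀ ρ₀ B) :
    WClose (M.realize (laxFriedrichs V r M τ ρ₀ 0) .atoms) (μ₀ : Measure K) M.width := by
  intro ψ ⟨C, hC⟩ hl
  have hw := hM.width_pos
  have hψ : Continuous ψ := continuous_of_abs_sub_le (L := 1) (by simpa using hl)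
  have hi : Integrable fun x => ρ₀ x * ψ x :=
    hρ.integrable.mul_bdd (c := C) hψ.aestronglyMeasurable (Eventually.of_forall hC)
  have h1 := hM.hasSum_integral_atoms (hM.isProb_initial (V := V) (r := r) (τ := τ) hρ) hψ hC
  have h2 := hM.hasSum_integral hi
  rw [hρ.integral_eq, ← (h1.sub h2).tsum_eq]
  have h3 := (hM.hasSum_integral hρ.integrable).mul_right M.width
  rw [hρ.integral_eq_one, one_mul] at h3
  rw [← Real.norm_eq_abs]
  refine tsum_of_norm_bounded h3 fun i => ?_
  have e : M.width * laxFriedrichs V r M τ ρ₀ 0 i * ψ (M.center i) - ∫ x in M.cell i, ρ₀ x * ψ x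
      = ∫ x in M.cell i, ρ₀ x * (ψ (M.center i) - ψ x) := by
    simp only [mul_sub]
    rw [integral_sub (hρ.integrable.integrableOn.mul_const _) hi.integrableOn,
      integral_mul_const, laxFriedrichs]
    field_simp
  rw [e, ← integral_mul_const]
  refine norm_integral_le_of_norm_le (hρ.integrable.integrableOn.mul_const _) ?_
  filter_upwards [ae_restrict_mem (hM.measurableSet_cell i),
    ae_restrict_of_ae hρ.isDensity.1] with x hx h0
  rw [norm_mul, Real.norm_of_nonneg h0]
  refine mul_le_mul_of_nonneg_left ((hl _ _).trans ?_) h0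
  rw [dist_comm]; exact hM.dist_center_le hp hx

/-- The difference of neighbouring cell averages is the average of ρ₀(x + h) − ρ₀(x), so the sum is
at most ‖ρ₀(·+h) − ρ₀‖₁/h. -/
lemma tv_initial [(volume : Measure K).IsAddLeftInvariant] (hM : M.IsUniform p o)
    (hp : IsLineCover p) (hρ : IsInitialDensity p μ₀ ρ₀ B) :
    ∑' i, |laxFriedrichs V r M τ ρ₀ 0 (i + 1) - laxFriedrichs V r M τ ρ₀ 0 i| ≤ B := by
  have hw := hM.width_pos
  have hmp : MeasurePreserving (fun x : K => x + p M.width) := measurePreserving_add_right _ _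
  have hi : Integrable fun x => ρ₀ (x + p M.width) :=
    hmp.integrable_comp_of_integrable hρ.integrable
  have hd : Integrable fun x => ρ₀ (x + p M.width) - ρ₀ x := hi.sub hρ.integrable
  have e : ∀ i, laxFriedrichs V r M τ ρ₀ 0 (i + 1) - laxFriedrichs V r M τ ρ₀ 0 i
      = 1 / M.width * ∫ x in M.cell i, (ρ₀ (x + p M.width) - ρ₀ x) := fun i => by
    have h1 : ∫ x in M.cell (i + 1), ρ₀ x = ∫ x in M.cell i, ρ₀ (x + p M.width) := by
      rw [← hmp.setIntegral_preimage_emb (measurableEmbedding_addRight _)]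
      congr 2
      ext x
      exact hM.mem_cell_succ_iff hp
    simp only [laxFriedrichs]
    rw [h1, integral_sub hi.integrableOn hρ.integrable.integrableOn, mul_sub]
  simp_rw [e]
  have hs := (hM.hasSum_integral hd.abs).mul_left (1 / M.width)
  have hle : ∀ i, |1 / M.width * ∫ x in M.cell i, (ρ₀ (x + p M.width) - ρ₀ x)|
      ≤ 1 / M.width * ∫ x in M.cell i, |ρ₀ (x + p M.width) - ρ₀ x| := fun i => by
    rw [abs_mul, abs_of_pos (by positivity)]
    exact mul_le_mul_of_nonneg_left (abs_integral_le_integral_abs) (by positivity)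
  have hs' : Summable fun i => |1 / M.width * ∫ x in M.cell i, (ρ₀ (x + p M.width) - ρ₀ x)| :=
    hs.summable.of_nonneg_of_le (fun i => abs_nonneg _) hle
  refine (hasSum_le hle hs'.hasSum hs).trans ?_
  have ht := hρ.transBound M.width hw.le
  have hn : ∫ x, |ρ₀ (x + p M.width) - ρ₀ x| ≤ B * M.width := by
    have hB := hρ.nonneg
    have := integral_norm_eq_lintegral_enorm hd.aestronglyMeasurable
    simp only [Real.norm_eq_abs] at this
    rw [this]
    exact ENNReal.toReal_le_of_le_ofReal (by positivity) ht
  rw [one_div, inv_mul_le_iff₀ hw, mul_comm]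
  exact hn

lemma abs_cfl_le (hM : M.IsUniform p o)
    (hV : IsVelocity p V C₁ C₂ C₃ C₄) (hτ : 0 ≤ τ) (hcfl : τ / M.width ≤ C₁⁻¹)
    {m : ι → ℝ} (hm : M.IsProb m) (i : ι) :
    |τ / M.width * V (M.realize m r) (M.center i)| ≤ 1 := by
  have hw := hM.width_pos
  have := hM.isProbabilityMeasure_realize hm r
  rw [abs_mul, abs_of_nonneg (by positivity)]
  calc _ ≤ C₁⁻¹ * C₁ := mul_le_mul hcfl (hV.bounded _ this _) (abs_nonneg _)
        (inv_nonneg.2 hV.pos₁.le)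
    _ = 1 := inv_mul_cancel₀ hV.pos₁.ne'

lemma isProb_laxFriedrichs (hM : M.IsUniform p o)
    (hV : IsVelocity p V C₁ C₂ C₃ C₄) (hρ : IsInitialDensity p μ₀ ρ₀ B)
    (hτ : 0 ≤ τ) (hcfl : τ / M.width ≤ C₁⁻¹) (n : ℕ) :
    M.IsProb (laxFriedrichs V r M τ ρ₀ n) := by
  induction n with
  | zero => exact hM.isProb_initial hρ
  | succ n ih =>
    have hc := hM.abs_cfl_le hV (r := r) hτ hcfl ih
    refine ⟨lfStep_nonneg hc ih.nonneg, ?_⟩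
    -- Testing the random walk with a constant gives conservation of mass, since the two jump
    -- weights add up to 1.
    obtain ⟨S, h1, h2⟩ := exists_hasSum_lfStep_mul hc (hM.summable_of_isProb ih)
      (g := fun _ => M.width) (C := M.width) (fun _ => (abs_of_pos hM.width_pos).le)
    have hS : S = 1 := by
      refine h2.unique (ih.hasSum.congr_fun fun j => ?_)
      ring
    rw [← hS]
    exact h1.congr_fun fun i => mul_comm _ _

/-- Discrete Gronwall applied to the one-step bound; neighbouring velocities and their second
differences are controlled by (A2) and (A4). -/
lemma tv_laxFriedrichs [(volume : Measure K).IsAddLeftInvariant] (hM : M.IsUniform p o)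
    (hV : IsVelocity p V C₁ C₂ C₃ C₄)
    (hp : IsLineCover p) (hρ : IsInitialDensity p μ₀ ρ₀ B)
    (hτ : 0 ≤ τ) (hcfl : τ / M.width ≤ C₁⁻¹) (n : ℕ) :
    ∑' i, |laxFriedrichs V r M τ ρ₀ n (i + 1) - laxFriedrichs V r M τ ρ₀ n i|
      ≤ Real.exp (2 * C₂ * (n * τ)) * (B + C₄ * (n * τ)) := by
  have h2 := hV.pos₂; have h4 := hV.pos₄; have hw := hM.width_pos; have hB := hρ.nonneg
  induction n with
  | zero => simpa using hM.tv_initial hp hρ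
  | succ n ih =>
    have hm := hM.isProb_laxFriedrichs hV (r := r) hρ hτ hcfl n
    have hprob := hM.isProbabilityMeasure_realize hm r
    have hc := hV.isC11 hp (M.realize (laxFriedrichs V r M τ ρ₀ n) r)
    have := (tv_lfStep_le hw hτ h2.le (hM.abs_cfl_le hV (r := r) hτ hcfl hm)
      (fun i => by
        refine (hV.lipSpace _ hprob _ _).trans (mul_le_mul_of_nonneg_left ?_ h2.le)
        rw [hM.center_succ hp]
        exact (hp.dist_add_self_le _ _).trans (abs_of_pos hw).le)
      (fun i => by
        simp only [hM.center_succ hp]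
        exact hc.abs_second_diff_le hp h4.le _ hw.le) hm.nonneg hm.hasSum).2
    refine this.trans ?_
    have x1 : 1 + 2 * C₂ * τ ≤ Real.exp (2 * C₂ * τ) := by
      rw [add_comm]; exact Real.add_one_le_exp _
    have x2 : 1 ≤ Real.exp (2 * C₂ * ((n + 1 : ℕ) * τ)) := Real.one_le_exp (by positivity)
    have x3 : Real.exp (2 * C₂ * ((n + 1 : ℕ) * τ))
        = Real.exp (2 * C₂ * τ) * Real.exp (2 * C₂ * (n * τ)) := by
      rw [← Real.exp_add]; push_cast; ring_nf
    calc _ ≤ Real.exp (2 * C₂ * τ) * (Real.exp (2 * C₂ * (n * τ)) * (B + C₄ * (n * τ)))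
          + Real.exp (2 * C₂ * ((n + 1 : ℕ) * τ)) * (C₄ * τ) := by
          refine add_le_add (mul_le_mul x1 ih (tsum_nonneg fun _ => abs_nonneg _) (by positivity)) ?_
          exact le_mul_of_one_le_left (by positivity) x2
      _ = _ := by rw [x3]; push_cast; ring

/-- Consistency of the method, read as a scheme for atomic measures. -/
lemma eulerConsistent_laxFriedrichs (hM : M.IsUniform p o)
    (hV : IsVelocity p V C₁ C₂ C₃ C₄) (hp : IsLineCover p)
    (hρ : IsInitialDensity p μ₀ ρ₀ B) {lam : ℝ} (hlam : 0 < lam) (hlamτ : lam ≤ τ / M.width)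
    (hcfl : τ / M.width ≤ C₁⁻¹) :
    EulerConsistent p V τ ((1 / lam + C₃) * M.width)
      fun n => M.realize (laxFriedrichs V r M τ ρ₀ n) .atoms := by
  have h1 := hV.pos₁; have h3 := hV.pos₃; have hw := hM.width_pos
  have hτ : 0 < τ := by
    rw [le_div_iff₀ hw] at hlamτ
    exact lt_of_lt_of_le (by positivity) hlamτ
  intro n ψ L N hN hψ
  have hL := hψ.nonneg_left
  obtain ⟨C, hC⟩ := hψ.bdd
  have hψc := hψ.continuous hp
  set m := laxFriedrichs V r M τ ρ₀ n with hm'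
  have hm : M.IsProb m := hM.isProb_laxFriedrichs hV (r := r) hρ hτ.le hcfl n
  have hm1 : M.IsProb (laxFriedrichs V r M τ ρ₀ (n + 1)) :=
    hM.isProb_laxFriedrichs hV (r := r) hρ hτ.le hcfl (n + 1)
  have hp1 := hM.isProbabilityMeasure_realize hm r
  have hp2 := hM.isProbabilityMeasure_realize hm .atoms
  set v : ι → ℝ := fun j => V (M.realize m r) (M.center j) with hv
  have hc : ∀ i, |τ / M.width * v i| ≤ 1 := hM.abs_cfl_le hV (r := r) hτ.le hcfl hm
  obtain ⟨S, s1, s2⟩ := exists_hasSum_lfStep_mul hc (hM.summable_of_isProb hm)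
    (g := fun i => M.width * ψ (M.center i)) (C := M.width * C) fun i => by
      rw [abs_mul, abs_of_pos hw]
      exact mul_le_mul_of_nonneg_left (hC _) hw.le
  have t1 := hM.hasSum_integral_atoms hm1 hψc hC
  have t2 := hM.hasSum_integral_atoms hm hψc hC
  have t3 := (hM.hasSum_integral_atoms hm (ψ := fun x => V (M.realize m .atoms) x * dx p ψ x)
    ((hV.continuous hp (M.realize m .atoms)).mul hψ.continuous_dx) (C := C₁ * L) fun x => by
      rw [abs_mul]
      exact mul_le_mul (hV.bounded _ hp2 x) (hψ.dx_le x) (abs_nonneg _) h1.le).mul_left τ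
  have eS : S = ∫ x, ψ x ∂M.realize (laxFriedrichs V r M τ ρ₀ (n + 1)) .atoms := by
    refine s1.unique (t1.congr_fun fun i => ?_)
    change lfStep M.width τ v m i * _ = M.width * lfStep M.width τ v m i * _
    ring
  rw [eS] at s2
  change |∫ x, ψ x ∂M.realize (laxFriedrichs V r M τ ρ₀ (n + 1)) .atoms
    - ∫ x, ψ x ∂M.realize m .atoms
    - τ * ∫ x, V (M.realize m .atoms) x * dx p ψ x ∂M.realize m .atoms| ≤ _
  rw [← ((s2.sub t2).sub t3).tsum_eq]
  set c := (1 / lam + C₃) * M.width * (L + N) * τ with hcdef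
  have e : ∀ j, m j * ((1 + τ / M.width * v j) / 2 * (M.width * ψ (M.center (j + 1)))
        + (1 - τ / M.width * v j) / 2 * (M.width * ψ (M.center (j - 1))))
      - M.width * m j * ψ (M.center j)
      - τ * (M.width * m j * (V (M.realize m .atoms) (M.center j) * dx p ψ (M.center j)))
      = M.width * m j * ((1 + τ / M.width * v j) / 2 * ψ (M.center (j + 1))
        + (1 - τ / M.width * v j) / 2 * ψ (M.center (j - 1)) - ψ (M.center j)
        - τ * (V (M.realize m .atoms) (M.center j) * dx p ψ (M.center j))) := fun j => by ring
  simp_rw [e]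
  refine (abs_tsum_le_of_weights (fun i => mul_nonneg hw.le (hm.nonneg i)) hm.hasSum
    fun j => ?_).2
  have hcp : M.center (j - 1) = M.center j + p (-M.width) := by
    have := hM.center_succ hp (j - 1)
    rw [sub_add_cancel] at this
    rw [this, hp.map_neg, add_neg_cancel_right]
  rw [hM.center_succ hp, hcp]
  set x := M.center j
  have r1 := hψ.taylor hp hN x M.width
  have r2 := hψ.taylor hp hN x (-M.width)
  -- Consistency is stated for the atoms whichever realization the scheme inserts in V; the
  -- discrepancy costs C₃h by (A3).
  have r3 : |v j - V (M.realize m .atoms) x| ≤ C₃ * M.width :=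
    hV.abs_sub_le (hM.wClose_atoms hp hm r) x
  have hcj := abs_le.1 (hc j)
  set α := (1 + τ / M.width * v j) / 2 with hα
  set β := (1 - τ / M.width * v j) / 2 with hβ
  have hα0 : 0 ≤ α := by rw [hα]; linarith
  have hβ0 : 0 ≤ β := by rw [hβ]; linarith
  have hαβ : α + β = 1 := by rw [hα, hβ]; ring
  have hαβ' : (α - β) * M.width = τ * v j := by rw [hα, hβ]; field_simp; ring
  -- The mean displacement (α − β)h equals τ v j, so the first-order terms cancel and only Taylor
  -- remainders and the velocity discrepancy are left.
  have e2 : α * ψ (x + p M.width) + β * ψ (x + p (-M.width)) - ψ x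
        - τ * (V (M.realize m .atoms) x * dx p ψ x)
      = α * (ψ (x + p M.width) - ψ x - M.width * dx p ψ x)
        + β * (ψ (x + p (-M.width)) - ψ x - -M.width * dx p ψ x)
        + τ * ((v j - V (M.realize m .atoms) x) * dx p ψ x) := by
    have : ψ x = (α + β) * ψ x := by rw [hαβ, one_mul]
    linear_combination (-1 : ℝ) * this + dx p ψ x * hαβ'
  rw [e2]
  have b1 : |α * (ψ (x + p M.width) - ψ x - M.width * dx p ψ x)| ≤ α * (N * M.width ^ 2) := by
    rw [abs_mul, abs_of_nonneg hα0]; exact mul_le_mul_of_nonneg_left r1 hα0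
  have b2 : |β * (ψ (x + p (-M.width)) - ψ x - -M.width * dx p ψ x)| ≤ β * (N * M.width ^ 2) := by
    rw [abs_mul, abs_of_nonneg hβ0]
    refine mul_le_mul_of_nonneg_left (r2.trans (le_of_eq ?_)) hβ0
    rw [neg_sq]
  have b3 : |τ * ((v j - V (M.realize m .atoms) x) * dx p ψ x)| ≤ τ * (C₃ * M.width * L) := by
    rw [abs_mul, abs_of_pos hτ, abs_mul]
    exact mul_le_mul_of_nonneg_left
      (mul_le_mul r3 (hψ.dx_le x) (abs_nonneg _) (by positivity)) hτ.le
  -- The lower CFL bound enters here: the remainder h² per step is at most hτ/λ₀.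
  have b4 : M.width ≤ τ / lam := by
    rw [le_div_iff₀ hlam]; rw [le_div_iff₀ hw] at hlamτ; linarith
  have b5 : N * M.width ^ 2 ≤ N * (M.width * (τ / lam)) := by rw [sq]; gcongr
  calc _ ≤ α * (N * M.width ^ 2) + β * (N * M.width ^ 2) + τ * (C₃ * M.width * L) :=
        (abs_add_le _ _).trans (add_le_add ((abs_add_le _ _).trans (add_le_add b1 b2)) b3)
    _ = N * M.width ^ 2 + τ * (C₃ * M.width * L) := by rw [← add_mul, hαβ, one_mul]
    _ ≤ N * (M.width * (τ / lam)) + τ * (C₃ * M.width * L) := by gcongr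
    _ ≤ c := by
      rw [hcdef]
      have q1 : 0 ≤ 1 / lam * M.width * L * τ := by positivity
      have q2 : 0 ≤ C₃ * M.width * N * τ := by positivity
      have q3 : N * (M.width * (τ / lam)) = 1 / lam * M.width * N * τ := by ring
      rw [q3]; nlinarith

end Mesh.IsUniform

end LaxFriedrichs

/-! ### From Wasserstein closeness to L¹ closeness -/

section L1

variable {K : Type} [NormedAddCommGroup K] [MeasureSpace K] [BorelSpace K]
  {p : ℝ → K}

/-- `u` is a density of `ν` whose variation, in the sense of translations, is at most `B`. -/
structure HasBVDensity (p : ℝ → K) (B : ℝ) (ν : Measure K) (u : K → ℝ) : Prop where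
  measurable : Measurable u
  nonneg : ∀ x, 0 ≤ u x
  integrable : Integrable u
  transBound : TransBound p B u
  eq_withDensity : ν = volume.withDensity fun x => ENNReal.ofReal (u x)

lemma integral_withDensity_ofReal {u : K → ℝ} (hu : Measurable u) (h0 : 0 ≤ᵐ[volume] u)
    (ψ : K → ℝ) :
    ∫ x, ψ x ∂(volume.withDensity fun x => ENNReal.ofReal (u x)) = ∫ x, u x * ψ x := by
  rw [integral_withDensity_eq_integral_toReal_smul hu.ennreal_ofReal
    (Eventually.of_forall fun _ => ENNReal.ofReal_lt_top)]
  refine integral_congr_ae ?_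
  filter_upwards [h0] with x hx
  rw [ENNReal.toReal_ofReal hx, smul_eq_mul]

variable [(volume : Measure K).IsAddLeftInvariant] [SigmaFinite (volume : Measure K)]

lemma TransBound.integral_le {B : ℝ} (hB : 0 ≤ B) {u : K → ℝ} (hu : Integrable u)
    (h : TransBound p B u) {s : ℝ} (hs : 0 ≤ s) : ∫ x, |u (x + p s) - u x| ≤ B * s := by
  have hi : Integrable fun x => u (x + p s) :=
    (measurePreserving_add_right (volume : Measure K) (p s)).integrable_comp_of_integrable hu
  have := integral_norm_eq_lintegral_enorm (hi.sub hu).aestronglyMeasurable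
  simp only [Real.norm_eq_abs, Pi.sub_apply] at this
  rw [this]
  exact ENNReal.toReal_le_of_le_ofReal (by positivity) (h s hs)

/-- Interpolation between the Wasserstein distance and the variation. -/
lemma HasBVDensity.integral_abs_sub_le (hp : IsLineCover p) {B r ε : ℝ} {ν ν' : Measure K}
    {u u' : K → ℝ} (hB : 0 ≤ B) (h : HasBVDensity p B ν u) (h' : HasBVDensity p B ν' u')
    (hc : WClose ν ν' r) (hε : 0 < ε) : ∫ x, |u x - u' x| ≤ 2 * B * ε + 2 * r / ε := by
  set w : K → ℝ := fun x => u x - u' x with hw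
  have hwm : Measurable w := h.measurable.sub h'.measurable
  have hwi : Integrable w := h.integrable.sub h'.integrable
  -- The sign of w = u − u', for which ∫gw is the L¹ norm; it is bounded but not Lipschitz.
  set g : K → ℝ := fun x => if 0 ≤ w x then 1 else -1 with hg
  have hgm : Measurable g :=
    Measurable.ite (measurableSet_le measurable_const hwm) measurable_const measurable_const
  have hgb : ∀ x, |g x| ≤ 1 := fun x => by
    simp only [hg]; split_ifs <;> simp
  have hgw : ∀ x, g x * w x = |w x| := fun x => by
    simp only [hg]
    split_ifs with h0
    · rw [one_mul, abs_of_nonneg h0]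
    · rw [neg_one_mul, abs_of_neg (not_le.1 h0)]
  have hadd : Measurable fun z : K × ℝ => z.1 + p z.2 :=
    (continuous_fst.add (hp.continuous.comp continuous_snd)).measurable
  have hgs : ∀ x, Measurable fun s => g (x + p s) := fun x =>
    hgm.comp (continuous_const.add hp.continuous).measurable
  have hgsi : ∀ x a b, IntervalIntegrable (fun s => g (x + p s)) volume a b := fun x a b =>
    (intervalIntegrable_const (c := (1 : ℝ))).mono_fun (hgs x).aestronglyMeasurable
      (Eventually.of_forall fun s => by simpa using hgb _)
  -- Averaging the sign over a length ε gives Lipschitz constant 2/ε, so that the Wasserstein bound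
  -- applies to it.
  set G : K → ℝ := fun x => ε⁻¹ * ∫ s in (0 : ℝ)..ε, g (x + p s) with hG
  have hGb : ∀ x, |G x| ≤ 1 := fun x => by
    have := intervalIntegral.norm_integral_le_of_norm_le_const (a := 0) (b := ε)
      (f := fun s => g (x + p s)) (C := 1) fun s _ => hgb _
    rw [sub_zero, abs_of_pos hε, one_mul, Real.norm_eq_abs] at this
    simp only [hG]
    rw [abs_mul, abs_of_pos (inv_pos.2 hε), inv_mul_le_iff₀ hε, mul_one]
    exact this
  have hGl : ∀ x y, |G x - G y| ≤ 2 / ε * dist x y := fun x y => by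
    obtain ⟨q, rfl, hq⟩ := hp.exists_shift x y
    have e1 : ∫ s in (0 : ℝ)..ε, g (x + p q + p s) = ∫ s in q..(q + ε), g (x + p s) := by
      have := intervalIntegral.integral_comp_add_left (a := 0) (b := ε)
        (fun s => g (x + p s)) q
      rw [add_zero] at this
      rw [← this]
      simp only [hp.map_add, add_assoc]
    have e2 : (∫ s in (0 : ℝ)..ε, g (x + p s)) - ∫ s in q..(q + ε), g (x + p s)
        = (∫ s in (0 : ℝ)..q, g (x + p s)) - ∫ s in ε..(q + ε), g (x + p s) :=
      intervalIntegral.integral_interval_sub_interval_comm (hgsi _ _ _) (hgsi _ _ _) (hgsi _ _ _)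
    have b1 := intervalIntegral.norm_integral_le_of_norm_le_const (a := 0) (b := q)
      (f := fun s => g (x + p s)) (C := 1) fun s _ => hgb _
    have b2 := intervalIntegral.norm_integral_le_of_norm_le_const (a := ε) (b := q + ε)
      (f := fun s => g (x + p s)) (C := 1) fun s _ => hgb _
    rw [sub_zero, one_mul, Real.norm_eq_abs] at b1
    rw [add_sub_cancel_right, one_mul, Real.norm_eq_abs] at b2
    simp only [hG]
    rw [← mul_sub, e1, e2, abs_mul, abs_of_pos (inv_pos.2 hε), div_mul_eq_mul_div,
      div_eq_inv_mul, ← hq]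
    refine mul_le_mul_of_nonneg_left ?_ (inv_pos.2 hε).le
    refine (abs_sub _ _).trans ?_
    linarith
  have hGc : Continuous G := continuous_of_abs_sub_le hGl
  have hFub : Integrable (Function.uncurry fun x s => g (x + p s) * w x)
      (volume.prod (volume.restrict (Ioc 0 ε))) := by
    have h1 : Integrable (fun z : K × ℝ => w z.1 * 1) (volume.prod (volume.restrict (Ioc 0 ε))) :=
      hwi.mul_prod (integrable_const (1 : ℝ))
    have h2 := h1.bdd_mul (c := 1) (f := fun z : K × ℝ => g (z.1 + p z.2))
      (hgm.comp hadd).aestronglyMeasurable (Eventually.of_forall fun z => hgb _)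
    simpa [Function.uncurry_def] using h2
  have hswap : ∫ x, G x * w x = ε⁻¹ * ∫ s in (0 : ℝ)..ε, ∫ x, g (x + p s) * w x := by
    rw [intervalIntegral.integral_of_le hε.le, ← integral_integral_swap hFub, ← integral_const_mul]
    congr 1 with x
    simp only [hG]
    rw [intervalIntegral.integral_of_le hε.le, integral_mul_const, mul_assoc]
  have hJi : IntervalIntegrable (fun s => ∫ x, g (x + p s) * w x) volume 0 ε :=
    (intervalIntegrable_iff_integrableOn_Ioc_of_le hε.le).2 hFub.integral_prod_right
  have hwtrans : ∀ s, 0 ≤ s → ∫ x, |w (x + p s) - w x| ≤ 2 * B * s := fun s hs => by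
    have i1 := (measurePreserving_add_right (volume : Measure K) (p s)).integrable_comp_of_integrable
      h.integrable
    have i2 := (measurePreserving_add_right (volume : Measure K) (p s)).integrable_comp_of_integrable
      h'.integrable
    have a1 : Integrable fun x => |u (x + p s) - u x| := (i1.sub h.integrable).abs
    have a2 : Integrable fun x => |u' (x + p s) - u' x| := (i2.sub h'.integrable).abs
    have t1 := h.transBound.integral_le hB h.integrable hs
    have t2 := h'.transBound.integral_le hB h'.integrable hs
    calc ∫ x, |w (x + p s) - w x| ≤ ∫ x, (|u (x + p s) - u x| + |u' (x + p s) - u' x|) := by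
          refine integral_mono_of_nonneg (Eventually.of_forall fun x => abs_nonneg _) (a1.add a2)
            (Eventually.of_forall fun x => ?_)
          have : w (x + p s) - w x = (u (x + p s) - u x) - (u' (x + p s) - u' x) := by
            simp only [hw]; ring
          simp only [this]
          exact abs_sub _ _
      _ ≤ B * s + B * s := by rw [integral_add a1 a2]; exact add_le_add t1 t2
      _ = 2 * B * s := by ring
  -- Translation invariance moves the shift from g to w, where the bound on the variation applies;
  -- averaging thus costs at most 2Bε.
  have hJ : ∀ s ∈ uIoc (0 : ℝ) ε, ‖(∫ x, g x * w x) - ∫ x, g (x + p s) * w x‖ ≤ 2 * B * ε := by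
    intro s hs
    rw [uIoc_of_le hε.le] at hs
    have i1 := (measurePreserving_add_right (volume : Measure K) (p s)).integrable_comp_of_integrable
      hwi
    have hgsm : AEStronglyMeasurable (fun x => g (x + p s)) :=
      (hgm.comp (measurable_add_const _)).aestronglyMeasurable
    have j1 : Integrable fun x => g (x + p s) * w (x + p s) :=
      i1.bdd_mul (c := 1) hgsm (Eventually.of_forall fun z => hgb _)
    have j2 : Integrable fun x => g (x + p s) * w x :=
      hwi.bdd_mul (c := 1) hgsm (Eventually.of_forall fun z => hgb _)
    rw [← integral_add_right_eq_self (fun x => g x * w x) (p s), ← integral_sub j1 j2]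
    refine (norm_integral_le_of_norm_le (i1.sub hwi).abs (Eventually.of_forall fun x => ?_)).trans
      ((hwtrans s hs.1.le).trans ?_)
    · rw [← mul_sub, norm_mul]
      exact mul_le_of_le_one_left (norm_nonneg _) (hgb _)
    · exact mul_le_mul_of_nonneg_left hs.2 (by positivity)
  have hfirst : (∫ x, g x * w x) - ∫ x, G x * w x ≤ 2 * B * ε := by
    have e : (∫ x, g x * w x) - ∫ x, G x * w x
        = ε⁻¹ * ∫ s in (0 : ℝ)..ε, ((∫ x, g x * w x) - ∫ x, g (x + p s) * w x) := by
      rw [hswap, intervalIntegral.integral_sub (by simp) hJi, intervalIntegral.integral_const]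
      simp only [smul_eq_mul, sub_zero]
      field_simp
    rw [e, inv_mul_le_iff₀ hε]
    have := intervalIntegral.norm_integral_le_of_norm_le_const hJ
    rw [sub_zero, abs_of_pos hε] at this
    refine (Real.le_norm_self _).trans (this.trans (le_of_eq (mul_comm _ _)))
  have hsecond : ∫ x, G x * w x ≤ 2 * r / ε := by
    have := hc.abs_integral_le (L := 2 / ε) (by positivity) (ψ := G) ⟨1, hGb⟩ hGl
    rw [h.eq_withDensity, h'.eq_withDensity,
      integral_withDensity_ofReal h.measurable (Eventually.of_forall h.nonneg),
      integral_withDensity_ofReal h'.measurable (Eventually.of_forall h'.nonneg)] at this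
    have e : ∫ x, G x * w x = (∫ x, u x * G x) - ∫ x, u' x * G x := by
      rw [← integral_sub (h.integrable.mul_bdd (c := 1) hGc.aestronglyMeasurable
        (Eventually.of_forall hGb)) (h'.integrable.mul_bdd (c := 1) hGc.aestronglyMeasurable
        (Eventually.of_forall hGb))]
      congr 1 with x
      simp only [hw]; ring
    rw [e]
    refine (le_abs_self _).trans (this.trans (le_of_eq (by ring)))
  have : ∫ x, |u x - u' x| = ∫ x, g x * w x := by
    congr 1 with x
    rw [hgw]
  rw [this]
  linarith

/-- A limit in the Wasserstein distance of measures with densities of uniformly bounded variation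
has a density, and the densities converge in `L¹`. -/
theorem absolutelyContinuous_and_eLpNorm_le (hp : IsLineCover p) {B : ℝ} (hB : 0 ≤ B)
    {μ : Measure K} [IsProbabilityMeasure μ]
    (H : ∀ r > 0, ∃ ν u, HasBVDensity p B ν u ∧ WClose ν μ r) :
    μ ≪ volume ∧ ∀ ν u r ε, 0 < ε → HasBVDensity p B ν u → WClose ν μ r →
      eLpNorm (fun x => u x - (μ.rnDeriv volume x).toReal) 1 volume
        ≤ ENNReal.ofReal (2 * B * ε + 2 * r / ε) := by
  have hr0 : ∀ k : ℕ, (0 : ℝ) < 1 / (k + 1) := fun k => by positivity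
  choose ν u hu hν using fun k : ℕ => H (1 / (k + 1)) (hr0 k)
  have hdist : ∀ k l, dist ((hu k).integrable.toL1 (u k)) ((hu l).integrable.toL1 (u l))
      = ∫ x, |u k x - u l x| := fun k l => by
    rw [dist_eq_norm, ← Integrable.toL1_sub, Integrable.norm_toL1_eq_lintegral_norm,
      ← integral_eq_lintegral_of_nonneg_ae (Eventually.of_forall fun x => norm_nonneg _)
        ((hu k).integrable.sub (hu l).integrable).norm.aestronglyMeasurable]
    rfl
  have hest : ∀ k l, ∀ ε > 0, ∫ x, |u k x - u l x|
      ≤ 2 * B * ε + 2 * (1 / (k + 1) + 1 / (l + 1)) / ε := fun k l ε hε =>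
    (hu k).integral_abs_sub_le hp hB (hu l) ((hν k).trans (hν l).symm) hε
  have hcauchy : CauchySeq fun k => (hu k).integrable.toL1 (u k) := by
    rw [Metric.cauchySeq_iff]
    intro η hη
    -- First ε makes the variation term at most η/2, then a large index makes the Wasserstein term,
    -- divided by this fixed ε, less than η/2.
    set ε := η / (4 * (B + 1)) with hε
    have hε0 : 0 < ε := by positivity
    obtain ⟨N, hN⟩ := exists_nat_one_div_lt (show 0 < η * ε / 8 by positivity)
    refine ⟨N, fun k hk l hl => ?_⟩
    rw [hdist]
    refine (hest k l ε hε0).trans_lt ?_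
    have b1 : 2 * B * ε ≤ η / 2 := by
      rw [hε]
      have : B / (B + 1) ≤ 1 := (div_le_one (by positivity)).2 (by linarith)
      calc 2 * B * (η / (4 * (B + 1))) = η / 2 * (B / (B + 1)) := by field_simp; ring
        _ ≤ η / 2 * 1 := by gcongr
        _ = η / 2 := mul_one _
    have c : ∀ j ≥ N, (1 : ℝ) / (j + 1) < η * ε / 8 := fun j hj =>
      (one_div_le_one_div_of_le (by positivity) (by gcongr)).trans_lt hN
    have b2 : 2 * ((1 : ℝ) / (k + 1) + 1 / (l + 1)) / ε < η / 2 := by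
      rw [div_lt_iff₀ hε0]
      linarith [c k hk, c l hl]
    linarith
  obtain ⟨F, hF⟩ := cauchySeq_tendsto_of_complete hcauchy
  set ρ : K → ℝ := ⇑F with hρ
  have hρm : Measurable ρ := (Lp.stronglyMeasurable F).measurable
  have hρi : Integrable ρ := L1.integrable_coeFn F
  have hdF : ∀ k, dist ((hu k).integrable.toL1 (u k)) F = ∫ x, |u k x - ρ x| := fun k => by
    conv_lhs => rw [← Integrable.toL1_coeFn F hρi]
    rw [dist_eq_norm, ← Integrable.toL1_sub, Integrable.norm_toL1_eq_lintegral_norm,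
      ← integral_eq_lintegral_of_nonneg_ae (Eventually.of_forall fun x => norm_nonneg _)
        ((hu k).integrable.sub hρi).norm.aestronglyMeasurable]
    rfl
  have hlim : Tendsto (fun k => ∫ x, |u k x - ρ x|) atTop (𝓝 0) := by
    simpa only [hdF] using tendsto_iff_dist_tendsto_zero.1 hF
  have hsub : ∀ k, Integrable fun x => |u k x - ρ x| := fun k => ((hu k).integrable.sub hρi).abs
  have hρ0 : 0 ≤ᵐ[volume] ρ := by
    have h0 : ∫ x, max (-ρ x) 0 ≤ 0 := by
      refine ge_of_tendsto' hlim fun k => ?_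
      refine integral_mono_of_nonneg (Eventually.of_forall fun x => le_max_right _ _) (hsub k)
        (Eventually.of_forall fun x => ?_)
      refine max_le ?_ (abs_nonneg _)
      have := (hu k).nonneg x
      linarith [le_abs_self (u k x - ρ x)]
    have h1 : 0 ≤ ∫ x, max (-ρ x) 0 := integral_nonneg fun x => le_max_right _ _
    have h2 := (integral_eq_zero_iff_of_nonneg (fun x => le_max_right _ _)
      hρi.neg.pos_part).1 (le_antisymm h0 h1)
    filter_upwards [h2] with x hx
    have : max (-ρ x) 0 = 0 := hx
    have := le_max_left (-ρ x) 0
    simp only [Pi.zero_apply]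
    linarith
  have hμ : μ = volume.withDensity fun x => ENNReal.ofReal (ρ x) := by
    have hfin : IsFiniteMeasure (volume.withDensity fun x => ENNReal.ofReal (ρ x)) :=
      isFiniteMeasure_withDensity_ofReal hρi.2
    -- The densities converge to ρ in L¹ and their measures to μ in the Wasserstein distance;
    -- testing with bounded Lipschitz functions identifies the two limits.
    refine WClose.eq_of_forall fun r hr ψ ⟨C, hC⟩ hl => ?_
    have hψ : Continuous ψ := continuous_of_abs_sub_le (L := 1) (by simpa using hl)
    have hC0 : 0 ≤ C := (abs_nonneg _).trans (hC 0)
    rw [integral_withDensity_ofReal hρm hρ0]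
    have hl1 : Tendsto (fun k : ℕ => (1 : ℝ) / (k + 1) + C * ∫ x, |u k x - ρ x|) atTop (𝓝 (0 + C * 0)) :=
      tendsto_one_div_add_atTop_nhds_zero_nat.add (hlim.const_mul C)
    rw [mul_zero, add_zero] at hl1
    refine le_trans (ge_of_tendsto' hl1 fun k => ?_) hr.le
    have a1 := (hν k).symm ψ ⟨C, hC⟩ hl
    rw [(hu k).eq_withDensity, integral_withDensity_ofReal (hu k).measurable
      (Eventually.of_forall (hu k).nonneg)] at a1
    have a2 : |(∫ x, u k x * ψ x) - ∫ x, ρ x * ψ x| ≤ C * ∫ x, |u k x - ρ x| := by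
      rw [← integral_sub ((hu k).integrable.mul_bdd (c := C) hψ.aestronglyMeasurable
        (Eventually.of_forall hC)) (hρi.mul_bdd (c := C) hψ.aestronglyMeasurable
        (Eventually.of_forall hC)), ← integral_const_mul, ← Real.norm_eq_abs]
      refine norm_integral_le_of_norm_le ((hsub k).const_mul C) (Eventually.of_forall fun x => ?_)
      rw [← sub_mul, norm_mul, mul_comm]
      exact mul_le_mul_of_nonneg_right (hC x) (norm_nonneg _)
    exact (abs_sub_le _ _ _).trans (add_le_add a1 a2)
  have hrn : μ.rnDeriv volume =ᵐ[volume] fun x => ENNReal.ofReal (ρ x) := by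
    rw [hμ]; exact Measure.rnDeriv_withDensity _ hρm.ennreal_ofReal
  refine ⟨hμ ▸ withDensity_absolutelyContinuous _ _, fun ν' v r ε hε hv hr => ?_⟩
  have e : eLpNorm (fun x => v x - (μ.rnDeriv volume x).toReal) 1 volume
      = eLpNorm (fun x => v x - ρ x) 1 volume := by
    refine eLpNorm_congr_ae ?_
    filter_upwards [hrn, hρ0] with x hx h0
    rw [hx, ENNReal.toReal_ofReal h0]
  have hvi : Integrable fun x => v x - ρ x := hv.integrable.sub hρi
  rw [e, eLpNorm_one_eq_lintegral_enorm, ← ofReal_integral_norm_eq_lintegral_enorm hvi]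
  refine ENNReal.ofReal_le_ofReal ?_
  -- The estimate for v against u k has the same ε for all k; letting k → ∞ replaces u k by ρ.
  have hl1 : Tendsto (fun k : ℕ => 2 * B * ε + 2 * (r + (1 : ℝ) / (k + 1)) / ε
      + ∫ x, |u k x - ρ x|) atTop (𝓝 (2 * B * ε + 2 * (r + 0) / ε + 0)) :=
    ((((tendsto_one_div_add_atTop_nhds_zero_nat.const_add r).const_mul 2).div_const ε).const_add
      _).add hlim
  rw [add_zero, add_zero] at hl1
  refine ge_of_tendsto' hl1 fun k => ?_
  have a1 := hv.integral_abs_sub_le hp hB (hu k) (hr.trans (hν k).symm) hε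
  refine le_trans ?_ (add_le_add_left a1 _)
  have i1 : Integrable fun x => |v x - u k x| := (hv.integrable.sub (hu k).integrable).abs
  rw [← integral_add i1 (hsub k)]
  exact integral_mono hvi.norm (i1.add (hsub k)) fun x => abs_sub_le _ _ _

end L1

/-! ### Convergence of the scheme and absolute continuity -/

section Convergence

variable {K : Type} [NormedAddCommGroup K] [MeasureSpace K] [BorelSpace K] {p : ℝ → K}

/-- Convex combinations of densities. -/
lemma HasBVDensity.convexComb {B : ℝ} {ν ν' : Measure K} {u u' : K → ℝ}
    (h : HasBVDensity p B ν u) (h' : HasBVDensity p B ν' u') {a b : ℝ} (ha : 0 ≤ a) (hb : 0 ≤ b)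
    (hab : a + b = 1) :
    ∃ ν'', HasBVDensity p B ν'' (fun x => a * u x + b * u' x) ∧
      ∀ μ r, WClose ν μ r → WClose ν' μ r → WClose ν'' μ r := by
  have hm : Measurable fun x => a * u x + b * u' x :=
    (h.measurable.const_mul a).add (h'.measurable.const_mul b)
  have h0 : ∀ x, 0 ≤ a * u x + b * u' x := fun x =>
    add_nonneg (mul_nonneg ha (h.nonneg x)) (mul_nonneg hb (h'.nonneg x))
  refine ⟨_, ⟨hm, h0, (h.integrable.const_mul a).add (h'.integrable.const_mul b), fun s hs => ?_,
    rfl⟩, fun μ r hr hr' ψ ⟨C, hC⟩ hl => ?_⟩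
  · have hd : ∀ v : K → ℝ, Measurable v → Measurable fun x => ‖v (x + p s) - v x‖ₑ := fun v hv =>
      ((hv.comp (measurable_add_const _)).sub hv).enorm
    calc ∫⁻ x, ‖(a * u (x + p s) + b * u' (x + p s)) - (a * u x + b * u' x)‖ₑ
        ≤ ∫⁻ x, (ENNReal.ofReal a * ‖u (x + p s) - u x‖ₑ
            + ENNReal.ofReal b * ‖u' (x + p s) - u' x‖ₑ) := by
          refine lintegral_mono fun x => ?_
          have : (a * u (x + p s) + b * u' (x + p s)) - (a * u x + b * u' x)
              = a * (u (x + p s) - u x) + b * (u' (x + p s) - u' x) := by ring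
          rw [this]
          refine (enorm_add_le _ _).trans (le_of_eq ?_)
          rw [enorm_mul, enorm_mul, Real.enorm_of_nonneg ha, Real.enorm_of_nonneg hb]
      _ = ENNReal.ofReal a * (∫⁻ x, ‖u (x + p s) - u x‖ₑ)
            + ENNReal.ofReal b * ∫⁻ x, ‖u' (x + p s) - u' x‖ₑ := by
          rw [lintegral_add_left ((hd u h.measurable).const_mul _),
            lintegral_const_mul _ (hd u h.measurable), lintegral_const_mul _ (hd u' h'.measurable)]
      _ ≤ ENNReal.ofReal a * ENNReal.ofReal (B * s) + ENNReal.ofReal b * ENNReal.ofReal (B * s) :=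
          add_le_add (mul_le_mul_right (h.transBound s hs) _)
            (mul_le_mul_right (h'.transBound s hs) _)
      _ = ENNReal.ofReal (B * s) := by
          rw [← add_mul, ← ENNReal.ofReal_add ha hb, hab, ENNReal.ofReal_one, one_mul]
  · have hψ : Continuous ψ := continuous_of_abs_sub_le (L := 1) (by simpa using hl)
    have b1 := hr ψ ⟨C, hC⟩ hl
    have b2 := hr' ψ ⟨C, hC⟩ hl
    rw [h.eq_withDensity, integral_withDensity_ofReal h.measurable
      (Eventually.of_forall h.nonneg)] at b1
    rw [h'.eq_withDensity, integral_withDensity_ofReal h'.measurable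
      (Eventually.of_forall h'.nonneg)] at b2
    have i1 : Integrable fun x => u x * ψ x := h.integrable.mul_bdd (c := C)
      hψ.aestronglyMeasurable (Eventually.of_forall hC)
    have i2 : Integrable fun x => u' x * ψ x := h'.integrable.mul_bdd (c := C)
      hψ.aestronglyMeasurable (Eventually.of_forall hC)
    rw [integral_withDensity_ofReal hm (Eventually.of_forall h0)]
    have e : ∫ x, (a * u x + b * u' x) * ψ x
        = a * (∫ x, u x * ψ x) + b * ∫ x, u' x * ψ x := by
      rw [← integral_const_mul, ← integral_const_mul,
        ← integral_add (i1.const_mul a) (i2.const_mul b)]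
      congr 1 with x
      ring
    rw [e]
    set I := ∫ x, ψ x ∂μ
    rw [abs_le] at b1 b2 ⊢
    have hb' : b = 1 - a := by linarith
    have e2 : a * (∫ x, u x * ψ x) + b * (∫ x, u' x * ψ x) - I
        = a * ((∫ x, u x * ψ x) - I) + b * ((∫ x, u' x * ψ x) - I) := by rw [hb']; ring
    have e3 : r = a * r + b * r := by rw [hb']; ring
    rw [e2]
    constructor
    · have := mul_le_mul_of_nonneg_left b1.1 ha
      have := mul_le_mul_of_nonneg_left b2.1 hb
      linarith
    · have := mul_le_mul_of_nonneg_left b1.2 ha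
      have := mul_le_mul_of_nonneg_left b2.2 hb
      linarith

variable [(volume : Measure K).IsAddLeftInvariant]

lemma Mesh.IsUniform.hasBVDensity_stepFun {ι : Type} [AddGroupWithOne ι] [Countable ι]
    {M : Mesh K ι} {o : ι → ℝ} (hM : M.IsUniform p o) (hp : IsLineCover p) {m : ι → ℝ}
    (hm : M.IsProb m) {B : ℝ} (hB : ∑' i, |m (i + 1) - m i| ≤ B) :
    HasBVDensity p B (M.realize m .cells) (M.stepFun m) where
  measurable := hM.measurable_stepFun m
  nonneg := hM.stepFun_nonneg hm.nonneg
  integrable := hM.integrable_stepFun (hM.summable_of_isProb hm)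
  transBound := hM.transBound_stepFun hp
    ((hasSum_comp_add_one (hM.summable_of_isProb hm).hasSum).summable.sub
      (hM.summable_of_isProb hm)).abs hB
  eq_withDensity := rfl

/-- The bound on the variation of the approximate solutions up to time `T`. -/
noncomputable def variationBound (C₂ C₄ B T : ℝ) : ℝ :=
  Real.exp (2 * C₂ * (T + 1)) * (B + C₄ * (T + 1))

variable {V : Measure K → K → ℝ} {C₁ C₂ C₃ C₄ : ℝ} {μ₀ : ProbabilityMeasure K} {ρ₀ : K → ℝ}
  {B : ℝ} {μ : ℝ → ProbabilityMeasure K}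

lemma variationBound_nonneg (hV : IsVelocity p V C₁ C₂ C₃ C₄) (hB : 0 ≤ B) {T : ℝ} (hT : 0 ≤ T) :
    0 ≤ variationBound C₂ C₄ B T := by
  have := hV.pos₄
  rw [variationBound]
  positivity

/-- Approximate solutions on fine meshes are close to the solution in the Wasserstein distance, and
have uniformly bounded variation. -/
theorem exists_hasBVDensity_approxSolution (hV : IsVelocity p V C₁ C₂ C₃ C₄) (hp : IsLineCover p)
    (hcut : HasCutoffs p) (hμ : IsMeasureValuedSolution p V μ₀ μ)
    (hρ : IsInitialDensity p μ₀ ρ₀ B) {T lam η : ℝ} (hlam : 0 < lam) (hη : 0 < η) :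
    ∃ δ > 0, ∀ {ι : Type} [AddGroupWithOne ι] [Countable ι] (M : Mesh K ι) (o : ι → ℝ),
      M.IsUniform p o → M.width < δ → ∀ τ, lam ≤ τ / M.width → τ / M.width ≤ C₁⁻¹ →
      ∀ r, ∀ t ∈ Icc 0 T, ∃ ν, HasBVDensity p (variationBound C₂ C₄ B T) ν
        (approxSolution V r M τ ρ₀ t) ∧ WClose ν (μ t : Measure K) η := by
  have h1 := hV.pos₁; have h2 := hV.pos₂; have h3 := hV.pos₃; have h4 := hV.pos₄
  have hB := hρ.nonneg
  obtain ⟨κ, hκ, H⟩ := exists_wClose_of_eulerConsistent hV hp (T + 1) (half_pos hη)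
  set S := 1 + C₁ + C₂ + C₃ + 1 / lam with hS
  have hlam' : 0 < 1 / lam := by positivity
  have hS0 : 0 < S := by positivity
  -- With width h, h < C₁ forces τ ≤ 1, S·h ≤ κ covers the hypotheses of the stability theorem, and
  -- h < η/4 pays twice: for passing from atoms to cells and for moving from n τ to t.
  refine ⟨min (min C₁ (κ / S)) (η / 4), by positivity, ?_⟩
  intro ι _ _ M o hM hδ τ hlo hhi r t ht
  have hw := hM.width_pos
  set h := M.width with hh
  have d1 : h < C₁ := hδ.trans_le ((min_le_left _ _).trans (min_le_left _ _))
  have d2 : S * h ≤ κ := by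
    have := hδ.trans_le ((min_le_left _ _).trans (min_le_right _ _))
    rw [lt_div_iff₀ hS0] at this
    linarith
  have d3 : h < η / 4 := hδ.trans_le (min_le_right _ _)
  have hτ : 0 < τ := by
    rw [le_div_iff₀ hw] at hlo
    exact lt_of_lt_of_le (by positivity) hlo
  have hτh : C₁ * τ ≤ h := by
    rw [div_le_iff₀ hw] at hhi
    calc C₁ * τ ≤ C₁ * (C₁⁻¹ * h) := by gcongr
      _ = h := by field_simp
  have hτ1 : τ ≤ 1 := by
    by_contra! hc
    nlinarith
  have hSh : ∀ c, c ≤ S → c * h ≤ κ := fun c hc =>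
    (mul_le_mul_of_nonneg_right hc hw.le).trans d2
  have hprob : ∀ n, M.IsProb (laxFriedrichs V r M τ ρ₀ n) := fun n =>
    hM.isProb_laxFriedrichs hV hρ hτ.le hhi n
  have hclose : ∀ n : ℕ, n * τ ≤ T + 1 → |n * τ - t| ≤ τ →
      WClose (M.realize (laxFriedrichs V r M τ ρ₀ n) .cells) (μ t : Measure K) η := by
    intro n hn hnt
    have c1 := H τ hτ hτ1 (by
        calc τ * C₁ ^ 2 = C₁ * (C₁ * τ) := by ring
          _ ≤ C₁ * h := by gcongr
          _ ≤ κ := hSh _ (by rw [hS]; linarith))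
      (fun n => M.realize (laxFriedrichs V r M τ ρ₀ n) .atoms)
      (fun n => (μ (n * τ) : Measure K))
      (fun n => hM.isProbabilityMeasure_realize (hprob n) _) (fun n => inferInstance)
      (by
        intro n ψ L N hN hψ
        refine (hM.eulerConsistent_laxFriedrichs hV hp hρ hlam hlo hhi n ψ L N hN hψ).trans ?_
        have := hψ.nonneg_left
        have := hSh (1 / lam + C₃) (by rw [hS]; linarith)
        gcongr)
      (hμ.eulerConsistent hV hp hcut hτ.le (by
        calc C₁ * (C₁ + C₂ + C₃) * τ = (C₁ + C₂ + C₃) * (C₁ * τ) := by ring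
          _ ≤ (C₁ + C₂ + C₃) * h := by gcongr
          _ ≤ κ := hSh _ (by rw [hS]; linarith)))
      (by
        have := (hM.wClose_initial (V := V) (r := r) (τ := τ) hp hρ).mono
          (by linarith [hSh 1 (by rw [hS]; linarith)] : M.width ≤ κ)
        simpa [hμ.initial_eq hV hp hcut] using this) n hn
    have c2 := hM.wClose_atoms_cells hp (hprob n)
    have c3 : WClose (μ (n * τ) : Measure K) (μ t : Measure K) h := by
      rcases le_total (n * τ) t with hle | hle
      · refine (hμ.wClose hV hp hcut (by positivity) hle).symm.mono (le_trans ?_ hτh)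
        gcongr
        linarith [neg_le_abs (n * τ - t)]
      · refine (hμ.wClose hV hp hcut ht.1 hle).mono (le_trans ?_ hτh)
        gcongr
        exact (le_abs_self _).trans hnt
    exact ((c2.symm.trans c1).trans c3).mono (by linarith)
  set n := ⌊t / τ⌋₊ with hn
  have n1 : n * τ ≤ t := by
    rw [← le_div_iff₀ hτ]; exact Nat.floor_le (div_nonneg ht.1 hτ.le)
  have n2 : t < (n + 1) * τ := by
    rw [← div_lt_iff₀ hτ]; exact Nat.lt_floor_add_one _
  have hbv : ∀ k : ℕ, k * τ ≤ T + 1 → HasBVDensity p (variationBound C₂ C₄ B T)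
      (M.realize (laxFriedrichs V r M τ ρ₀ k) .cells)
      (M.stepFun (laxFriedrichs V r M τ ρ₀ k)) := fun k hk =>
    hM.hasBVDensity_stepFun hp (hprob k)
      ((hM.tv_laxFriedrichs hV hp hρ hτ.le hhi k).trans (by rw [variationBound]; gcongr))
  have k0 : (n : ℝ) * τ ≤ T + 1 := by linarith [ht.2]
  -- The interpolation at t ≤ T uses the node (n + 1)τ, which may exceed T by at most τ ≤ 1; hence T
  -- + 1 in the bounds.
  have k1 : ((n + 1 : ℕ) : ℝ) * τ ≤ T + 1 := by push_cast; linarith [ht.2]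
  obtain ⟨ν, hν, hc⟩ := (hbv n k0).convexComb (hbv (n + 1) k1)
    (a := ((n + 1) * τ - t) / τ) (b := (t - n * τ) / τ)
    (div_nonneg (by linarith) hτ.le) (div_nonneg (by linarith) hτ.le)
    (by field_simp; ring)
  refine ⟨ν, hν, hc _ _ (hclose n k0 ?_) (hclose (n + 1) k1 ?_)⟩
  · rw [abs_le]; constructor <;> linarith
  · push_cast; rw [abs_le]; constructor <;> linarith

/-- There are uniform meshes of arbitrarily small width. -/
def HasFineMeshes (p : ℝ → K) : Prop :=
  ∀ δ > 0, ∃ (ι : Type) (_ : AddGroupWithOne ι) (_ : Countable ι) (M : Mesh K ι) (o : ι → ℝ),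
    M.IsUniform p o ∧ M.width < δ

/-- Absolute continuity of the solution and convergence of the approximate solutions. -/
theorem absolutelyContinuous_and_convergence [SigmaFinite (volume : Measure K)]
    (hV : IsVelocity p V C₁ C₂ C₃ C₄) (hp : IsLineCover p)
    (hcut : HasCutoffs p) (hmesh : HasFineMeshes p) (hμ : IsMeasureValuedSolution p V μ₀ μ)
    (hρ : IsInitialDensity p μ₀ ρ₀ B) :
    (∀ t, 0 ≤ t → (μ t : Measure K) ≪ volume) ∧
    ∀ T lam ε : ℝ, 0 < T → 0 < lam → 0 < ε →
    ∃ δ > 0, ∀ {ι : Type} [AddGroupWithOne ι] [Countable ι] (M : Mesh K ι) (o : ι → ℝ),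
      M.IsUniform p o → M.width < δ → ∀ τ, lam ≤ τ / M.width → τ / M.width ≤ C₁⁻¹ →
      ∀ r, supL1Dist T (approxSolution V r M τ ρ₀) μ ≤ ENNReal.ofReal ε := by
  have h1 := hV.pos₁
  have key : ∀ T : ℝ, 0 ≤ T → ∀ t ∈ Icc 0 T, _ := fun T hT t ht =>
    absolutelyContinuous_and_eLpNorm_le hp (variationBound_nonneg hV hρ.nonneg hT)
      (μ := (μ t : Measure K)) fun η hη => by
        obtain ⟨δ, hδ, H⟩ := exists_hasBVDensity_approxSolution hV hp hcut hμ hρ (T := T)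
          (inv_pos.2 h1) hη
        obtain ⟨ι, _, _, M, o, hM, hMδ⟩ := hmesh δ hδ
        have hw := hM.width_pos
        -- For absolute continuity any approximating family will do: the largest admissible step and
        -- the atomic realization are taken.
        have e : C₁⁻¹ * M.width / M.width = C₁⁻¹ := by field_simp
        obtain ⟨ν, hν, hc⟩ := H M o hM hMδ (C₁⁻¹ * M.width) e.ge e.le .atoms t ht
        exact ⟨ν, _, hν, hc⟩
  refine ⟨fun t ht => (key t ht t ⟨ht, le_rfl⟩).1, fun T lam ε hT hlam hε => ?_⟩
  set b := variationBound C₂ C₄ B T with hb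
  have hb0 : 0 ≤ b := variationBound_nonneg hV hρ.nonneg hT.le
  set ε' := ε / (4 * (b + 1)) with hε'
  have hε0 : 0 < ε' := by positivity
  obtain ⟨δ, hδ, H⟩ := exists_hasBVDensity_approxSolution hV hp hcut hμ hρ hlam (T := T)
    (η := ε * ε' / 4) (by positivity)
  refine ⟨δ, hδ, fun M o hM hMδ τ hlo hhi r => iSup₂_le fun t ht => ?_⟩
  obtain ⟨ν, hν, hc⟩ := H M o hM hMδ τ hlo hhi r t ht
  refine ((key T hT.le t ht).2 ν _ _ ε' hε0 hν hc).trans (ENNReal.ofReal_le_ofReal ?_)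
  have e1 : 2 * (ε * ε' / 4) / ε' = ε / 2 := by field_simp; ring
  have e2 : 2 * b * ε' ≤ ε / 2 := by
    have : b / (b + 1) ≤ 1 := (div_le_one (by positivity)).2 (by linarith)
    calc 2 * b * (ε / (4 * (b + 1))) = ε / 2 * (b / (b + 1)) := by field_simp; ring
      _ ≤ ε / 2 * 1 := by gcongr
      _ = ε / 2 := mul_one _
  linarith

end Convergence

/-! ### Translation estimates for functions of bounded variation -/

section Variation

/-- Translation estimate on a bounded interval. -/
lemma setLIntegral_translate_le (G : ℝ → ℝ) (a : ℝ) {s : ℝ} (hs : 0 ≤ s) (N : ℕ) :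
    ∫⁻ x in Ioc a (a + N * s), ‖G (x + s) - G x‖ₑ ≤ ENNReal.ofReal s *
      (eVariationOn G (Icc a (a + N * s)) + eVariationOn G (Icc (a + s) (a + N * s + s))) := by
  have hadd : ∀ {b c d : ℝ}, b ≤ c → c ≤ d →
      eVariationOn G (Icc b c) + eVariationOn G (Icc c d) = eVariationOn G (Icc b d) :=
    fun h1 h2 => by simpa using eVariationOn.Icc_add_Icc G (s := univ) h1 h2 (mem_univ _)
  induction N with
  | zero => simp
  | succ N ih =>
    set b := a + N * s with hb
    have hab : a ≤ b := le_add_of_nonneg_right (by positivity)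
    have e : a + (N + 1 : ℕ) * s = b + s := by rw [hb]; push_cast; ring
    -- On a strip of length s the increment is at most the variation over the strip and its right
    -- neighbour. Summed over strips, these variations join into the two shifted intervals of the
    -- statement.
    have hlast : ∫⁻ x in Ioc b (b + s), ‖G (x + s) - G x‖ₑ ≤
        ENNReal.ofReal s * (eVariationOn G (Icc b (b + s)) +
          eVariationOn G (Icc (b + s) (b + s + s))) := by
      rw [hadd (by linarith) (by linarith)]
      calc ∫⁻ x in Ioc b (b + s), ‖G (x + s) - G x‖ₑ
          ≤ ∫⁻ _ in Ioc b (b + s), eVariationOn G (Icc b (b + s + s)) := by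
            refine setLIntegral_mono' measurableSet_Ioc fun x hx => ?_
            rw [← edist_eq_enorm_sub]
            exact eVariationOn.edist_le _ ⟨by linarith [hx.1], by linarith [hx.2]⟩
              ⟨hx.1.le, by linarith [hx.2]⟩
        _ = _ := by
            rw [setLIntegral_const, Real.volume_Ioc, add_sub_cancel_left, mul_comm]
    rw [e, ← Ioc_union_Ioc_eq_Ioc hab (le_add_of_nonneg_right hs)]
    refine (lintegral_union_le _ _ _).trans ((add_le_add ih hlast).trans (le_of_eq ?_))
    rw [← mul_add, ← hadd hab (le_add_of_nonneg_right hs),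
      ← hadd (show a + s ≤ b + s by linarith) (le_add_of_nonneg_right hs)]
    ring

lemma setLIntegral_translate_le' (G : ℝ → ℝ) (a : ℝ) {s : ℝ} (hs : 0 ≤ s) (N : ℕ) :
    ∫⁻ x in Ioc a (a + N * s), ‖G (x + s) - G x‖ₑ ≤ ENNReal.ofReal s *
      (2 * eVariationOn G (Icc a (a + N * s + s))) := by
  refine (setLIntegral_translate_le G a hs N).trans ?_
  rw [two_mul]
  gcongr
  · exact eVariationOn.mono _ (Icc_subset_Icc_right (by linarith))
  · exact eVariationOn.mono _ (Icc_subset_Icc_left (by linarith))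

lemma TransBound.congr_ae {K : Type} [NormedAddCommGroup K] [MeasureSpace K] [BorelSpace K]
    [(volume : Measure K).IsAddLeftInvariant] {p : ℝ → K} {B : ℝ} {u v : K → ℝ}
    (h : TransBound p B u) (huv : u =ᵐ[volume] v) : TransBound p B v := fun s hs => by
  have h1 : (fun x => u (x + p s)) =ᵐ[volume] fun x => v (x + p s) :=
    (measurePreserving_add_right (volume : Measure K) (p s)).quasiMeasurePreserving.ae_eq_comp huv
  refine (lintegral_congr_ae ?_).trans_le (h s hs)
  filter_upwards [h1, huv] with x hx hx'
  rw [hx, hx']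

end Variation

/-! ### The line -/

section Line

lemma isLineCover_id : IsLineCover (id : ℝ → ℝ) :=
  ⟨fun _ _ => rfl, fun _ => le_rfl, fun x => ⟨x, rfl, rfl⟩⟩

/-- One bump is dilated by c(n+1), where c ≥ 1 bounds its first two derivatives; each
differentiation gains the inverse of the dilation. -/
lemma hasCutoffs_id : HasCutoffs (id : ℝ → ℝ) := by
  let f : ContDiffBump (0 : ℝ) := ⟨1, 2, one_pos, one_lt_two⟩
  have hf : ContDiff ℝ ∞ f := f.contDiff
  have hf' : ContDiff ℝ ∞ (deriv f) := (contDiff_infty_iff_deriv.1 hf).2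
  obtain ⟨c₁, hc₁⟩ := (hf'.continuous).bounded_above_of_compact_support f.hasCompactSupport.deriv
  obtain ⟨c₂, hc₂⟩ := (hf'.continuous_deriv (by simp)).bounded_above_of_compact_support
    f.hasCompactSupport.deriv.deriv
  have hlip : ∀ x y, |deriv f x - deriv f y| ≤ c₂ * |x - y| := fun x y =>
    Convex.norm_image_sub_le_of_norm_deriv_le (fun x _ => hf'.differentiable (by simp) x)
      (fun x _ => hc₂ x) convex_univ (mem_univ y) (mem_univ x)
  set c := max 1 (max c₁ c₂) with hc
  have c0 : 1 ≤ c := le_max_left _ _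
  have cc₁ : c₁ ≤ c := (le_max_left _ _).trans (le_max_right _ _)
  have cc₂ : c₂ ≤ c := (le_max_right _ _).trans (le_max_right _ _)
  have hd : ∀ (n : ℕ) (x : ℝ), dx id (fun y => f (y * (c * (n + 1))⁻¹)) x
      = deriv f (x * (c * (n + 1))⁻¹) * (c * (n + 1))⁻¹ := fun n x => by
    have h1 : HasDerivAt f (deriv f ((x + id 0) * (c * (n + 1))⁻¹)) ((x + id 0) * (c * (n + 1))⁻¹) :=
      (hf.differentiable (by simp) _).hasDerivAt
    have h2 : HasDerivAt (fun h : ℝ => (x + id h) * (c * (n + 1))⁻¹) (1 * (c * (n + 1))⁻¹) 0 :=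
      ((hasDerivAt_id (0 : ℝ)).const_add x).mul_const _
    have := (h1.comp 0 h2).deriv
    simpa [dx, Function.comp_def] using this
  refine ⟨fun n x => f (x * (c * (n + 1))⁻¹), fun n => ⟨?_, ?_, fun x => ?_, fun x => ?_,
    fun x y => ?_⟩, fun x => ?_⟩
  · have hne : (c * (n + 1))⁻¹ ≠ 0 := by positivity
    exact f.hasCompactSupport.comp_homeomorph (Homeomorph.mulRight₀ _ hne)
  · exact hf.comp (contDiff_id.mul contDiff_const)
  · rw [abs_of_nonneg f.nonneg]; exact f.le_one
  · rw [hd, abs_mul, abs_of_pos (by positivity : 0 < (c * (n + 1))⁻¹)]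
    calc _ ≤ c * (c * (n + 1))⁻¹ := by
          gcongr; exact (hc₁ _).trans cc₁
      _ = 1 / (n + 1) := by field_simp
  · rw [hd, hd, ← sub_mul, abs_mul, abs_of_pos (by positivity : 0 < (c * (n + 1))⁻¹)]
    have hle : (c * (n + 1 : ℝ))⁻¹ ≤ 1 := inv_le_one_of_one_le₀ (by
      have : (0 : ℝ) ≤ n := n.cast_nonneg
      nlinarith)
    calc _ ≤ (c₂ * |x * (c * (n + 1))⁻¹ - y * (c * (n + 1))⁻¹|) * (c * (n + 1))⁻¹ := by
          gcongr; exact hlip _ _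
      _ = c₂ * (|x - y| * (c * (n + 1))⁻¹) * (c * (n + 1))⁻¹ := by
          rw [← sub_mul, abs_mul, abs_of_pos (by positivity : 0 < (c * (n + 1))⁻¹)]
      _ ≤ c * (|x - y| * 1) * (c * (n + 1))⁻¹ := by gcongr
      _ = 1 / (n + 1) * dist x y := by rw [Real.dist_eq]; field_simp
  · refine tendsto_const_nhds.congr' ?_
    obtain ⟨m, hm⟩ := exists_nat_ge |x|
    filter_upwards [eventually_ge_atTop m] with n hn
    refine (f.one_of_mem_closedBall ?_).symm
    have : (m : ℝ) ≤ n := by exact_mod_cast hn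
    rw [mem_closedBall_zero_iff, Real.norm_eq_abs, abs_mul,
      abs_of_pos (by positivity : 0 < (c * (n + 1))⁻¹), ← div_eq_mul_inv]
    refine (div_le_one (by positivity)).2 ?_
    nlinarith [abs_nonneg x]

lemma isUniform_lineMesh (a : ℝ) {h : ℝ} (hh : 0 < h) :
    (lineMesh a h).IsUniform id fun i : ℤ => a + i * h where
  width_pos := hh
  cell_eq i := by
    simp only [lineMesh, image_id]
    congr 1; ring
  center_eq i := by simp only [lineMesh, id]; ring
  origin_succ i := by simp only [lineMesh, id]; push_cast; ring
  disjoint := by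
    simpa [lineMesh] using Set.pairwise_disjoint_Ico_add_zsmul a h
  cover := by
    simpa [lineMesh] using iUnion_Ico_add_zsmul hh a
  measurableSet_arc α s _ _ := by rw [image_id]; exact measurableSet_Ico
  volume_arc α s _ _ := by rw [image_id, Real.volume_Ico, add_sub_cancel_left]

lemma hasFineMeshes_id : HasFineMeshes (id : ℝ → ℝ) := fun δ hδ =>
  ⟨ℤ, inferInstance, inferInstance, lineMesh 0 (δ / 2), _,
    isUniform_lineMesh 0 (half_pos hδ), half_lt_self hδ⟩

/-- The line is exhausted by windows of 2n strips of length s. The factor 2 counts every strip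
twice, which is harmless. -/
lemma transBound_line {g : ℝ → ℝ} (hg : BoundedVariationOn g univ) :
    TransBound id (2 * (eVariationOn g univ).toReal) g := fun s hs => by
  rcases hs.eq_or_lt with rfl | hs0
  · simp
  have hU : ⋃ n : ℕ, Ioc (-(n * s)) (-(n * s) + (2 * n : ℕ) * s) = univ := by
    refine eq_univ_of_forall fun x => mem_iUnion.2 ?_
    obtain ⟨n, hn⟩ := exists_nat_gt (|x| / s)
    rw [div_lt_iff₀ hs0, abs_lt] at hn
    refine ⟨n, hn.1, ?_⟩
    push_cast
    linarith [hn.2]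
  have hmono : Monotone fun n : ℕ => Ioc (-(n * s)) (-(n * s) + (2 * n : ℕ) * s) := by
    intro m n hmn
    have : (m : ℝ) * s ≤ n * s := by gcongr
    refine Ioc_subset_Ioc (by linarith) ?_
    push_cast
    linarith
  rw [← setLIntegral_univ fun x => ‖g (x + id s) - g x‖ₑ, ← hU,
    setLIntegral_iUnion_of_directed _ hmono.directed_le, hU]
  refine iSup_le fun n => (setLIntegral_translate_le' g _ hs _).trans ?_
  rw [mul_comm, ENNReal.ofReal_mul (by positivity), ENNReal.ofReal_mul zero_le_two,
    ENNReal.ofReal_toReal hg, ENNReal.ofReal_ofNat]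
  gcongr
  exact eVariationOn.mono _ (subset_univ _)

lemma MemBVLine.exists_isInitialDensity {μ₀ : ProbabilityMeasure ℝ} {ρ₀ : ℝ → ℝ}
    (h : MemBVLine ρ₀) (hd : IsDensity μ₀ ρ₀) : ∃ B, IsInitialDensity id μ₀ ρ₀ B := by
  obtain ⟨hi, g, hg, hv⟩ := h
  exact ⟨_, hd, hi, by positivity, (transBound_line hv).congr_ae hg⟩

end Line

/-! ### The torus -/

section Torus

lemma isLineCover_torusProj : IsLineCover torusProj where
  map_add _ _ := rfl
  norm_le _ := QuotientAddGroup.norm_mk_le_norm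
  exists_lift x := by
    obtain ⟨s, rfl⟩ := QuotientAddGroup.mk_surjective x
    -- Subtracting the nearest multiple of the period gives a representative whose modulus is the
    -- norm.
    refine ⟨s - round ((2 * Real.pi)⁻¹ * s) * (2 * Real.pi), ?_, (AddCircle.norm_eq _).symm⟩
    rw [torusProj, AddCircle.coe_sub,
      AddCircle.coe_eq_zero_iff (2 * Real.pi) (x := _ * _) |>.2 ⟨_, zsmul_eq_mul _ _⟩]
    exact sub_zero _

lemma hasCutoffs_torusProj : HasCutoffs torusProj := by
  have hd : ∀ x, dx torusProj (fun _ => (1 : ℝ)) x = 0 := fun x => by simp [dx]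
  refine ⟨fun _ _ => 1, fun n => ⟨.of_compactSpace _, contDiff_const, by simp, fun x => ?_,
    fun x y => ?_⟩, fun x => tendsto_const_nhds⟩
  · rw [hd, abs_zero]; positivity
  · rw [hd, hd, sub_zero, abs_zero]; positivity

lemma torusProj_eq_iff_of_mem_Ico {a s t : ℝ} (hs : s ∈ Ico a (a + 2 * Real.pi))
    (ht : t ∈ Ico a (a + 2 * Real.pi)) : torusProj s = torusProj t ↔ s = t :=
  AddCircle.coe_eq_coe_iff_of_mem_Ico hs ht

/-- Using the fundamental domain that starts at α, the arc does not wrap, and the image becomes a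
preimage under a measurable map. -/
lemma torusProj_arc_eq {α s : ℝ} (hs : s ≤ 2 * Real.pi) :
    torusProj '' Ico α (α + s)
      = AddCircle.measurableEquivIco (2 * Real.pi) α ⁻¹' (Subtype.val ⁻¹' Ico α (α + s)) := by
  ext x
  constructor
  · rintro ⟨y, hy, rfl⟩
    have : AddCircle.measurableEquivIco (2 * Real.pi) α (torusProj y)
        = ⟨y, hy.1, hy.2.trans_le (by linarith)⟩ :=
      (AddCircle.equivIco (2 * Real.pi) α).apply_symm_apply ⟨y, hy.1, hy.2.trans_le (by linarith)⟩
    rw [mem_preimage, this]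
    exact hy
  · intro hx
    exact ⟨_, hx, (AddCircle.equivIco (2 * Real.pi) α).symm_apply_apply x⟩

lemma measurableSet_torusProj_arc {α s : ℝ} (hs : s ≤ 2 * Real.pi) :
    MeasurableSet (torusProj '' Ico α (α + s)) := by
  rw [torusProj_arc_eq hs]
  exact (AddCircle.measurableEquivIco _ α).measurable (measurable_subtype_coe measurableSet_Ico)

lemma volume_torusProj_arc {α s : ℝ} (hs : s ≤ 2 * Real.pi) :
    volume (torusProj '' Ico α (α + s)) = ENNReal.ofReal s := by
  rw [AddCircle.add_projection_respects_measure (2 * Real.pi) α (measurableSet_torusProj_arc hs)]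
  refine le_antisymm ?_ ?_
  -- The volume on the torus is computed on (α, α + 2π], whereas the arc contains α: the preimage
  -- may gain the endpoint α + 2π, a null set.
  · calc _ ≤ volume (insert (α + 2 * Real.pi) (Ico α (α + s))) := by
          refine measure_mono ?_
          rintro x ⟨⟨y, hy, hxy⟩, hx⟩
          rcases hx.2.eq_or_lt with h | h
          · exact Or.inl h
          · right
            have := (torusProj_eq_iff_of_mem_Ico (a := α) ⟨hy.1, by linarith [hy.2]⟩
              ⟨hx.1.le, h⟩).1 hxy
            rwa [← this]
      _ = ENNReal.ofReal s := by
          rw [measure_congr (insert_ae_eq_self _ _), Real.volume_Ico, add_sub_cancel_left]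
  · calc ENNReal.ofReal s = volume (Ioo α (α + s)) := by
          rw [Real.volume_Ioo, add_sub_cancel_left]
      _ ≤ _ := by
          refine measure_mono fun x hx => ⟨⟨x, ⟨hx.1.le, hx.2⟩, rfl⟩, hx.1, ?_⟩
          linarith [hx.2]

lemma isUniform_torusMesh {N : ℕ} (hN : 0 < N) (a : ℝ) :
    (torusMesh N a).IsUniform torusProj fun i => a + i.val * (2 * Real.pi / N) := by
  have : NeZero N := ⟨hN.ne'⟩
  have hN' : (0 : ℝ) < N := by exact_mod_cast hN
  set h := 2 * Real.pi / N with hh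
  have h0 : 0 < h := by positivity
  have hNh : N * h = 2 * Real.pi := by rw [hh]; field_simp
  have hle : h ≤ 2 * Real.pi := by
    rw [← hNh]
    have : (1 : ℝ) ≤ N := by exact_mod_cast hN
    nlinarith
  have hmem : ∀ (i : ZMod N) {s : ℝ}, s ∈ Ico (a + i.val * h) (a + (i.val + 1) * h) →
      s ∈ Ico a (a + 2 * Real.pi) := fun i s hs => by
    have : (i.val : ℝ) + 1 ≤ N := by exact_mod_cast i.val_lt
    have h1 := mul_le_mul_of_nonneg_right this h0.le
    have : (0 : ℝ) ≤ i.val * h := by positivity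
    exact ⟨by linarith [hs.1], by linarith [hs.2]⟩
  refine ⟨h0, fun i => ?_, fun i => ?_, fun i => ?_, fun i j hij => ?_, ?_,
    fun α s _ hs => measurableSet_torusProj_arc (hs.trans hle),
    fun α s _ hs => volume_torusProj_arc (hs.trans hle)⟩
  · simp only [torusMesh, ← hh]
    congr 2; ring
  · simp only [torusMesh, ← hh]
    congr 1; ring
  · simp only [torusMesh, ← hh]
    -- Labels are added modulo N. The quotient (i.val + 1)/N is 1 at the last cell and 0 otherwise;
    -- it counts the full turn that the projection removes.
    have e : (i + 1).val = (i.val + 1) % N := by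
      rw [ZMod.val_add, ZMod.val_one_eq_one_mod, Nat.add_mod_mod]
    have e2 : ((i.val + 1 : ℕ) : ℝ) = N * ((i.val + 1) / N : ℕ) + ((i + 1).val : ℕ) := by
      rw [e]; exact_mod_cast (Nat.div_add_mod _ _).symm
    push_cast at e2
    have e3 : a + i.val * h + h
        = a + (i + 1).val * h + ((i.val + 1) / N : ℕ) * (2 * Real.pi) := by
      rw [← hNh]
      linear_combination h * e2
    rw [e3, isLineCover_torusProj.map_add (_ + _)]
    have : torusProj (((i.val + 1) / N : ℕ) * (2 * Real.pi)) = 0 := by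
      exact (AddCircle.coe_eq_zero_iff _).2 ⟨((i.val + 1) / N : ℕ), by
        rw [zsmul_eq_mul, Int.cast_natCast]⟩
    rw [this, add_zero]
  · rw [Function.onFun, disjoint_left]
    rintro _ ⟨s, hs, rfl⟩ ⟨t, ht, hst⟩
    have hst := (torusProj_eq_iff_of_mem_Ico (hmem j ht) (hmem i hs)).1 hst
    subst hst
    refine hij (ZMod.val_injective N ?_)
    have l1 : (i.val : ℝ) < j.val + 1 := by
      have : a + i.val * h < a + (j.val + 1) * h := hs.1.trans_lt ht.2
      exact lt_of_mul_lt_mul_right (by linarith) h0.le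
    have l2 : (j.val : ℝ) < i.val + 1 := by
      have : a + j.val * h < a + (i.val + 1) * h := ht.1.trans_lt hs.2
      exact lt_of_mul_lt_mul_right (by linarith) h0.le
    norm_cast at l1 l2
    omega
  · refine eq_univ_of_forall fun x => mem_iUnion.2 ?_
    have hx : x ∈ (univ : Set Torus) := mem_univ x
    rw [← AddCircle.coe_image_Ico_eq (2 * Real.pi) a] at hx
    obtain ⟨s, ⟨hs1, hs2⟩, rfl⟩ := hx
    have q0 : 0 ≤ (s - a) / h := div_nonneg (by linarith) h0.le
    have q1 : ⌊(s - a) / h⌋₊ < N := by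
      rw [Nat.floor_lt q0, div_lt_iff₀ h0, hNh]; linarith
    refine ⟨(⌊(s - a) / h⌋₊ : ZMod N), s, ?_, rfl⟩
    rw [ZMod.val_natCast_of_lt q1]
    have f1 := Nat.floor_le q0
    have f2 := Nat.lt_floor_add_one ((s - a) / h)
    rw [le_div_iff₀ h0] at f1
    rw [div_lt_iff₀ h0] at f2
    exact ⟨by linarith, by linarith⟩

lemma hasFineMeshes_torusProj : HasFineMeshes torusProj := fun δ hδ => by
  obtain ⟨n, hn⟩ := exists_nat_gt (2 * Real.pi / δ)
  have hn0 : 0 < n := by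
    have : (0 : ℝ) < n := lt_trans (by positivity) hn
    exact_mod_cast this
  have : NeZero n := ⟨hn0.ne'⟩
  refine ⟨ZMod n, inferInstance, inferInstance, torusMesh n 0, _, isUniform_torusMesh hn0 0, ?_⟩
  change 2 * Real.pi / n < δ
  rwa [div_lt_comm₀ (by exact_mod_cast hn0) hδ]

/-- By periodicity every further period contributes the same finite variation; this makes room for
translations that leave the first period. -/
lemma eVariationOn_periods_ne_top {G : ℝ → ℝ} {c : ℝ} (hc : 0 ≤ c) (hG : Function.Periodic G c)
    (hv : BoundedVariationOn G (Icc 0 c)) (n : ℕ) : eVariationOn G (Icc 0 (n * c)) ≠ ⊤ := by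
  induction n with
  | zero => simp [eVariationOn.subsingleton]
  | succ n ih =>
    have h1 := eVariationOn.Icc_add_Icc G (s := univ) (show 0 ≤ n * c by positivity)
      (show n * c ≤ (n + 1 : ℕ) * c by push_cast; linarith) (mem_univ _)
    have h2 := eVariationOn.comp_eq_of_monotoneOn G (t := Icc 0 c) (fun x => x + n * c)
      fun x _ y _ hxy => by simpa using hxy
    have h3 : G ∘ (fun x => x + n * c) = G := funext fun x => hG.nat_mul n x
    rw [h3, image_add_const_Icc, zero_add] at h2
    simp only [univ_inter] at h1
    rw [← h1, show ((n + 1 : ℕ) : ℝ) * c = c + n * c by push_cast; ring, ← h2]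
    exact ENNReal.add_ne_top.2 ⟨ih, hv⟩

lemma MemBVTorus.exists_isInitialDensity {μ₀ : ProbabilityMeasure Torus} {ρ₀ : Torus → ℝ}
    (h : MemBVTorus ρ₀) (hd : IsDensity μ₀ ρ₀) : ∃ B, IsInitialDensity torusProj μ₀ ρ₀ B := by
  obtain ⟨hi, g, hg, hv⟩ := h
  have hπ := Real.two_pi_pos
  set G : ℝ → ℝ := fun x => g (torusProj x) with hG
  have hper : Function.Periodic G (2 * Real.pi) := fun x => by
    simp only [hG, torusProj, AddCircle.coe_add_period]
  -- Three periods suffice: the strips of length s ≤ 2π that cover one period, with one more strip,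
  -- end before 2π + 2s ≤ 6π.
  have hvar := eVariationOn_periods_ne_top hπ.le hper hv 3
  set A := eVariationOn G (Icc 0 ((3 : ℕ) * (2 * Real.pi))) with hA
  have hsmall : ∀ s, 0 ≤ s → s ≤ 2 * Real.pi →
      ∫⁻ x, ‖g (x + torusProj s) - g x‖ₑ ≤ ENNReal.ofReal (2 * A.toReal * s) := by
    intro s hs0 hs
    rcases hs0.eq_or_lt with rfl | hs0'
    · simp [isLineCover_torusProj.map_zero]
    set N := ⌈2 * Real.pi / s⌉₊ with hN
    have n1 : 2 * Real.pi ≤ N * s := by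
      rw [← div_le_iff₀ hs0']; exact Nat.le_ceil _
    have n2 : N * s + s ≤ 3 * (2 * Real.pi) := by
      have : (N : ℝ) < 2 * Real.pi / s + 1 := Nat.ceil_lt_add_one (by positivity)
      have := mul_lt_mul_of_pos_right this hs0'
      rw [add_mul, div_mul_cancel₀ _ hs0'.ne'] at this
      linarith
    rw [← AddCircle.lintegral_preimage (2 * Real.pi) 0]
    calc ∫⁻ x in Ioc 0 (0 + 2 * Real.pi), ‖g ((x : Torus) + torusProj s) - g (x : Torus)‖ₑ
        ≤ ∫⁻ x in Ioc 0 (0 + N * s), ‖G (x + s) - G x‖ₑ :=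
          lintegral_mono_set (Ioc_subset_Ioc_right (by linarith))
      _ ≤ ENNReal.ofReal s * (2 * eVariationOn G (Icc 0 (0 + N * s + s))) :=
          setLIntegral_translate_le' G 0 hs0 N
      _ ≤ ENNReal.ofReal s * (2 * A) := by
          gcongr
          refine eVariationOn.mono _ (Icc_subset_Icc_right ?_)
          push_cast
          linarith
      _ = ENNReal.ofReal (2 * A.toReal * s) := by
          rw [mul_comm, ENNReal.ofReal_mul (by positivity), ENNReal.ofReal_mul zero_le_two,
            ENNReal.ofReal_toReal hvar, ENNReal.ofReal_ofNat]
  -- Extending the estimate from short shifts to all shifts requires a measurable function, so it is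
  -- done for a measurable representative of ρ₀ and transferred back.
  obtain ⟨u, hu, hρu⟩ := hi.aestronglyMeasurable
  have hgu : g =ᵐ[volume] u := hg.trans hρu
  refine ⟨2 * A.toReal, hd, hi, by positivity, ?_⟩
  refine (transBound_of_le isLineCover_torusProj hu.measurable (by positivity) hπ
    fun s hs0 hs => ?_).congr_ae hρu.symm
  have h1 : (fun x => g (x + torusProj s)) =ᵐ[volume] fun x => u (x + torusProj s) :=
    (measurePreserving_add_right (volume : Measure Torus) (torusProj s)).quasiMeasurePreserving.ae_eq_comp hgu
  refine (lintegral_congr_ae ?_).trans_le (hsmall s hs0 hs)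
  filter_upwards [h1, hgu] with x hx hx'
  rw [hx, hx']

end Torus

end NonlocalLaw

theorem theorem2p6 (C₁ C₂ C₃ C₄ lam : ℝ)
    (hC₁ : 0 < C₁) (hC₂ : 0 < C₂) (hC₃ : 0 < C₃) (hC₄ : 0 < C₄) (hlam : 0 < lam) :
    -- the line
    (∀ (V : Measure ℝ → ℝ → ℝ) (μ₀ : ProbabilityMeasure ℝ) (ρ₀ : ℝ → ℝ),
      VelocityBounded V C₁ → VelocityLipschitzSpace V C₂ → VelocityLipschitzMeasure V C₃ →
      VelocityDerivLipschitz id V C₄ →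
      IsCompact (μ₀ : Measure ℝ).support → IsDensity μ₀ ρ₀ → MemBVLine ρ₀ →
      ∃ μ : ℝ → ProbabilityMeasure ℝ,
        IsMeasureValuedSolution id V μ₀ μ ∧
        (∀ μ', IsMeasureValuedSolution id V μ₀ μ' → EqOn μ' μ (Ici 0)) ∧
        (∀ t, 0 ≤ t → (μ t : Measure ℝ) ≪ volume) ∧
        ∀ (r : Realization) (T : ℝ), 0 < T → ∀ ε : ℝ, 0 < ε → ∃ δ : ℝ, 0 < δ ∧
          ∀ a h τ : ℝ, 0 < h → h < δ → lam ≤ τ / h → τ / h ≤ C₁⁻¹ →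
            supL1Dist T (approxSolution V r (lineMesh a h) τ ρ₀) μ ≤ ENNReal.ofReal ε) ∧
    -- the torus
    (∀ (V : Measure Torus → Torus → ℝ) (μ₀ : ProbabilityMeasure Torus) (ρ₀ : Torus → ℝ),
      VelocityBounded V C₁ → VelocityLipschitzSpace V C₂ → VelocityLipschitzMeasure V C₃ →
      VelocityDerivLipschitz torusProj V C₄ →
      IsDensity μ₀ ρ₀ → MemBVTorus ρ₀ →
      ∃ μ : ℝ → ProbabilityMeasure Torus,
        IsMeasureValuedSolution torusProj V μ₀ μ ∧
        (∀ μ', IsMeasureValuedSolution torusProj V μ₀ μ' → EqOn μ' μ (Ici 0)) ∧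
        (∀ t, 0 ≤ t → (μ t : Measure Torus) ≪ volume) ∧
        ∀ (r : Realization) (T : ℝ), 0 < T → ∀ ε : ℝ, 0 < ε → ∃ δ : ℝ, 0 < δ ∧
          ∀ (N : ℕ) (a τ : ℝ), 0 < N → 2 * Real.pi / N < δ →
            lam ≤ τ / (2 * Real.pi / N) → τ / (2 * Real.pi / N) ≤ C₁⁻¹ →
            supL1Dist T (approxSolution V r (torusMesh N a) τ ρ₀) μ ≤ ENNReal.ofReal ε) := by
  refine ⟨fun V μ₀ ρ₀ hb hs hm hd _ hden hbv => ?_, fun V μ₀ ρ₀ hb hs hm hd hden hbv => ?_⟩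
  · have hV : IsVelocity id V C₁ C₂ C₃ C₄ := ⟨hC₁, hC₂, hC₃, hC₄, hb, hs, hm, hd⟩
    obtain ⟨B, hρ⟩ := hbv.exists_isInitialDensity hden
    obtain ⟨μ, hμ⟩ := exists_isMeasureValuedSolution hV isLineCover_id μ₀
    obtain ⟨hac, hconv⟩ := absolutelyContinuous_and_convergence hV isLineCover_id hasCutoffs_id
      hasFineMeshes_id hμ hρ
    refine ⟨μ, hμ, fun μ' hμ' => hμ.eqOn hμ' hV isLineCover_id hasCutoffs_id, hac,
      fun r T hT ε hε => ?_⟩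
    obtain ⟨δ, hδ, H⟩ := hconv T lam ε hT hlam hε
    exact ⟨δ, hδ, fun a h τ hh hhδ hlo hhi =>
      H (lineMesh a h) _ (isUniform_lineMesh a hh) hhδ τ hlo hhi r⟩
  · have hV : IsVelocity torusProj V C₁ C₂ C₃ C₄ := ⟨hC₁, hC₂, hC₃, hC₄, hb, hs, hm, hd⟩
    obtain ⟨B, hρ⟩ := hbv.exists_isInitialDensity hden
    obtain ⟨μ, hμ⟩ := exists_isMeasureValuedSolution hV isLineCover_torusProj μ₀
    obtain ⟨hac, hconv⟩ := absolutelyContinuous_and_convergence hV isLineCover_torusProj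
      hasCutoffs_torusProj hasFineMeshes_torusProj hμ hρ
    refine ⟨μ, hμ, fun μ' hμ' => hμ.eqOn hμ' hV isLineCover_torusProj hasCutoffs_torusProj, hac,
      fun r T hT ε hε => ?_⟩
    obtain ⟨δ, hδ, H⟩ := hconv T lam ε hT hlam hε
    refine ⟨δ, hδ, fun N a τ hN hNδ hlo hhi => ?_⟩
    have : NeZero N := ⟨hN.ne'⟩
    exact H (torusMesh N a) _ (isUniform_torusMesh hN a) hNδ τ hlo hhi r
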